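/- Let $(M,\omega)$ be a symplectic manifold on which a Lie group $G$ acts smoothly and symplectically, let $X_1,\dots,X_n$ be a basis of the Lie algebra $\mathfrak g$ of $G$ with dual basis $X^1,\dots,X^n$, and identify $\mathfrak g^*$ with $\mathbb R^n$ by $\mu\mapsto\sum_l\mu_lX^l$. Functions are complex-valued. Let $u*v=uv+\sum_{r\ge1}(\lambda/2)^rC_r(u,v)$ be a $G$-invariant star product on $C^\infty(M)[[\lambda]]$: it is associative, the $C_r$ are bidifferential operators annihilating constants, and $C_1(u,v)-C_1(v,u)=2\{u,v\}$. Let $\mathfrak g_\lambda$ be $\mathfrak g[[\lambda]]$ (with complex coefficients) with the $\lambda$-bilinear bracket $[\xi,\eta]_\lambda=\lambda[\xi,\eta]$ for $\xi,\eta\in\mathfrak g$, and let $\Phi_*:\mathfrak U(\mathfrak g_\lambda)\to(C^\infty(M)[[\lambda]],*)$ be a quantum moment map, i.e. a unital homomorphism of $\mathbb C[[\lambda]]$-algebras with $\Phi_*(\xi)*u-u*\Phi_*(\xi)=\lambda\,\xi u$ for $\xi\in\mathfrak g$ and $u\in C^\infty(M)[[\lambda]]$, where $(\xi u)(x)=\frac{d}{dt}\big|_{t=0}u(\exp(-t\xi)x)$,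 whose classical part $\Phi_0=\Phi_*|_{\lambda=0}$ is a classical moment map, i.e. $\Phi_0(\xi)$ is real-valued for $\xi\in\mathfrak g$. For $p=(p^1,\dots,p^n)\in\mathbb C[[\lambda]]^n$ put $pX=\sum_kp^kX_k$, regarded either as an element of $\mathfrak g_\lambda$ or as an element of $C^\infty(\mathfrak g^*)[[\lambda]]$ (a linear function), and put $$e^{pX}=\sum_{r\ge0}\frac1{r!}(pX)^r,\qquad \exp_*(\Phi_*(pX))=\sum_{r\ge0}\frac1{r!}\,\Phi_*(pX)*\cdots*\Phi_*(pX)\quad(r\text{ factors}),$$ where each coefficient of a power of $\lambda$ is an absolutely convergent series at each point. Let $\mathcal A^0$ be the set of $u\in C^\infty(\mathbb R^n)$ for which there is $\tau\ge0$ such that each partial derivative satisfies $|\partial^Iu(\zeta)|\le C_I\langle\zeta\rangle^\tau$, where $\langle\zeta\rangle=\sqrt{1+|\zeta|^2}$; let $\mathcal A$ be the set of $a\in C^\infty(\mathbb R^n\times\mathbb R^n)$ for which there are $m\in\mathbb R$ and $\tau\ge0$ such that $|\partial_\xi^I\partial_x^Ja(\xi,x)|\le C_{I,J}\langle\xi\rangle^m\langle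 x\rangle^\tau$ for all $I,J$. For $a\in\mathcal A$ the oscillatory integral is $$\text{Os-}\!\int e^{-i\xi x}a(\xi,x)\,d\xi\,dx=(2\pi)^{-n}\lim_{\varepsilon\to0^+}\int\chi(\varepsilon\xi,\varepsilon x)\,e^{-i\xi x}a(\xi,x)\,d\xi\,dx$$ for every Schwartz function $\chi$ with $\chi(0,0)=1$. The integral extension of $\Phi_*$ to $u\in\mathcal A^0[[\lambda]]$ is $$\Phi_*(u)=\text{Os-}\!\int u(\mu)\,e^{-i\nu\mu}\exp_*(\Phi_*(i\nu X))\,d\mu\,d\nu\in C^\infty(M)[[\lambda]],$$ taken at each point of $M$ and for each power of $\lambda$. (i) Let $p\in\mathbb C[[\lambda]]^n$ be such that the constant term of each $p^k$ lies in $i\mathbb R$. Then $e^{pX}\in\mathcal A^0[[\lambda]]$, the element $\exp_*(\Phi_*(pX))$ of $C^\infty(M)[[\lambda]]$ and the oscillatory integrals defining $\Phi_*(e^{pX})$ exist (with amplitudes in $\mathcal A$), and $$\Phi_*(e^{pX})=\exp_*(\Phi_*(pX)).$$ (ii) Let $*^G$ be the Gutt star product on $C^\infty(\mathfrak g^*)[[\lambda]]$,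 that is, the differentiable deformation of the usual product (associative, given by bidifferential operators annihilating constants in positive order) with $u*^Gv=s^{-1}(s(u)\cdot s(v))$ for polynomials $u,v$, where $s$ is the symmetrization map from polynomials on $\mathfrak g^*$ to $\mathfrak U(\mathfrak g_\lambda)$. If $p,r\in\mathbb C[[\lambda]]^n$ have constant terms in $i\mathbb R$, then $e^{pX}*^Ge^{rX}\in\mathcal A^0[[\lambda]]$ and $$\Phi_*(e^{pX})*\Phi_*(e^{rX})=\Phi_*\big(e^{pX}*^Ge^{rX}\big).$$ In particular $\Phi_*(e^{i\xi})*\Phi_*(e^{i\eta})=\Phi_*(e^{i\xi}*^Ge^{i\eta})$ for $\xi,\eta\in\mathfrak g[[\lambda]]$. -/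

import Mathlib

open scoped Manifold ContDiff TensorProduct BigOperators Topology SchwartzMap Nat
open Bundle Filter MeasureTheory

noncomputable section

namespace QMM

/-- `ℝⁿ` with its Euclidean norm. -/
abbrev Euc (n : ℕ) : Type := EuclideanSpace ℝ (Fin n)

/-! ### Smooth functions and bidifferential operators -/

section Smooth

variable (d : ℕ) (M : Type*) [TopologicalSpace M] [ChartedSpace (Euc d) M]

/-- `C^∞(M)`: the complex-valued smooth functions on `M`, as a `ℂ`-algebra. -/
def SmoothFun : Subalgebra ℂ (M → ℂ) where
  carrier := {f | ContMDiff (𝓡 d) 𝓘(ℝ, ℂ) ∞ f}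
  mul_mem' hf hg := by
    have hf' : ContMDiff (𝓡 d) 𝓘(ℝ, ℂ) ∞ _ := hf
    have hg' : ContMDiff (𝓡 d) 𝓘(ℝ, ℂ) ∞ _ := hg
    exact (contDiff_mul.contMDiff.comp (hf'.prodMk_space hg') :)
  add_mem' hf hg := by
    have hf' : ContMDiff (𝓡 d) 𝓘(ℝ, ℂ) ∞ _ := hf
    have hg' : ContMDiff (𝓡 d) 𝓘(ℝ, ℂ) ∞ _ := hg
    exact (contDiff_add.contMDiff.comp (hf'.prodMk_space hg') :)
  algebraMap_mem' c := by
    exact (contMDiff_const : ContMDiff (𝓡 d) 𝓘(ℝ, ℂ) ∞ (fun _ : M => c))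

/-- `C^∞(M)[[λ]]`. The formal parameter `λ` is `PowerSeries.X`. -/
abbrev FormalFun : Type _ := PowerSeries (SmoothFun d M)

variable {d M}

/-- The value at `x` of the coefficient of `λ^j` in `f`. -/
def coeffAt (j : ℕ) (f : FormalFun d M) (x : M) : ℂ :=
  (PowerSeries.coeff j f : SmoothFun d M).1 x

/-- The `k`-jet of `u` at `x` vanishes: in the chart at `x`, all derivatives of `u` of order at
most `k` (order zero included) are zero at `x`. -/
def JetVanishes (k : ℕ) (x : M) (u : SmoothFun d M) : Prop :=
  ∀ i ≤ k, iteratedFDeriv ℝ i ((u : M → ℂ) ∘ (extChartAt (𝓡 d) x).symm)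
    (extChartAt (𝓡 d) x x) = 0

/-- A bilinear map `C^∞(M) × C^∞(M) → C^∞(M)` is a bidifferential operator (of order at most `k` in
each argument, for some `k`) when its value at each point depends only on the `k`-jets at that
point of the two arguments. -/
def IsBidifferential (B : SmoothFun d M →ₗ[ℂ] SmoothFun d M →ₗ[ℂ] SmoothFun d M) : Prop :=
  ∃ k : ℕ, ∀ (x : M) (u v : SmoothFun d M),
    JetVanishes k x u ∨ JetVanishes k x v → (B u v : M → ℂ) x = 0

end Smooth

/-! ### Differentiable deformations of the product of functions -/

section Deformation

variable (d : ℕ) (M : Type*) [TopologicalSpace M] [ChartedSpace (Euc d) M]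

variable {d M} in
/-- The `λ`-bilinear extension `f * g` to `C^∞(M)[[λ]]` of `u * v = ∑_n (λ/2)ⁿ Cₙ(u, v)`. -/
def formalProduct (C : ℕ → SmoothFun d M →ₗ[ℂ] SmoothFun d M →ₗ[ℂ] SmoothFun d M)
    (f g : FormalFun d M) : FormalFun d M :=
  PowerSeries.mk fun n =>
    ∑ p ∈ Finset.HasAntidiagonal.antidiagonal n, ∑ q ∈ Finset.HasAntidiagonal.antidiagonal p.2,
      ((1 / 2 : ℂ) ^ p.1) • C p.1 (PowerSeries.coeff q.1 f) (PowerSeries.coeff q.2 g)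

/-- An associative differentiable deformation
`u * v = u v + ∑_{n ≥ 1} (λ/2)ⁿ Cₙ(u, v)` of the product of `C^∞(M)`, with bidifferential operators
`Cₙ` which annihilate constants. -/
structure Deformation where
  /-- the cochains `Cₙ` -/
  C : ℕ → SmoothFun d M →ₗ[ℂ] SmoothFun d M →ₗ[ℂ] SmoothFun d M
  C_zero : ∀ u v, C 0 u v = u * v
  bidifferential : ∀ n, IsBidifferential (C n)
  C_one_left : ∀ n, 1 ≤ n → ∀ v, C n 1 v = 0
  C_one_right : ∀ n, 1 ≤ n → ∀ u, C n u 1 = 0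
  assoc : ∀ f g h : FormalFun d M,
    formalProduct C (formalProduct C f g) h = formalProduct C f (formalProduct C g h)

variable {d M}

/-- The product `*` on `C^∞(M)[[λ]]`. -/
def Deformation.star (S : Deformation d M) (f g : FormalFun d M) : FormalFun d M :=
  formalProduct S.C f g

/-- The powers `f * f * ⋯ * f` (`r` factors). -/
def Deformation.starPow (S : Deformation d M) (f : FormalFun d M) : ℕ → FormalFun d M
  | 0 => 1
  | r + 1 => S.star f (S.starPow f r)

/-- `E = exp_*(f) = ∑_r (1/r!) f * ⋯ * f`: for each power of `λ`, the series of the coefficients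
converges absolutely at each point, and the sums form the element `E` of `C^∞(M)[[λ]]`. -/
def Deformation.IsStarExp (S : Deformation d M) (f E : FormalFun d M) : Prop :=
  ∀ (j : ℕ) (x : M),
    HasSum (fun r : ℕ => ((r ! : ℂ))⁻¹ * coeffAt j (S.starPow f r) x)
      (coeffAt j E x)

/-- `E = e^f = ∑_r (1/r!) f^r` for the usual product of functions, in the sense of formal absolute
convergence. -/
def IsFormalExp (f E : FormalFun d M) : Prop :=
  ∀ (j : ℕ) (x : M),
    HasSum (fun r : ℕ => ((r ! : ℂ))⁻¹ * coeffAt j (f ^ r) x)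
      (coeffAt j E x)

end Deformation

/-! ### Symplectic manifolds and star products -/

section Symplectic

variable (d : ℕ) (M : Type*) [TopologicalSpace M] [ChartedSpace (Euc d) M]
  [IsManifold (𝓡 d) ∞ M]

/-- A symplectic form: a smooth, nondegenerate, closed 2-form. Closedness is
`dω(U, V, W) = 0` for all smooth vector fields `U`, `V`, `W`. -/
structure SymplecticForm where
  /-- the form -/
  form : ∀ x : M, TangentSpace (𝓡 d) x →L[ℝ] TangentSpace (𝓡 d) x →L[ℝ] ℝ
  alternating : ∀ x v, form x v v = 0
  nondegenerate : ∀ x, Function.Bijective (form x)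
  smooth : ContMDiff (𝓡 d) ((𝓡 d).prod 𝓘(ℝ, Euc d →L[ℝ] Euc d →L[ℝ] ℝ)) ∞
    (fun x ↦ TotalSpace.mk' (Euc d →L[ℝ] Euc d →L[ℝ] ℝ)
      (E := fun x : M => TangentSpace (𝓡 d) x →L[ℝ] TangentSpace (𝓡 d) x →L[ℝ] ℝ) x (form x))
  closed : ∀ U V W : (x : M) → TangentSpace (𝓡 d) x,
    ContMDiff (𝓡 d) (𝓡 d).tangent ∞ (fun x => (⟨x, U x⟩ : TangentBundle (𝓡 d) M)) →
    ContMDiff (𝓡 d) (𝓡 d).tangent ∞ (fun x => (⟨x, V x⟩ : TangentBundle (𝓡 d) M)) →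
    ContMDiff (𝓡 d) (𝓡 d).tangent ∞ (fun x => (⟨x, W x⟩ : TangentBundle (𝓡 d) M)) →
    ∀ x : M,
      mvfderiv (𝓡 d) (fun y => form y (V y) (W y)) x (U x)
      - mvfderiv (𝓡 d) (fun y => form y (U y) (W y)) x (V x)
      + mvfderiv (𝓡 d) (fun y => form y (U y) (V y)) x (W x)
      - form x (VectorField.mlieBracket (𝓡 d) U V x) (W x)
      + form x (VectorField.mlieBracket (𝓡 d) U W x) (V x)
      - form x (VectorField.mlieBracket (𝓡 d) V W x) (U x) = 0

variable {d M}

/-- The differential `du_x : T_xM → ℂ`. -/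
def differential (u : SmoothFun d M) (x : M) : TangentSpace (𝓡 d) x →L[ℝ] ℂ :=
  mfderiv (𝓡 d) 𝓘(ℝ, ℂ) (u : M → ℂ) x

/-- The vector `V ∈ T_xM` with `ω(V, ·) = α`. -/
def SymplecticForm.sharp (Ω : SymplecticForm d M) (x : M)
    (α : TangentSpace (𝓡 d) x →L[ℝ] ℝ) : TangentSpace (𝓡 d) x :=
  (LinearEquiv.ofBijective (Ω.form x).toLinearMap (Ω.nondegenerate x)).symm α

/-- The Poisson bracket `{u, v} = dv(X_u)`, with `ω(X_u, ·) = du`, extended `ℂ`-bilinearly to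
complex-valued functions. -/
def SymplecticForm.poisson (Ω : SymplecticForm d M) (u v : SmoothFun d M) (x : M) : ℂ :=
  differential v x (Ω.sharp x (Complex.reCLM.comp (differential u x)))
    + Complex.I * differential v x (Ω.sharp x (Complex.imCLM.comp (differential u x)))

/-- A star product on `(M, ω)`: a deformation with `C₁(u, v) - C₁(v, u) = 2 {u, v}`. -/
def IsStarProduct (Ω : SymplecticForm d M) (S : Deformation d M) : Prop :=
  ∀ (u v : SmoothFun d M) (x : M),
    (S.C 1 u v : M → ℂ) x - (S.C 1 v u : M → ℂ) x = 2 * Ω.poisson u v x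

end Symplectic

/-! ### Group actions -/

section Action

variable {d n : ℕ} {M : Type*} [TopologicalSpace M] [ChartedSpace (Euc d) M]
  [IsManifold (𝓡 d) ∞ M]
  {G : Type*} [TopologicalSpace G] [ChartedSpace (Euc n) G] [Group G] [MulAction G M]

/-- The action of `G` on `(M, ω)` is smooth and preserves `ω`. -/
structure IsSymplecticAction (n : ℕ) (G : Type*) [TopologicalSpace G] [ChartedSpace (Euc n) G]
    [Group G] [MulAction G M] (Ω : SymplecticForm d M) : Prop where
  smooth : ContMDiff ((𝓡 n).prod (𝓡 d)) (𝓡 d) ∞ (fun p : G × M => p.1 • p.2)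
  preserves : ∀ (g : G) (x : M) (v w : TangentSpace (𝓡 d) x),
    Ω.form (g • x) (mfderiv (𝓡 d) (𝓡 d) (fun y : M => g • y) x v)
      (mfderiv (𝓡 d) (𝓡 d) (fun y : M => g • y) x w) = Ω.form x v w

theorem IsSymplecticAction.smooth_smul {Ω : SymplecticForm d M} (h : IsSymplecticAction n G Ω)
    (g : G) : ContMDiff (𝓡 d) (𝓡 d) ∞ (fun y : M => g • y) :=
  h.smooth.comp (contMDiff_const.prodMk contMDiff_id)

/-- The function `(gu)(x) = u(g⁻¹ x)`. -/
def translate {Ω : SymplecticForm d M} (h : IsSymplecticAction n G Ω) (g : G)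
    (u : SmoothFun d M) : SmoothFun d M :=
  ⟨fun x => (u : M → ℂ) (g⁻¹ • x), by
    have hu : ContMDiff (𝓡 d) 𝓘(ℝ, ℂ) ∞ (u : M → ℂ) := u.2
    exact hu.comp (h.smooth_smul g⁻¹)⟩

/-- `G`-invariance of a star product: `g(u * v) = gu * gv` on `C^∞(M)[[λ]]`, where `G` acts
coefficientwise. -/
def IsInvariant {Ω : SymplecticForm d M} (h : IsSymplecticAction n G Ω)
    (S : Deformation d M) : Prop :=
  let act : G → FormalFun d M → FormalFun d M := fun g f =>
    PowerSeries.mk fun j => translate h g (PowerSeries.coeff j f)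
  ∀ (g : G) (f₁ f₂ : FormalFun d M), act g (S.star f₁ f₂) = S.star (act g f₁) (act g f₂)

/-- The infinitesimal action `(ξu)(x) = d/dt u(exp(-tξ) x)` at `t = 0`, that is, the derivative of
`g ↦ (gu)(x) = u(g⁻¹ x)` at the identity in the direction `ξ`. -/
def infAction (ξ : GroupLieAlgebra (𝓡 n) G) (u : SmoothFun d M) (x : M) : ℂ :=
  mfderiv (𝓡 n) 𝓘(ℝ, ℂ) (fun g : G => (u : M → ℂ) (g⁻¹ • x)) 1 ξ

end Action

/-! ### The Lie algebra `𝔤_λ` and its universal enveloping algebra -/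

section Algebra

/-- For a Lie algebra `K` over `R` and `t ∈ R`, the module `K` with the bracket `t [x, y]`. -/
def ScaledLie {R : Type*} (_t : R) (K : Type*) : Type _ := K

section Scaled

variable {R : Type*} [CommRing R] (t : R) (K : Type*) [LieRing K] [LieAlgebra R K]

instance : AddCommGroup (ScaledLie t K) := inferInstanceAs (AddCommGroup K)

instance : Module R (ScaledLie t K) := inferInstanceAs (Module R K)

/-- The bracket `t [x, y]`. -/
def scaledBracket (x y : K) : K := t • ⁅x, y⁆

instance : LieRing (ScaledLie t K) where
  bracket x y := scaledBracket t K x y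
  add_lie x y z := by
    have h : ∀ x y z : K, t • ⁅x + y, z⁆ = t • ⁅x, z⁆ + t • ⁅y, z⁆ := fun x y z => by
      rw [add_lie, smul_add]
    exact h x y z
  lie_add x y z := by
    have h : ∀ x y z : K, t • ⁅x, y + z⁆ = t • ⁅x, y⁆ + t • ⁅x, z⁆ := fun x y z => by
      rw [lie_add, smul_add]
    exact h x y z
  lie_self x := by
    have h : ∀ x : K, t • ⁅x, x⁆ = 0 := fun x => by rw [lie_self, smul_zero]
    exact h x
  leibniz_lie x y z := by
    have h : ∀ x y z : K, t • ⁅x, t • ⁅y, z⁆⁆ = t • ⁅t • ⁅x, y⁆, z⁆ + t • ⁅y, t • ⁅x, z⁆⁆ :=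
      fun x y z => by rw [lie_smul, lie_smul, smul_lie, leibniz_lie x y z, smul_add, smul_add]
    exact h x y z

instance : LieAlgebra R (ScaledLie t K) where
  lie_smul a x y := by
    have h : ∀ x y : K, t • ⁅x, a • y⁆ = a • (t • ⁅x, y⁆) := fun x y => by
      rw [lie_smul, smul_comm]
    exact h x y

end Scaled

variable (L : Type*) [LieRing L] [LieAlgebra ℝ L]

/-- `𝔤_λ = 𝔤[[λ]]` with complex coefficients, that is `ℂ[[λ]] ⊗ 𝔤` for a finite-dimensional `𝔤`,
with the `ℂ[[λ]]`-bilinear bracket such that `[ξ, η]_λ = λ[ξ, η]` for `ξ, η ∈ 𝔤`. -/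
abbrev LieLambda : Type _ := ScaledLie (PowerSeries.X : PowerSeries ℂ) (PowerSeries ℂ ⊗[ℝ] L)

/-- `𝔘(𝔤_λ)`. -/
abbrev EnvLambda : Type _ := UniversalEnvelopingAlgebra (PowerSeries ℂ) (LieLambda L)

variable {L}

/-- The element `a ξ` of `𝔤_λ`, for `a ∈ ℂ[[λ]]` and `ξ ∈ 𝔤`. -/
def LieLambda.of (a : PowerSeries ℂ) (ξ : L) : LieLambda L :=
  (a ⊗ₜ[ℝ] ξ : PowerSeries ℂ ⊗[ℝ] L)

/-- The canonical map `𝔤_λ → 𝔘(𝔤_λ)`. -/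
def toEnv (ξ : LieLambda L) : EnvLambda L :=
  UniversalEnvelopingAlgebra.ι (PowerSeries ℂ) ξ

variable {n : ℕ} (b : Module.Basis (Fin n) ℝ L)

/-- `pX = ∑_k p^k X_k ∈ 𝔤_λ`. -/
def combination (p : Fin n → PowerSeries ℂ) : LieLambda L :=
  ∑ k, LieLambda.of (p k) (b k)

/-- The symmetrized monomial `s(X^m) ∈ 𝔘(𝔤_λ)`: the average of the products
`X_{f 1} X_{f 2} ⋯ X_{f |m|}` over all `|m|! / m!` orderings `f` of the factors of `X^m`. -/
def symmMonomial (m : Fin n →₀ ℕ) : EnvLambda L :=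
  PowerSeries.C (((∏ i, (m i)! : ℕ) : ℂ) / ((∑ i, m i)! : ℂ)) •
    ∑ f : Fin (∑ i, m i) → Fin n with (∀ i, (Finset.univ.filter fun j => f j = i).card = m i),
      (List.ofFn fun j => toEnv (LieLambda.of 1 (b (f j)))).prod

/-- The symmetrization map `s : 𝔖(𝔤_λ) → 𝔘(𝔤_λ)`; `𝔖(𝔤_λ)` is the algebra of polynomials over
`ℂ[[λ]]` in the basis vectors `X_k`. -/
def symmetrization : MvPolynomial (Fin n) (PowerSeries ℂ) →ₗ[PowerSeries ℂ] EnvLambda L :=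
  (MvPolynomial.basisMonomials (Fin n) (PowerSeries ℂ)).constr (PowerSeries ℂ) (symmMonomial b)

end Algebra

/-! ### Functions on `𝔤^* ≅ ℝⁿ` and the Gutt star product

A basis `X_1, …, X_n` of `𝔤` identifies `𝔤^*` with `ℝⁿ`: the point `μ` of `ℝⁿ` stands for
`∑ μ_l X^l`, and `X_l`, as a linear function on `𝔤^*`, is the coordinate function `μ ↦ μ_l`. -/

section Gutt

variable {n : ℕ}

/-- The coordinate function `X_l` on `𝔤^*`. -/
def coord (l : Fin n) : SmoothFun n (Euc n) :=
  ⟨fun μ => ((μ l : ℝ) : ℂ), by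
    have h : ContDiff ℝ ∞ (fun μ : Euc n => ((μ l : ℝ) : ℂ)) :=
      Complex.ofRealCLM.contDiff.comp (EuclideanSpace.proj (𝕜 := ℝ) l).contDiff
    exact h.contMDiff⟩

/-- The polynomial function in `C^∞(𝔤^*)[[λ]]` given by an element of `𝔖(𝔤_λ)`. -/
def polyFun : MvPolynomial (Fin n) (PowerSeries ℂ) →ₐ[PowerSeries ℂ] FormalFun n (Euc n) :=
  MvPolynomial.aeval fun l => PowerSeries.C (coord l)

/-- The linear function `pX = ∑_k p^k X_k` on `𝔤^*`, an element of `C^∞(𝔤^*)[[λ]]`. -/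
def linearFun (p : Fin n → PowerSeries ℂ) : FormalFun n (Euc n) :=
  ∑ k, p k • PowerSeries.C (coord k)

/-- `S` is the Gutt star product on `C^∞(𝔤^*)[[λ]]`: the extension by bidifferential operators of
the product `u *^G v = s⁻¹(s(u) · s(v))` of polynomials. -/
def IsGutt {L : Type*} [LieRing L] [LieAlgebra ℝ L] (b : Module.Basis (Fin n) ℝ L)
    (S : Deformation n (Euc n)) : Prop :=
  ∀ P Q : MvPolynomial (Fin n) (PowerSeries ℂ),
    ∃ W : MvPolynomial (Fin n) (PowerSeries ℂ),
      symmetrization b W = symmetrization b P * symmetrization b Q ∧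
        S.star (polyFun P) (polyFun Q) = polyFun W

end Gutt

/-! ### Oscillatory integrals -/

section Oscillatory

variable {n : ℕ}

/-- `⟨x⟩ = √(1 + |x|²)`. -/
def japanese (x : Euc n) : ℝ := Real.sqrt (1 + ‖x‖ ^ 2)

/-- The symbol class `𝒜⁰ = ⋃_{τ ≥ 0} 𝒜⁰_τ` of smooth functions on `ℝⁿ` of polynomial increase:
all derivatives are bounded by constants times the same power `⟨x⟩^τ`. -/
def InSymbolClassZero (u : Euc n → ℂ) : Prop :=
  ContDiff ℝ ∞ u ∧ ∃ τ : ℝ, 0 ≤ τ ∧ ∀ k : ℕ, ∃ C : ℝ, ∀ x,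
    ‖iteratedFDeriv ℝ k u x‖ ≤ C * japanese x ^ τ

/-- The symbol class `𝒜 = ⋃_{m, τ} 𝒜^m_τ` of amplitudes `a(ξ, x)`. -/
def InSymbolClass (a : Euc n × Euc n → ℂ) : Prop :=
  ContDiff ℝ ∞ a ∧ ∃ m τ : ℝ, 0 ≤ τ ∧ ∀ k : ℕ, ∃ C : ℝ, ∀ z,
    ‖iteratedFDeriv ℝ k a z‖ ≤ C * japanese z.1 ^ m * japanese z.2 ^ τ

/-- `a ∈ 𝒜` and `Os-∫ e^{-iξx} a(ξ, x) dξ dx = c`, that is,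
`(2π)⁻ⁿ ∫ χ(εξ, εx) e^{-iξx} a(ξ, x) dξ dx → c` as `ε → 0`, for every Schwartz function `χ` with
`χ(0, 0) = 1`. -/
def HasOscIntegral (a : Euc n × Euc n → ℂ) (c : ℂ) : Prop :=
  InSymbolClass a ∧ ∀ χ : 𝓢(Euc n × Euc n, ℂ), χ 0 = 1 →
    Tendsto (fun ε : ℝ => (((2 * Real.pi) ^ n : ℝ) : ℂ)⁻¹ *
        ∫ z : Euc n × Euc n,
          χ (ε • z) * Complex.exp (-Complex.I * ((∑ l, z.1 l * z.2 l : ℝ) : ℂ)) * a z)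
      (𝓝[>] 0) (𝓝 c)

end Oscillatory

/-! ### Quantum moment maps -/

section QuantumMomentMap

variable {d n : ℕ} {M : Type*} [TopologicalSpace M] [ChartedSpace (Euc d) M]
  [IsManifold (𝓡 d) ∞ M]

instance : ENat.LEInfty (minSmoothness ℝ 3) :=
  ⟨by
    rw [minSmoothness_of_isRCLikeNormedField]
    exact ENat.LEInfty.out⟩

/-- A quantum moment map `Φ_* : 𝔘(𝔤_λ) → C^∞(M)[[λ]]` of a star product on the `G`-space `M`. -/
structure QuantumMomentMap (n : ℕ) (G : Type*) [TopologicalSpace G] [ChartedSpace (Euc n) G]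
    [Group G] [LieGroup (𝓡 n) ∞ G] [MulAction G M] (S : Deformation d M) where
  /-- the underlying `ℂ[[λ]]`-linear map -/
  toLin : EnvLambda (GroupLieAlgebra (𝓡 n) G) →ₗ[PowerSeries ℂ] FormalFun d M
  map_one : toLin 1 = 1
  map_mul : ∀ a b, toLin (a * b) = S.star (toLin a) (toLin b)
  /-- `[Φ_*(ξ), u]_* = λ ξu`: the coefficient of `λ⁰` vanishes, and that of `λ^{j+1}` is `ξ u_j` -/
  commutator : ∀ (ξ : GroupLieAlgebra (𝓡 n) G) (u : FormalFun d M),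
    PowerSeries.coeff 0 (S.star (toLin (toEnv (LieLambda.of 1 ξ))) u
      - S.star u (toLin (toEnv (LieLambda.of 1 ξ)))) = 0 ∧
    ∀ (j : ℕ) (x : M),
      coeffAt (j + 1) (S.star (toLin (toEnv (LieLambda.of 1 ξ))) u
        - S.star u (toLin (toEnv (LieLambda.of 1 ξ)))) x
        = infAction ξ (PowerSeries.coeff j u) x
  /-- the classical part `Φ_0` is a classical moment map `M → 𝔤^*`: each `Φ_0(ξ)` is real-valued -/
  classical_real : ∀ (ξ : GroupLieAlgebra (𝓡 n) G) (x : M),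
    (coeffAt 0 (toLin (toEnv (LieLambda.of 1 ξ))) x).im = 0

variable {G : Type*} [TopologicalSpace G] [ChartedSpace (Euc n) G]
    [Group G] [LieGroup (𝓡 n) ∞ G] [MulAction G M] {S : Deformation d M}

/-- `Φ_*(pX) = Φ_*(∑_k p^k X_k)`. -/
def QuantumMomentMap.linear (Φ : QuantumMomentMap n G S)
    (b : Module.Basis (Fin n) ℝ (GroupLieAlgebra (𝓡 n) G)) (p : Fin n → PowerSeries ℂ) :
    FormalFun d M :=
  Φ.toLin (toEnv (combination b p))

/-- `u ∈ 𝒜⁰[[λ]]` and `F = Φ_*(u)` for the integral extension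
`Φ_*(u) = Os-∫ u(μX) e^{-iνμ} exp_*(Φ_*(iνX)) dμ dν` of the quantum moment map. The integral is
taken at each point of `M` and in each power of `λ`; `𝓔 ν` is `exp_*(Φ_*(iνX))`. -/
def QuantumMomentMap.IsExtension (Φ : QuantumMomentMap n G S)
    (b : Module.Basis (Fin n) ℝ (GroupLieAlgebra (𝓡 n) G))
    (u : FormalFun n (Euc n)) (F : FormalFun d M) : Prop :=
  (∀ j, InSymbolClassZero (coeffAt j u)) ∧
  ∃ 𝓔 : Euc n → FormalFun d M,
    (∀ ν : Euc n, S.IsStarExp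
      (Φ.linear b fun k => PowerSeries.C (Complex.I * ((ν k : ℝ) : ℂ))) (𝓔 ν)) ∧
    ∀ (m : ℕ) (x : M),
      HasOscIntegral
        (fun z : Euc n × Euc n => ∑ q ∈ Finset.HasAntidiagonal.antidiagonal m,
          coeffAt q.1 u z.2 *
            coeffAt q.2 (𝓔 z.1) x)
        (coeffAt m F x)

end QuantumMomentMap

end QMM

end

/-! Let T be the quantum moment map composed with symmetrization, a map from polynomials on 𝔤* to
C^∞(M)[[λ]], and let J : M → ℝⁿ be the classical moment map. Everything rests on one fact: the
coefficient of λ^m in T(W) at x depends only on a finite jet of W at J(x).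

Symmetrization turns powers of affine polynomials into powers in 𝔘(𝔤_λ), so T turns them into star
powers (`symmetrization_affinePoly_pow`, `isQuantization`). Since the C_a are differential
operators, the λ^m coefficient of the r-th star power of g is divisible by g₀^(r - K(m)), where g₀
is the classical part of g (`exists_pow_dvd_starPow`). If the affine polynomial vanishes at J(x),
then g₀(x) = 0, and the coefficient vanishes at x once r > K(m). Polarization carries this to all
homogeneous polynomials of degree r in X - J(x) (`symbolPart_taylorPart`). Hence T extends to smooth
functions as a formal series of differential operators along J: take the Taylor polynomial at J(x)
and apply T (`extension`).

This extension is the integral extension. The λ^m coefficient of exp_*(Φ_*(iνX)) at x is a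
polynomial in ν times e^{iν·J(x)}. Fourier inversion handles the exponential, and integration by
parts turns each factor iν_l into ∂_l acting on u, so the oscillatory integral of u is `extension`
applied to u (`hasOscIntegral_extension`). Part (i) follows because `extension` sends the series of
e^{pX} termwise to the star exponential (`isStarExp`).

For (ii), both sides of the multiplicativity of `extension` depend, at a given order in λ and a
given point x, on finite jets at J(x). Polynomials realize all jets, and on polynomials the identity
is the homomorphism property of Φ_* (`extension_star`). The Gutt product preserves 𝒜⁰ because its
cochains map polynomials to polynomials, so their coefficients have polynomial growth
(`star_mem_formalSymbolZero`). -/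

noncomputable section

namespace QMM

/-! ### Vanishing order of smooth functions at a point. -/

section Jets

variable {d : ℕ} {M : Type*} [TopologicalSpace M] [ChartedSpace (Euc d) M]

/-- `u` in the chart at `x`. -/
def chartRep (x : M) (u : SmoothFun d M) : Euc d → ℂ :=
  (u : M → ℂ) ∘ (extChartAt (𝓡 d) x).symm

/-- All derivatives of `u` of order less than `a` vanish at `x`. -/
def VanishBelow (a : ℕ) (x : M) (u : SmoothFun d M) : Prop :=
  ∀ i < a, iteratedFDeriv ℝ i (chartRep x u) (extChartAt (𝓡 d) x x) = 0

/-- Counting derivatives with a strict bound makes orders of vanishing add under products, and makes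
order zero an empty condition. -/
theorem jetVanishes_iff {k : ℕ} {x : M} {u : SmoothFun d M} :
    JetVanishes k x u ↔ VanishBelow (k + 1) x u := by
  simp only [JetVanishes, VanishBelow, chartRep, Nat.lt_succ_iff]

theorem VanishBelow.mono {a b : ℕ} {x : M} {u : SmoothFun d M} (h : VanishBelow b x u)
    (hab : a ≤ b) : VanishBelow a x u := fun i hi => h i (hi.trans_le hab)

theorem VanishBelow.apply_eq_zero {a : ℕ} {x : M} {u : SmoothFun d M}
    (h : VanishBelow (a + 1) x u) : (u : M → ℂ) x = 0 := by
  have := congrArg (fun T => T 0) (h 0 (Nat.succ_pos a))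
  simpa [chartRep] using this

theorem vanishBelow_zero (x : M) (u : SmoothFun d M) : VanishBelow 0 x u :=
  fun i hi => absurd hi (Nat.not_lt_zero i)

theorem vanishBelow_one {x : M} {u : SmoothFun d M} (h : (u : M → ℂ) x = 0) :
    VanishBelow 1 x u := by
  intro i hi
  obtain rfl : i = 0 := by omega
  ext m
  simpa [chartRep] using h

theorem vanishBelow_zero_fun (a : ℕ) (x : M) : VanishBelow a x (0 : SmoothFun d M) := by
  intro i _
  have : chartRep x (0 : SmoothFun d M) = fun _ => 0 := rfl
  rw [this]
  simp

variable [IsManifold (𝓡 d) ∞ M]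

theorem contDiffOn_chartRep (x : M) (u : SmoothFun d M) :
    ContDiffOn ℝ ∞ (chartRep x u) (extChartAt (𝓡 d) x).target := by
  have hu : ContMDiff (𝓡 d) 𝓘(ℝ, ℂ) ∞ (u : M → ℂ) := u.2
  exact (hu.comp_contMDiffOn (contMDiffOn_extChartAt_symm x)).contDiffOn

theorem contDiffAt_chartRep (x : M) (u : SmoothFun d M) :
    ContDiffAt ℝ ∞ (chartRep x u) (extChartAt (𝓡 d) x x) :=
  (contDiffOn_chartRep x u).contDiffAt
    ((isOpen_extChartAt_target x).mem_nhds (mem_extChartAt_target x))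

theorem contDiffAt_chartRep_nat (x : M) (u : SmoothFun d M) (i : ℕ) :
    ContDiffAt ℝ i (chartRep x u) (extChartAt (𝓡 d) x x) :=
  (contDiffAt_chartRep x u).of_le (by exact_mod_cast le_top)

theorem VanishBelow.add {a : ℕ} {x : M} {u v : SmoothFun d M} (hu : VanishBelow a x u)
    (hv : VanishBelow a x v) : VanishBelow a x (u + v) := by
  intro i hi
  have : chartRep x (u + v) = chartRep x u + chartRep x v := rfl
  rw [this, iteratedFDeriv_add_apply (contDiffAt_chartRep_nat x u i) (contDiffAt_chartRep_nat x v i),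
    hu i hi, hv i hi, add_zero]

/-- In each Leibniz term of order `i < a + b`, either the first factor is differentiated fewer than
`a` times or the second fewer than `b` times. -/
theorem VanishBelow.mul {a b : ℕ} {x : M} {u v : SmoothFun d M} (hu : VanishBelow a x u)
    (hv : VanishBelow b x v) : VanishBelow (a + b) x (u * v) := by
  intro i hi
  have ht := isOpen_extChartAt_target (I := 𝓡 d) x
  have hx := mem_extChartAt_target (I := 𝓡 d) x
  have h := norm_iteratedFDerivWithin_mul_le (contDiffOn_chartRep x u) (contDiffOn_chartRep x v)
    ht.uniqueDiffOn hx (n := i) (by exact_mod_cast le_top)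
  simp only [iteratedFDerivWithin_of_isOpen _ ht hx] at h
  have h0 : ∑ k ∈ Finset.range (i + 1), (i.choose k : ℝ) *
      ‖iteratedFDeriv ℝ k (chartRep x u) (extChartAt (𝓡 d) x x)‖ *
      ‖iteratedFDeriv ℝ (i - k) (chartRep x v) (extChartAt (𝓡 d) x x)‖ = 0 := by
    refine Finset.sum_eq_zero fun k hk => ?_
    rw [Finset.mem_range] at hk
    by_cases hka : k < a
    · rw [hu k hka]; simp
    · rw [hv (i - k) (by omega)]; simp
  rw [h0] at h
  exact norm_le_zero_iff.1 h

theorem VanishBelow.mul_right {a : ℕ} {x : M} {u : SmoothFun d M} (hu : VanishBelow a x u)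
    (v : SmoothFun d M) : VanishBelow a x (u * v) := by
  simpa using hu.mul (vanishBelow_zero x v)

theorem VanishBelow.mul_left {a : ℕ} {x : M} {u : SmoothFun d M} (hu : VanishBelow a x u)
    (v : SmoothFun d M) : VanishBelow a x (v * u) := by
  simpa using (vanishBelow_zero x v).mul hu

theorem VanishBelow.smul {a : ℕ} {x : M} {u : SmoothFun d M} (hu : VanishBelow a x u)
    (c : ℂ) : VanishBelow a x (c • u) := by
  rw [Algebra.smul_def]; exact hu.mul_left _

theorem VanishBelow.sum {ι : Type*} {s : Finset ι} {a : ℕ} {x : M} {u : ι → SmoothFun d M}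
    (h : ∀ i ∈ s, VanishBelow a x (u i)) : VanishBelow a x (∑ i ∈ s, u i) := by
  classical
  induction s using Finset.induction_on with
  | empty => simpa using vanishBelow_zero_fun a x
  | insert i s hi ih =>
    rw [Finset.sum_insert hi]
    exact (h i (by simp)).add (ih fun j hj => h j (by simp [hj]))

theorem vanishBelow_pow {x : M} {h : SmoothFun d M} (hx : (h : M → ℂ) x = 0) (k : ℕ) :
    VanishBelow k x (h ^ k) := by
  induction k with
  | zero => exact vanishBelow_zero _ _
  | succ k ih => rw [pow_succ]; exact ih.mul (vanishBelow_one hx)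

end Jets

/-! ### Pullback along a smooth map to ℝⁿ. -/

section Pullback

variable {d n : ℕ} {M : Type*} [TopologicalSpace M] [ChartedSpace (Euc d) M]

theorem contDiff_coe (u : SmoothFun n (Euc n)) : ContDiff ℝ ∞ (u : Euc n → ℂ) :=
  (contMDiff_iff_contDiff.1 u.2 :)

/-- Pullback of smooth functions on `ℝⁿ` along a smooth map. -/
def pullback (mom : M → Euc n) (hmom : ContMDiff (𝓡 d) (𝓡 n) ∞ mom) :
    SmoothFun n (Euc n) →ₐ[ℂ] SmoothFun d M where
  toFun u := ⟨fun x => (u : Euc n → ℂ) (mom x), by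
    have hu : ContMDiff (𝓡 n) 𝓘(ℝ, ℂ) ∞ (u : Euc n → ℂ) := u.2
    exact hu.comp hmom⟩
  map_one' := rfl
  map_mul' _ _ := rfl
  map_zero' := rfl
  map_add' _ _ := rfl
  commutes' _ := rfl

theorem chartRep_euc (y : Euc n) (u : SmoothFun n (Euc n)) : chartRep y u = (u : Euc n → ℂ) := by
  rfl

theorem extChartAt_euc (y : Euc n) : extChartAt (𝓡 n) y y = y := rfl

/-- Faà di Bruno: each term of the derivative of order `i` contains a derivative of `u` of order
`c.length ≤ i < a`, taken at `mom x`. -/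
theorem VanishBelow.pullback [IsManifold (𝓡 d) ∞ M] {mom : M → Euc n}
    {hmom : ContMDiff (𝓡 d) (𝓡 n) ∞ mom} {a : ℕ} {x : M} {u : SmoothFun n (Euc n)}
    (hu : VanishBelow a (mom x) u) : VanishBelow a x (pullback mom hmom u) := by
  intro i hi
  have hrep : chartRep x (QMM.pullback mom hmom u) =
      (u : Euc n → ℂ) ∘ (mom ∘ (extChartAt (𝓡 d) x).symm) := rfl
  have hf : ContDiffAt ℝ ∞ (mom ∘ (extChartAt (𝓡 d) x).symm) (extChartAt (𝓡 d) x x) :=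
    ((hmom.comp_contMDiffOn (contMDiffOn_extChartAt_symm x)).contDiffOn).contDiffAt
      ((isOpen_extChartAt_target x).mem_nhds (mem_extChartAt_target x))
  have hpt : (mom ∘ (extChartAt (𝓡 d) x).symm) (extChartAt (𝓡 d) x x) = mom x := by simp
  rw [hrep, iteratedFDeriv_comp (n := ∞) (contDiff_coe u).contDiffAt hf (by exact_mod_cast le_top)]
  unfold FormalMultilinearSeries.taylorComp
  refine Finset.sum_eq_zero fun c _ => ?_
  have h0 : iteratedFDeriv ℝ c.length (u : Euc n → ℂ) (mom x) = 0 := by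
    have := hu c.length (c.length_le.trans_lt hi)
    rwa [chartRep_euc, extChartAt_euc] at this
  ext v
  rw [hpt]
  simp only [FormalMultilinearSeries.compAlongOrderedFinpartition_apply, ftaylorSeries, h0]
  rfl

end Pullback

/-! ### Partial derivatives on ℝⁿ. -/

section PartialDerivatives

variable {n : ℕ}

/-- The standard basis vector of `ℝⁿ`. -/
abbrev eVec (l : Fin n) : Euc n := EuclideanSpace.single l 1

/-- The partial derivative `∂/∂x_l`. -/
def pd (l : Fin n) : SmoothFun n (Euc n) →ₗ[ℂ] SmoothFun n (Euc n) where
  toFun u := ⟨fun x => fderiv ℝ (u : Euc n → ℂ) x (eVec l), by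
    have h : ContDiff ℝ ∞ (fun x => fderiv ℝ (u : Euc n → ℂ) x (eVec l)) :=
      ((contDiff_coe u).fderiv_right (m := ∞) (by simp)).clm_apply contDiff_const
    exact h.contMDiff⟩
  map_add' u v := by
    ext x
    change fderiv ℝ ((u : Euc n → ℂ) + (v : Euc n → ℂ)) x (eVec l) = _
    rw [fderiv_add ((contDiff_coe u).differentiable (by simp) x) ((contDiff_coe v).differentiable (by simp) x)]
    rfl
  map_smul' c u := by
    ext x
    change fderiv ℝ (c • (u : Euc n → ℂ)) x (eVec l) = _
    rw [fderiv_const_smul ((contDiff_coe u).differentiable (by simp) x)]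
    rfl

theorem pd_mul (l : Fin n) (u v : SmoothFun n (Euc n)) :
    pd l (u * v) = u * pd l v + v * pd l u := by
  ext x
  change fderiv ℝ ((u : Euc n → ℂ) * (v : Euc n → ℂ)) x (eVec l) = _
  rw [fderiv_mul ((contDiff_coe u).differentiable (by simp) x) ((contDiff_coe v).differentiable (by simp) x)]
  rfl

theorem pd_one (l : Fin n) : pd l (1 : SmoothFun n (Euc n)) = 0 := by
  ext x
  change fderiv ℝ (fun _ : Euc n => (1 : ℂ)) x (eVec l) = _
  simp

theorem pd_algebraMap (l : Fin n) (c : ℂ) : pd l (algebraMap ℂ (SmoothFun n (Euc n)) c) = 0 := by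
  rw [Algebra.algebraMap_eq_smul_one, map_smul, pd_one, smul_zero]

theorem pd_coord (l k : Fin n) : pd l (coord k) = if l = k then 1 else 0 := by
  ext x
  change fderiv ℝ (fun μ : Euc n => ((μ k : ℝ) : ℂ)) x (eVec l) = _
  have h : HasFDerivAt (fun μ : Euc n => ((μ k : ℝ) : ℂ))
      (Complex.ofRealCLM.comp (EuclideanSpace.proj (𝕜 := ℝ) k)) x :=
    (Complex.ofRealCLM.comp (EuclideanSpace.proj (𝕜 := ℝ) k)).hasFDerivAt
  rw [h.fderiv]
  by_cases hlk : l = k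
  · subst hlk; simp
  · have : k ≠ l := fun h => hlk h.symm
    simp [hlk, this]

theorem pd_comm (l k : Fin n) (u : SmoothFun n (Euc n)) : pd l (pd k u) = pd k (pd l u) := by
  ext x
  have hd : DifferentiableAt ℝ (fderiv ℝ (u : Euc n → ℂ)) x :=
    ((contDiff_coe u).fderiv_right (m := ∞) (by simp)).differentiable (by simp) x
  have key : ∀ a b : Fin n, (pd a (pd b u) : Euc n → ℂ) x =
      fderiv ℝ (fderiv ℝ (u : Euc n → ℂ)) x (eVec a) (eVec b) := by
    intro a b
    change fderiv ℝ (fun z => fderiv ℝ (u : Euc n → ℂ) z (eVec b)) x (eVec a) = _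
    rw [fderiv_clm_apply hd (differentiableAt_const _)]
    simp
  rw [key, key]
  exact ((contDiff_coe u).contDiffAt.isSymmSndFDerivAt (by
    rw [minSmoothness_of_isRCLikeNormedField]; exact WithTop.coe_le_coe.2 (le_top : (2 : ℕ∞) ≤ ⊤))).eq _ _

theorem VanishBelow.pd {a : ℕ} {y : Euc n} {u : SmoothFun n (Euc n)}
    (h : VanishBelow (a + 1) y u) (l : Fin n) : VanishBelow a y (pd l u) := by
  intro i hi
  have h1 := h (i + 1) (by omega)
  rw [chartRep_euc, extChartAt_euc] at *
  have h2 : iteratedFDeriv ℝ i (fderiv ℝ (u : Euc n → ℂ)) y = 0 := by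
    rw [← norm_eq_zero, norm_iteratedFDeriv_fderiv, h1, norm_zero]
  have h3 := norm_iteratedFDeriv_clm_apply_const (c := eVec l) (x := y) (n := i)
    (f := fderiv ℝ (u : Euc n → ℂ)) (N := ∞)
    ((contDiff_coe u).fderiv_right (m := ∞) (by simp)).contDiffAt (by exact_mod_cast le_top)
  rw [h2, norm_zero, mul_zero] at h3
  exact norm_le_zero_iff.1 h3

/-- The inductive step for Taylor's theorem: the derivative of order `i + 1` is recovered from
derivatives of order `i` of the partials, by expanding the last argument in the standard basis. -/
theorem VanishBelow.of_pd {a : ℕ} {y : Euc n} {u : SmoothFun n (Euc n)}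
    (h0 : (u : Euc n → ℂ) y = 0) (h : ∀ l, VanishBelow a y (QMM.pd l u)) :
    VanishBelow (a + 1) y u := by
  intro i hi
  rw [chartRep_euc, extChartAt_euc]
  rcases i with _ | i
  · ext m; simpa using h0
  · rw [← norm_eq_zero, ← norm_iteratedFDeriv_fderiv, norm_eq_zero]
    have hs : ContDiff ℝ ∞ (fderiv ℝ (u : Euc n → ℂ)) := (contDiff_coe u).fderiv_right (by simp)
    ext m w
    have hw : w = ∑ l, w l • eVec l := by
      ext j; simp [Finset.sum_apply, Pi.single_apply]
    rw [hw]
    simp only [map_sum, map_smul]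
    simp only [zero_apply, smul_zero, Finset.sum_const_zero]
    refine Finset.sum_eq_zero fun l _ => ?_
    have h1 := h l i (by omega)
    rw [chartRep_euc, extChartAt_euc] at h1
    have h2 := iteratedFDeriv_clm_apply_const_apply (n := ∞) hs (i := i) (by exact_mod_cast le_top)
      (x := y) (u := eVec l) (m := m)
    have h3 : iteratedFDeriv ℝ i (fun z => fderiv ℝ (u : Euc n → ℂ) z (eVec l)) y = 0 := h1
    rw [← h2, h3]; simp

end PartialDerivatives

/-! ### Taylor polynomials as elements of the polynomial ring. -/

section Taylor

variable {n : ℕ}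

/-- The polynomial function on `ℝⁿ` given by a polynomial with complex coefficients. -/
def evalFun : MvPolynomial (Fin n) ℂ →ₐ[ℂ] SmoothFun n (Euc n) :=
  MvPolynomial.aeval coord

@[simp] theorem evalFun_X (l : Fin n) : evalFun (MvPolynomial.X l) = coord l := by
  simp [evalFun]

@[simp] theorem coord_apply (l : Fin n) (y : Euc n) :
    (coord l : Euc n → ℂ) y = ((y l : ℝ) : ℂ) := rfl

/-- Evaluation at a point. -/
def evalAt {d : ℕ} {M : Type*} [TopologicalSpace M] [ChartedSpace (Euc d) M] (x : M) :
    SmoothFun d M →ₗ[ℂ] ℂ where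
  toFun u := (u : M → ℂ) x
  map_add' _ _ := rfl
  map_smul' _ _ := rfl

@[simp] theorem evalAt_apply {d : ℕ} {M : Type*} [TopologicalSpace M] [ChartedSpace (Euc d) M]
    (x : M) (u : SmoothFun d M) : evalAt x u = (u : M → ℂ) x := rfl

/-- The linear polynomial `X_l - y_l`. -/
def shiftedX (y : Euc n) (l : Fin n) : MvPolynomial (Fin n) ℂ :=
  MvPolynomial.X l - MvPolynomial.C ((y l : ℝ) : ℂ)

/-- `r!` times the homogeneous part of degree `r` of the Taylor series of a function at `y`. -/
def taylorPart (y : Euc n) : ℕ → SmoothFun n (Euc n) →ₗ[ℂ] MvPolynomial (Fin n) ℂ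
  | 0 => Algebra.linearMap ℂ (MvPolynomial (Fin n) ℂ) ∘ₗ evalAt y
  | r + 1 => ∑ l, LinearMap.mulLeft ℂ (shiftedX y l) ∘ₗ taylorPart y r ∘ₗ pd l

theorem taylorPart_zero (y : Euc n) (u : SmoothFun n (Euc n)) :
    taylorPart y 0 u = MvPolynomial.C ((u : Euc n → ℂ) y) := rfl

theorem taylorPart_succ (y : Euc n) (r : ℕ) (u : SmoothFun n (Euc n)) :
    taylorPart y (r + 1) u = ∑ l, shiftedX y l * taylorPart y r (pd l u) := by
  simp [taylorPart, LinearMap.sum_apply]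

theorem evalFun_shiftedX (y : Euc n) (l : Fin n) :
    evalFun (shiftedX y l) = coord l - algebraMap ℂ _ ((y l : ℝ) : ℂ) := by
  simp [shiftedX, ← MvPolynomial.algebraMap_eq]

theorem evalFun_shiftedX_self (y : Euc n) (l : Fin n) :
    (evalFun (shiftedX y l) : Euc n → ℂ) y = 0 := by
  rw [evalFun_shiftedX]
  change ((y l : ℝ) : ℂ) - ((y l : ℝ) : ℂ) = 0
  simp

theorem evalFun_taylorPart_self (y : Euc n) (r : ℕ) (u : SmoothFun n (Euc n)) :
    (evalFun (taylorPart y (r + 1) u) : Euc n → ℂ) y = 0 := by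
  have : evalAt y (evalFun (taylorPart y (r + 1) u)) = 0 := by
    rw [taylorPart_succ, map_sum, map_sum]
    refine Finset.sum_eq_zero fun l _ => ?_
    rw [map_mul]
    change (evalFun (shiftedX y l) : Euc n → ℂ) y * _ = 0
    rw [evalFun_shiftedX_self, zero_mul]
  exact this

theorem pd_evalFun_shiftedX (y : Euc n) (l k : Fin n) :
    pd l (evalFun (shiftedX y k)) = if l = k then 1 else 0 := by
  rw [evalFun_shiftedX, map_sub, pd_algebraMap, pd_coord, sub_zero]

theorem pd_taylorPart_zero (y : Euc n) (l : Fin n) (u : SmoothFun n (Euc n)) :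
    pd l (evalFun (taylorPart y 0 u)) = 0 := by
  rw [taylorPart_zero, ← MvPolynomial.algebraMap_eq, AlgHom.commutes, pd_algebraMap]

/-- The factor `r + 1` appears because `taylorPart` omits 1/r!. In the inductive step the product
rule gives `r + 1` copies from the inner Taylor part, after commuting the partials, and one more
from differentiating the shifted variable. -/
theorem pd_taylorPart (y : Euc n) (r : ℕ) (l : Fin n) (u : SmoothFun n (Euc n)) :
    pd l (evalFun (taylorPart y (r + 1) u)) =
      ((r : ℂ) + 1) • evalFun (taylorPart y r (pd l u)) := by
  induction r generalizing u with
  | zero =>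
    rw [taylorPart_succ, map_sum, map_sum]
    simp only [map_mul, pd_mul, pd_taylorPart_zero, pd_evalFun_shiftedX]
    simp
  | succ r ih =>
    rw [taylorPart_succ, map_sum, map_sum]
    simp only [map_mul, pd_mul, pd_evalFun_shiftedX, ih]
    rw [Finset.sum_add_distrib]
    have h1 : ∑ k, evalFun (shiftedX y k) * ((r : ℂ) + 1) • evalFun (taylorPart y r (pd l (pd k u)))
        = ((r : ℂ) + 1) • evalFun (taylorPart y (r + 1) (pd l u)) := by
      rw [taylorPart_succ, map_sum, Finset.smul_sum]
      refine Finset.sum_congr rfl fun k _ => ?_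
      rw [pd_comm l k, map_mul, mul_smul_comm]
    rw [h1]
    simp only [mul_ite, mul_one, mul_zero, Finset.sum_ite_eq, Finset.mem_univ, if_true]
    push_cast
    module

/-- The Taylor polynomial of degree less than `k` of `u` at `y`. -/
def taylorPoly (y : Euc n) (k : ℕ) (u : SmoothFun n (Euc n)) : MvPolynomial (Fin n) ℂ :=
  ∑ i ∈ Finset.range k, ((i ! : ℂ))⁻¹ • taylorPart y i u

/-- Taylor's theorem without a remainder estimate: the difference vanishes at `y`, and each of its
partials is the same difference for `pd l u` with one term fewer. -/
theorem vanishBelow_sub_taylorPoly (y : Euc n) (k : ℕ) (u : SmoothFun n (Euc n)) :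
    VanishBelow k y (u - evalFun (taylorPoly y k u)) := by
  induction k generalizing u with
  | zero => exact vanishBelow_zero _ _
  | succ k ih =>
    refine VanishBelow.of_pd ?_ fun l => ?_
    · have : evalAt y (u - evalFun (taylorPoly y (k + 1) u)) = 0 := by
        rw [taylorPoly, Finset.sum_range_succ', map_sub, map_add, map_sum, map_add, map_sum]
        simp only [map_smul, evalAt_apply, evalFun_taylorPart_self, smul_zero,
          Finset.sum_const_zero]
        rw [taylorPart_zero, ← MvPolynomial.algebraMap_eq, AlgHom.commutes]
        change _ - (_ + _ • ((u : Euc n → ℂ) y)) = 0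
        simp
      exact this
    · have : pd l (u - evalFun (taylorPoly y (k + 1) u)) =
          pd l u - evalFun (taylorPoly y k (pd l u)) := by
        rw [map_sub, taylorPoly, Finset.sum_range_succ', taylorPoly]
        simp only [map_add, map_sum, map_smul, pd_taylorPart_zero, pd_taylorPart, smul_zero,
          add_zero, smul_smul]
        congr 1
        refine Finset.sum_congr rfl fun i _ => ?_
        congr 1
        rw [Nat.factorial_succ]
        have h1 : (i ! : ℂ) ≠ 0 := by exact_mod_cast i.factorial_ne_zero
        have h2 : ((i : ℂ) + 1) ≠ 0 := by exact_mod_cast i.succ_ne_zero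
        push_cast
        field_simp
      rw [this]
      exact ih (pd l u)

theorem taylorPart_mul_coord_zero (y : Euc n) (l : Fin n) (u : SmoothFun n (Euc n)) :
    taylorPart y 0 (u * coord l) = MvPolynomial.C ((y l : ℝ) : ℂ) * taylorPart y 0 u := by
  rw [taylorPart_zero, taylorPart_zero, ← map_mul, mul_comm]
  rfl

/-- The coordinate equals `y l` plus the shifted variable, so multiplying by it multiplies the
Taylor series by this sum; `r + 1` again comes from the missing 1/r!. -/
theorem taylorPart_mul_coord (y : Euc n) (r : ℕ) (l : Fin n) (u : SmoothFun n (Euc n)) :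
    taylorPart y (r + 1) (u * coord l) = MvPolynomial.C ((y l : ℝ) : ℂ) * taylorPart y (r + 1) u
      + ((r : ℂ) + 1) • (shiftedX y l * taylorPart y r u) := by
  have hpd : ∀ k, pd k (u * coord l) = pd k u * coord l + if k = l then u else 0 := by
    intro k
    rw [pd_mul, pd_coord, mul_comm (coord l), add_comm]
    split_ifs <;> simp
  induction r generalizing u with
  | zero =>
    rw [taylorPart_succ, taylorPart_succ]
    simp only [hpd, map_add, taylorPart_mul_coord_zero, apply_ite (taylorPart y 0), map_zero,
      mul_add, Finset.sum_add_distrib, mul_ite, mul_zero, Finset.sum_ite_eq', Finset.mem_univ,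
      if_true, Finset.mul_sum]
    congr 1
    · exact Finset.sum_congr rfl fun k _ => by ring
    · simp
  | succ r ih =>
    have hpd' : ∀ v : SmoothFun n (Euc n), ∀ k,
        pd k (v * coord l) = pd k v * coord l + if k = l then v else 0 := by
      intro v k
      rw [pd_mul, pd_coord, mul_comm (coord l), add_comm]
      split_ifs <;> simp
    rw [taylorPart_succ]
    simp only [hpd, map_add]
    have h : ∀ k, taylorPart y (r + 1) (pd k u * coord l) = _ := fun k => ih (pd k u) (hpd' _)
    simp only [h, apply_ite (taylorPart y (r + 1)), map_zero, mul_add, Finset.sum_add_distrib,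
      mul_ite, mul_zero, Finset.sum_ite_eq', Finset.mem_univ, if_true]
    have h1 : ∑ k, shiftedX y k * (MvPolynomial.C ((y l : ℝ) : ℂ) * taylorPart y (r + 1) (pd k u))
        = MvPolynomial.C ((y l : ℝ) : ℂ) * taylorPart y (r + 1 + 1) u := by
      rw [taylorPart_succ y (r + 1), Finset.mul_sum]
      exact Finset.sum_congr rfl fun k _ => by ring
    have h2 : ∑ k, shiftedX y k * ((r : ℂ) + 1) • (shiftedX y l * taylorPart y r (pd k u))
        = ((r : ℂ) + 1) • (shiftedX y l * taylorPart y (r + 1) u) := by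
      rw [taylorPart_succ y r, Finset.mul_sum, Finset.smul_sum]
      refine Finset.sum_congr rfl fun k _ => ?_
      rw [mul_smul_comm]; congr 1; ring
    rw [h1, h2]
    push_cast
    module

theorem taylorPoly_mul_coord (y : Euc n) (k : ℕ) (l : Fin n) (u : SmoothFun n (Euc n)) :
    taylorPoly y (k + 1) (u * coord l) = MvPolynomial.C ((y l : ℝ) : ℂ) * taylorPoly y (k + 1) u
      + shiftedX y l * taylorPoly y k u := by
  simp only [taylorPoly]
  rw [Finset.sum_range_succ', Finset.sum_range_succ' _ k, taylorPart_mul_coord_zero]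
  simp only [taylorPart_mul_coord, smul_add, Finset.sum_add_distrib, Finset.mul_sum, mul_add,
    mul_smul_comm, smul_smul]
  have : ∀ i : ℕ, (((i + 1)! : ℂ))⁻¹ * (i : ℂ) + (((i + 1)! : ℂ))⁻¹ * 1 = ((i ! : ℂ))⁻¹ := by
    intro i
    rw [← mul_add]
    rw [Nat.factorial_succ]
    have h1 : (i ! : ℂ) ≠ 0 := by exact_mod_cast i.factorial_ne_zero
    have h2 : ((i : ℂ) + 1) ≠ 0 := by exact_mod_cast i.succ_ne_zero
    push_cast
    field_simp
  simp only [this]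
  abel

/-- Exactness is needed only for large `k`, so no degree is tracked: multiplication by a variable
raises the threshold by one. -/
theorem exists_taylorPoly_eq (y : Euc n) (W : MvPolynomial (Fin n) ℂ) :
    ∃ R, ∀ k, R ≤ k → taylorPoly y k (evalFun W) = W := by
  induction W using MvPolynomial.induction_on with
  | C a =>
    refine ⟨1, fun k hk => ?_⟩
    obtain ⟨k, rfl⟩ := Nat.exists_eq_add_of_le' hk
    have hz : ∀ i, taylorPart y (i + 1) (evalFun (MvPolynomial.C a : MvPolynomial (Fin n) ℂ)) = 0 := by
      intro i
      rw [taylorPart_succ, ← MvPolynomial.algebraMap_eq, AlgHom.commutes]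
      simp [pd_algebraMap]
    rw [taylorPoly, Finset.sum_range_succ']
    simp only [hz, smul_zero, Finset.sum_const_zero, zero_add]
    rw [taylorPart_zero, ← MvPolynomial.algebraMap_eq, AlgHom.commutes]
    have : ((algebraMap ℂ (SmoothFun n (Euc n)) a : SmoothFun n (Euc n)) : Euc n → ℂ) y = a := rfl
    rw [this]; simp
  | add p q hp hq =>
    obtain ⟨R, hR⟩ := hp
    obtain ⟨R', hR'⟩ := hq
    refine ⟨max R R', fun k hk => ?_⟩
    have h1 := hR k (le_trans (le_max_left _ _) hk)
    have h2 := hR' k (le_trans (le_max_right _ _) hk)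
    have h3 : taylorPoly y k (evalFun (p + q)) =
        taylorPoly y k (evalFun p) + taylorPoly y k (evalFun q) := by
      simp only [taylorPoly, map_add, smul_add, Finset.sum_add_distrib]
    rw [h3, h1, h2]
  | mul_X p l hp =>
    obtain ⟨R, hR⟩ := hp
    refine ⟨R + 1, fun k hk => ?_⟩
    obtain ⟨k, rfl⟩ := Nat.exists_eq_add_of_le' (le_trans (Nat.le_add_left 1 R) hk)
    rw [map_mul, evalFun_X, taylorPoly_mul_coord, hR _ (by omega), hR _ (by omega), shiftedX]
    ring

end Taylor

/-! ### Differential operators along a map, built from their values on polynomials. -/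

section Operators

variable {d n : ℕ} {M : Type*} [TopologicalSpace M] [ChartedSpace (Euc d) M]
  (mom : M → Euc n) (hmom : ContMDiff (𝓡 d) (𝓡 n) ∞ mom)

/-- The commutator `W ↦ τ(X_l W) - mom_l τ(W)`. -/
def shiftOp (τ : MvPolynomial (Fin n) ℂ →ₗ[ℂ] SmoothFun d M) (l : Fin n) :
    MvPolynomial (Fin n) ℂ →ₗ[ℂ] SmoothFun d M :=
  τ ∘ₗ LinearMap.mulLeft ℂ (MvPolynomial.X l)
    - LinearMap.mulLeft ℂ (pullback mom hmom (coord l)) ∘ₗ τ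

/-- The part of order `r` of the extension of `τ` to a differential operator along `mom`. -/
def opPart : ℕ → (MvPolynomial (Fin n) ℂ →ₗ[ℂ] SmoothFun d M) →
    SmoothFun n (Euc n) →ₗ[ℂ] SmoothFun d M
  | 0, τ => LinearMap.mulLeft ℂ (τ 1) ∘ₗ (pullback mom hmom).toLinearMap
  | r + 1, τ => ∑ l, opPart r (shiftOp mom hmom τ l) ∘ₗ pd l

theorem opPart_zero (τ : MvPolynomial (Fin n) ℂ →ₗ[ℂ] SmoothFun d M) (u : SmoothFun n (Euc n)) :
    opPart mom hmom 0 τ u = τ 1 * pullback mom hmom u := rfl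

theorem opPart_succ (r : ℕ) (τ : MvPolynomial (Fin n) ℂ →ₗ[ℂ] SmoothFun d M)
    (u : SmoothFun n (Euc n)) :
    opPart mom hmom (r + 1) τ u = ∑ l, opPart mom hmom r (shiftOp mom hmom τ l) (pd l u) := by
  simp [opPart, LinearMap.sum_apply]

theorem shiftOp_apply (τ : MvPolynomial (Fin n) ℂ →ₗ[ℂ] SmoothFun d M) (l : Fin n)
    (W : MvPolynomial (Fin n) ℂ) (x : M) :
    (shiftOp mom hmom τ l W : M → ℂ) x = (τ (shiftedX (mom x) l * W) : M → ℂ) x := by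
  rw [shiftedX, sub_mul, map_sub, ← MvPolynomial.smul_eq_C_mul, map_smul]
  rfl

/-- The right-hand side feeds `τ` a polynomial that itself depends on `x`, so its smoothness in `x`
is not visible. The commutators `shiftOp` are independent of `x` and agree at `x` with
multiplication by the shifted variable; they exhibit this function as an element of `SmoothFun`. -/
theorem opPart_apply (r : ℕ) (τ : MvPolynomial (Fin n) ℂ →ₗ[ℂ] SmoothFun d M)
    (u : SmoothFun n (Euc n)) (x : M) :
    (opPart mom hmom r τ u : M → ℂ) x = (τ (taylorPart (mom x) r u) : M → ℂ) x := by
  induction r generalizing τ u with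
  | zero =>
    rw [opPart_zero, taylorPart_zero, ← mul_one (MvPolynomial.C _), ← MvPolynomial.smul_eq_C_mul,
      map_smul]
    exact mul_comm ((τ 1 : M → ℂ) x) ((u : Euc n → ℂ) (mom x))
  | succ r ih =>
    rw [opPart_succ, taylorPart_succ, map_sum, ← evalAt_apply, ← evalAt_apply, map_sum, map_sum]
    refine Finset.sum_congr rfl fun l _ => ?_
    rw [evalAt_apply, evalAt_apply, ih, shiftOp_apply]

/-- An operator of order `r` costs at most `r` orders of vanishing, one for each partial derivative.
-/
theorem VanishBelow.opPart [IsManifold (𝓡 d) ∞ M] {r a : ℕ}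
    {τ : MvPolynomial (Fin n) ℂ →ₗ[ℂ] SmoothFun d M}
    {u : SmoothFun n (Euc n)} {x : M} (h : VanishBelow (a + r) (mom x) u) :
    VanishBelow a x (opPart mom hmom r τ u) := by
  induction r generalizing τ u with
  | zero =>
    rw [opPart_zero]
    exact (VanishBelow.pullback h).mul_left _
  | succ r ih =>
    rw [opPart_succ]
    exact VanishBelow.sum fun l _ => ih (h.pd l)

end Operators

/-! ### Formal series of linear maps. -/

section Formal

variable {A B : Type*} [CommRing A] [Algebra ℂ A] [CommRing B] [Algebra ℂ B]

theorem coeff_formal_smul (c : PowerSeries ℂ) (f : PowerSeries A) (m : ℕ) :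
    PowerSeries.coeff m (c • f) =
      ∑ q ∈ Finset.HasAntidiagonal.antidiagonal m,
        PowerSeries.coeff q.1 c • PowerSeries.coeff q.2 f := by
  rw [Algebra.smul_def, PowerSeries.algebraMap_apply'', PowerSeries.coeff_mul]
  simp [Algebra.smul_def]

theorem coeff_C_smul (c : ℂ) (f : PowerSeries A) (m : ℕ) :
    PowerSeries.coeff m (PowerSeries.C c • f) = c • PowerSeries.coeff m f := by
  rw [Algebra.smul_def, PowerSeries.algebraMap_apply'', PowerSeries.map_C, PowerSeries.coeff_C_mul,
    Algebra.smul_def]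

/-- The `ℂ[[λ]]`-linear map `∑ λ^a τ_a`. -/
def formalMap (τ : ℕ → A →ₗ[ℂ] B) : PowerSeries A →ₗ[PowerSeries ℂ] PowerSeries B where
  toFun f := PowerSeries.mk fun m => ∑ q ∈ Finset.HasAntidiagonal.antidiagonal m,
    τ q.1 (PowerSeries.coeff q.2 f)
  map_add' f g := by
    ext m
    simp [Finset.sum_add_distrib]
  map_smul' c f := by
    ext m
    rw [RingHom.id_apply, coeff_formal_smul]
    simp only [PowerSeries.coeff_mk, coeff_formal_smul, map_sum, map_smul, Finset.smul_sum]
    rw [Finset.sum_sigma', Finset.sum_sigma']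
    -- Both sides run over triples of indices with sum `m`; exchanging the index of `τ` with that of
    -- `c` is an involution.
    refine Finset.sum_nbij' (fun t => ⟨(t.2.1, t.1.1 + t.2.2), (t.1.1, t.2.2)⟩)
      (fun t => ⟨(t.2.1, t.1.1 + t.2.2), (t.1.1, t.2.2)⟩) ?_ ?_ ?_ ?_ ?_
    all_goals
      rintro ⟨⟨a, b⟩, ⟨e, f⟩⟩ h
      simp only [Finset.mem_sigma, Finset.HasAntidiagonal.mem_antidiagonal] at h
      obtain ⟨h1, h2⟩ := h
      subst h2
    · refine Finset.mem_sigma.2 ⟨Finset.HasAntidiagonal.mem_antidiagonal.2 ?_,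
        Finset.HasAntidiagonal.mem_antidiagonal.2 rfl⟩
      change e + (a + f) = m
      omega
    · refine Finset.mem_sigma.2 ⟨Finset.HasAntidiagonal.mem_antidiagonal.2 ?_,
        Finset.HasAntidiagonal.mem_antidiagonal.2 rfl⟩
      change e + (a + f) = m
      omega
    · rfl
    · rfl
    · rfl

theorem coeff_formalMap (τ : ℕ → A →ₗ[ℂ] B) (f : PowerSeries A) (m : ℕ) :
    PowerSeries.coeff m (formalMap τ f) = ∑ q ∈ Finset.HasAntidiagonal.antidiagonal m,
      τ q.1 (PowerSeries.coeff q.2 f) := by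
  simp [formalMap]

theorem coeff_formalMap_C (τ : ℕ → A →ₗ[ℂ] B) (u : A) (m : ℕ) :
    PowerSeries.coeff m (formalMap τ (PowerSeries.C u)) = τ m u := by
  rw [coeff_formalMap, Finset.sum_eq_single (m, 0)]
  · simp
  · rintro ⟨a, b⟩ hab hne
    rw [Finset.HasAntidiagonal.mem_antidiagonal] at hab
    have : b ≠ 0 := by
      rintro rfl
      exact hne (by simpa using hab)
    simp [PowerSeries.coeff_C, this]
  · intro h
    simp at h

end Formal

/-! ### Iterated commutators with a multiplication operator. -/

section Commutators

variable {A : Type*} [CommRing A] [Algebra ℂ A]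

/-- The commutator of an operator with the multiplication by `g`. -/
def commutatorWith (g : A) (D : A →ₗ[ℂ] A) : A →ₗ[ℂ] A :=
  D ∘ₗ LinearMap.mulLeft ℂ g - LinearMap.mulLeft ℂ g ∘ₗ D

theorem apply_mul_eq (g : A) (D : A →ₗ[ℂ] A) (v : A) :
    D (g * v) = g * D v + commutatorWith g D v := by
  simp [commutatorWith]

/-- Grothendieck's description of differential operators: order below `k` costs at most `k` factors
of `g`. Moving one `g` out of `D` leaves `g * D`, treated by induction on `s`, and a commutator,
treated by induction on `k`. -/
theorem pow_dvd_of_iterate_commutator (g : A) {k : ℕ} {D : A →ₗ[ℂ] A}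
    (hD : (commutatorWith g)^[k] D = 0) {s : ℕ} {u : A} (hu : g ^ s ∣ u) :
    g ^ (s - k) ∣ D u := by
  induction k generalizing D s u with
  | zero =>
    have : D = 0 := hD
    simp [this]
  | succ k ih =>
    induction s generalizing u with
    | zero => simp
    | succ s ihs =>
      obtain ⟨w, rfl⟩ := hu
      have hv : g ^ s ∣ g ^ s * w := dvd_mul_right _ _
      rw [pow_succ', mul_assoc, apply_mul_eq]
      refine dvd_add ?_ ?_
      · refine (pow_dvd_pow g (by omega : s + 1 - (k + 1) ≤ (s - (k + 1)) + 1)).trans ?_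
        rw [pow_succ']
        exact mul_dvd_mul_left g (ihs hv)
      · have h := ih (D := commutatorWith g D) hD hv
        rwa [Nat.add_sub_add_right]

end Commutators

/-! ### Divisibility of star powers by powers of the classical part. -/

section Locality

variable {d : ℕ} {M : Type*} [TopologicalSpace M] [ChartedSpace (Euc d) M]

/-- Subtracting the constant `g x` from `g` does not change the commutator. Evaluated at `x`, the
commutator applied to `h ^ k * v` is therefore `D (h ^ (k + 1) * v)`, which passes the hypothesis to
`commutatorWith g D`. -/
theorem iterate_commutator_eq_zero (g : SmoothFun d M) {k : ℕ}
    {D : SmoothFun d M →ₗ[ℂ] SmoothFun d M}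
    (hD : ∀ x v, (D ((g - algebraMap ℂ _ ((g : M → ℂ) x)) ^ k * v) : M → ℂ) x = 0) :
    (commutatorWith g)^[k] D = 0 := by
  induction k generalizing D with
  | zero =>
    refine LinearMap.ext fun v => Subtype.ext (funext fun x => ?_)
    simpa using hD x v
  | succ k ih =>
    rw [Function.iterate_succ_apply]
    refine ih fun x v => ?_
    set h := g - algebraMap ℂ _ ((g : M → ℂ) x) with hh
    have hg : g = h + algebraMap ℂ _ ((g : M → ℂ) x) := by rw [hh]; ring
    have h1 := apply_mul_eq g D (h ^ k * v)
    have h2 : g * (h ^ k * v) = h ^ (k + 1) * v + ((g : M → ℂ) x) • (h ^ k * v) := by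
      conv_lhs => rw [hg]
      rw [Algebra.smul_def]; ring
    rw [h2, map_add, map_smul] at h1
    have h3 := congrArg (evalAt x) h1
    rw [map_add, map_smul, map_add] at h3
    have h4 : evalAt x (g * D (h ^ k * v)) = (g : M → ℂ) x * evalAt x (D (h ^ k * v)) := rfl
    have h5 : evalAt x (D (h ^ (k + 1) * v)) = 0 := hD x v
    rw [h4, h5, zero_add, smul_eq_mul] at h3
    simpa using h3.symm

theorem Deformation.exists_order (S : Deformation d M) :
    ∃ κ : ℕ → ℕ, ∀ (a : ℕ) (x : M) (u v : SmoothFun d M),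
      VanishBelow (κ a) x u ∨ VanishBelow (κ a) x v → (S.C a u v : M → ℂ) x = 0 := by
  choose κ hκ using S.bidifferential
  refine ⟨fun a => κ a + 1, fun a x u v h => hκ a x u v ?_⟩
  simpa only [jetVanishes_iff] using h

theorem coeff_star {S : Deformation d M} (f g : FormalFun d M) (m : ℕ) :
    PowerSeries.coeff m (S.star f g) =
      ∑ p ∈ Finset.HasAntidiagonal.antidiagonal m, ∑ q ∈ Finset.HasAntidiagonal.antidiagonal p.2,
      ((1 / 2 : ℂ) ^ p.1) • S.C p.1 (PowerSeries.coeff q.1 f) (PowerSeries.coeff q.2 g) := by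
  simp [Deformation.star, formalProduct]

variable [IsManifold (𝓡 d) ∞ M]

/-- In the λ^m coefficient of g * g^{*r}, the only term using the λ^m coefficient of g^{*r} is its
ordinary product with g₀, which gains a factor g₀. Every other term uses a coefficient of lower
order, whose larger exponent of g₀ pays for the order of the cochain applied to it. -/
theorem Deformation.exists_pow_dvd_starPow (S : Deformation d M) :
    ∃ K : ℕ → ℕ, ∀ (g : FormalFun d M) (r m : ℕ),
      (PowerSeries.coeff 0 g) ^ (r - K m) ∣ PowerSeries.coeff m (S.starPow g r) := by
  obtain ⟨κ, hκ⟩ := S.exists_order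
  set κ' : ℕ → ℕ := fun m => ∑ a ∈ Finset.range (m + 1), κ a with hκ'
  have hle : ∀ a m, a ≤ m → κ a ≤ κ' m := fun a m h =>
    Finset.single_le_sum (f := κ) (fun _ _ => Nat.zero_le _) (Finset.mem_range.2 (by omega))
  have hmono : ∀ a m, a ≤ m → κ' a ≤ κ' m := fun a m h =>
    Finset.sum_le_sum_of_subset (Finset.range_mono (by omega))
  -- The recursion needs K(m) ≥ K(c) + κ(a) + 1 whenever c < m and a ≤ m: κ(a) for the cochain, and
  -- 1 for the factor not gained.
  refine ⟨fun m => m * (κ' m + 1), fun g r => ?_⟩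
  set g0 := PowerSeries.coeff 0 g with hg0
  have hcomm : ∀ a w, (commutatorWith g0)^[κ a] (S.C a w) = 0 := by
    intro a w
    refine iterate_commutator_eq_zero g0 fun x v => hκ a x _ _ (Or.inr ?_)
    refine (vanishBelow_pow ?_ _).mul_right v
    change (g0 : M → ℂ) x - (g0 : M → ℂ) x = 0
    simp
  induction r with
  | zero => intro m; simp
  | succ r ih =>
    intro m
    change _ ∣ PowerSeries.coeff m (S.star g (S.starPow g r))
    rw [coeff_star]
    refine Finset.dvd_sum fun p hp => Finset.dvd_sum fun q hq => ?_
    rw [Finset.HasAntidiagonal.mem_antidiagonal] at hp hq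
    rw [Algebra.smul_def]
    refine Dvd.dvd.mul_left ?_ _
    by_cases hc : q.2 = m
    · have hp1 : p.1 = 0 := by omega
      have hq1 : q.1 = 0 := by omega
      rw [hp1, hq1, S.C_zero, hc, ← hg0]
      refine (pow_dvd_pow g0
        (by omega : r + 1 - m * (κ' m + 1) ≤ (r - m * (κ' m + 1)) + 1)).trans ?_
      rw [pow_succ']
      exact mul_dvd_mul_left g0 (ih m)
    · have h1 := pow_dvd_of_iterate_commutator g0 (hcomm p.1 (PowerSeries.coeff q.1 g)) (ih q.2)
      refine (pow_dvd_pow g0 ?_).trans h1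
      have hcm : q.2 + 1 ≤ m := by omega
      have h2 : q.2 * (κ' q.2 + 1) ≤ q.2 * (κ' m + 1) :=
        Nat.mul_le_mul_left _ (by have := hmono q.2 m (by omega); omega)
      have h3 : κ p.1 ≤ κ' m := hle _ _ (by omega)
      have h4 : (q.2 + 1) * (κ' m + 1) ≤ m * (κ' m + 1) := Nat.mul_le_mul_right _ hcm
      have h5 : (q.2 + 1) * (κ' m + 1) = q.2 * (κ' m + 1) + κ' m + 1 := by ring
      change r + 1 - m * (κ' m + 1) ≤ r - q.2 * (κ' q.2 + 1) - κ p.1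
      omega

end Locality

/-! ### Polarization. -/

section Kill

variable {n : ℕ}

/-- Powers of linear forms span the homogeneous polynomials. The variables are split off one at a
time, each being absorbed into the functional `L`. -/
theorem apply_taylorPart_eq_zero (y : Euc n) (r : ℕ) (L : MvPolynomial (Fin n) ℂ →ₗ[ℂ] ℂ)
    (hL : ∀ q : Fin n → ℂ, L ((∑ k, q k • shiftedX y k) ^ r) = 0) (u : SmoothFun n (Euc n)) :
    L (taylorPart y r u) = 0 := by
  induction r generalizing L u with
  | zero =>
    rw [taylorPart_zero, ← mul_one (MvPolynomial.C _), ← MvPolynomial.smul_eq_C_mul, map_smul]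
    have := hL 0
    rw [pow_zero] at this
    rw [this, smul_zero]
  | succ r ih =>
    rw [taylorPart_succ, map_sum]
    refine Finset.sum_eq_zero fun l _ => ?_
    refine ih (L ∘ₗ LinearMap.mulLeft ℂ (shiftedX y l)) (fun q => ?_) (pd l u)
    set Q := ∑ k, q k • shiftedX y k with hQ
    set Y := shiftedX y l with hY
    change L (Y * Q ^ r) = 0
    -- P(t) = L((tY + Q)^(r+1)) vanishes for every t, so its linear coefficient (r + 1) L(Y Q^r) is
    -- zero.
    set P : Polynomial ℂ := ∑ j ∈ Finset.range (r + 1 + 1),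
      Polynomial.monomial j (L (Y ^ j * Q ^ (r + 1 - j) * ((r + 1).choose j))) with hP
    have hP0 : P = 0 := by
      refine Polynomial.funext fun t => ?_
      have h := hL (q + Pi.single l t : Fin n → ℂ)
      have h1 : ∑ k, (q + Pi.single l t : Fin n → ℂ) k • shiftedX y k = t • Y + Q := by
        simp only [Pi.add_apply, add_smul, Finset.sum_add_distrib]
        rw [add_comm, ← hQ]
        congr 1
        rw [Finset.sum_eq_single l]
        · simp [hY]
        · intro b _ hb; simp [hb]
        · simp
      rw [h1, add_pow, map_sum] at h
      rw [hP, Polynomial.eval_finsetSum, Polynomial.eval_zero, ← h]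
      refine Finset.sum_congr rfl fun j _ => ?_
      rw [Polynomial.eval_monomial, smul_pow, smul_mul_assoc, smul_mul_assoc, map_smul,
        smul_eq_mul, mul_comm]
    have h1 := congrArg (fun p => Polynomial.coeff p 1) hP0
    simp only [hP, Polynomial.finsetSum_coeff, Polynomial.coeff_monomial, Polynomial.coeff_zero]
      at h1
    rw [Finset.sum_ite_eq' , if_pos (by simp)] at h1
    rw [pow_one, Nat.choose_one_right, mul_comm, ← nsmul_eq_mul, map_nsmul, nsmul_eq_mul] at h1
    rcases mul_eq_zero.1 h1 with h2 | h2
    · exact absurd h2 (by exact_mod_cast r.succ_ne_zero)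
    · simpa using h2

end Kill

/-! ### Locality of the quantum moment map and its extension to smooth functions. -/

section Symbol

variable {d n : ℕ} {M : Type*} [TopologicalSpace M] [ChartedSpace (Euc d) M]

/-- The coefficient of `λ^j` of `T` on polynomials with complex coefficients. -/
def symbolPart (T : MvPolynomial (Fin n) (PowerSeries ℂ) →ₗ[PowerSeries ℂ] FormalFun d M) (j : ℕ) :
    MvPolynomial (Fin n) ℂ →ₗ[ℂ] SmoothFun d M where
  toFun W := PowerSeries.coeff j (T (MvPolynomial.map PowerSeries.C W))
  map_add' W W' := by simp
  map_smul' c W := by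
    rw [MvPolynomial.smul_eq_C_mul, map_mul, MvPolynomial.map_C, ← MvPolynomial.smul_eq_C_mul,
      map_smul, coeff_C_smul, RingHom.id_apply]

theorem symbolPart_apply (T : MvPolynomial (Fin n) (PowerSeries ℂ) →ₗ[PowerSeries ℂ] FormalFun d M)
    (j : ℕ) (W : MvPolynomial (Fin n) ℂ) :
    symbolPart T j W = PowerSeries.coeff j (T (MvPolynomial.map PowerSeries.C W)) := rfl

/-- The affine polynomial `pX + c`. -/
def affinePoly (p : Fin n → PowerSeries ℂ) (c : PowerSeries ℂ) :
    MvPolynomial (Fin n) (PowerSeries ℂ) :=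
  ∑ k, p k • MvPolynomial.X k + MvPolynomial.C c

/-- `T` sends powers of affine polynomials to star powers, and its classical part on linear
functions is the map `mom` to `ℝⁿ`. -/
structure IsQuantization (S : Deformation d M) (mom : M → Euc n)
    (T : MvPolynomial (Fin n) (PowerSeries ℂ) →ₗ[PowerSeries ℂ] FormalFun d M) : Prop where
  affine_pow : ∀ p c (r : ℕ), T (affinePoly p c ^ r) = S.starPow (T (affinePoly p c)) r
  coeff_zero : ∀ k x, coeffAt 0 (T (MvPolynomial.X k)) x = ((mom x k : ℝ) : ℂ)

theorem IsQuantization.apply_one {S : Deformation d M} {mom : M → Euc n}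
    {T : MvPolynomial (Fin n) (PowerSeries ℂ) →ₗ[PowerSeries ℂ] FormalFun d M}
    (h : IsQuantization S mom T) : T 1 = 1 := by
  have := h.affine_pow 0 0 0
  rwa [pow_zero] at this

theorem polyFun_map_C (W : MvPolynomial (Fin n) ℂ) :
    polyFun (MvPolynomial.map PowerSeries.C W) = PowerSeries.C (evalFun W) := by
  induction W using MvPolynomial.induction_on with
  | C a =>
    rw [MvPolynomial.map_C, ← MvPolynomial.algebraMap_eq, AlgHom.commutes,
      ← MvPolynomial.algebraMap_eq, AlgHom.commutes, PowerSeries.algebraMap_apply'',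
      PowerSeries.map_C]
  | add p q hp hq => simp only [map_add, hp, hq]
  | mul_X p l hp =>
    rw [map_mul, map_mul, hp, MvPolynomial.map_X, map_mul, evalFun_X, map_mul]
    congr 1
    simp [polyFun]

theorem linearMap_ext_of_map_C {N : Type*} [AddCommGroup N] [Module (PowerSeries ℂ) N]
    {F F' : MvPolynomial (Fin n) (PowerSeries ℂ) →ₗ[PowerSeries ℂ] N}
    (h : ∀ W : MvPolynomial (Fin n) ℂ,
      F (MvPolynomial.map PowerSeries.C W) = F' (MvPolynomial.map PowerSeries.C W)) : F = F' := by
  refine (MvPolynomial.basisMonomials (Fin n) (PowerSeries ℂ)).ext fun s => ?_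
  have := h (MvPolynomial.monomial s 1)
  simpa using this

variable [IsManifold (𝓡 d) ∞ M]

/-- The number of Taylor coefficients which determine the term of order `λ^m`. -/
def Deformation.depth (S : Deformation d M) : ℕ → ℕ := S.exists_pow_dvd_starPow.choose

theorem Deformation.pow_dvd_starPow (S : Deformation d M) (g : FormalFun d M) (r m : ℕ) :
    (PowerSeries.coeff 0 g) ^ (r - S.depth m) ∣ PowerSeries.coeff m (S.starPow g r) :=
  S.exists_pow_dvd_starPow.choose_spec g r m

variable {S : Deformation d M} {mom : M → Euc n} (hmom : ContMDiff (𝓡 d) (𝓡 n) ∞ mom)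
  {T : MvPolynomial (Fin n) (PowerSeries ℂ) →ₗ[PowerSeries ℂ] FormalFun d M}

/-- The heart of the proof: at `x`, order λ^m sees only finitely many Taylor coefficients at `mom
x`. By polarization it suffices to test powers of linear forms in the shifted variables, which are
powers of affine polynomials and hence go to star powers. -/
theorem IsQuantization.symbolPart_taylorPart (h : IsQuantization S mom T) {m r : ℕ}
    (hr : S.depth m < r) (x : M) (u : SmoothFun n (Euc n)) :
    (symbolPart T m (taylorPart (mom x) r u) : M → ℂ) x = 0 := by
  refine apply_taylorPart_eq_zero (mom x) r (evalAt x ∘ₗ symbolPart T m) (fun q => ?_) u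
  change (symbolPart T m _ : M → ℂ) x = 0
  set p : Fin n → PowerSeries ℂ := fun k => PowerSeries.C (q k) with hp
  -- This constant makes the affine polynomial vanish at `mom x`, hence the classical part of its
  -- image vanish at `x`.
  set c : PowerSeries ℂ := PowerSeries.C (-∑ k, q k * ((mom x k : ℝ) : ℂ)) with hc
  have h1 : MvPolynomial.map PowerSeries.C ((∑ k, q k • shiftedX (mom x) k) ^ r)
      = affinePoly p c ^ r := by
    rw [map_pow]
    congr 1
    simp only [map_sum, affinePoly, shiftedX, MvPolynomial.smul_eq_C_mul, map_mul, map_sub,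
      MvPolynomial.map_C, MvPolynomial.map_X, mul_sub, Finset.sum_sub_distrib, hp, hc, map_neg]
    rw [← sub_eq_add_neg]
  rw [symbolPart_apply, h1, h.affine_pow]
  set g := T (affinePoly p c) with hg
  have hg0 : evalAt x (PowerSeries.coeff 0 g) = 0 := by
    have h2 : affinePoly p c = ∑ k, p k • MvPolynomial.X k + c • (1 : MvPolynomial (Fin n) (PowerSeries ℂ)) := by
      rw [affinePoly, MvPolynomial.smul_eq_C_mul 1 c, mul_one]
    rw [hg, h2, map_add, map_sum, map_smul, h.apply_one]
    simp only [map_smul, map_add, map_sum, hp, hc, coeff_C_smul]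
    have h3 : ∀ k, evalAt x (PowerSeries.coeff 0 (T (MvPolynomial.X k))) = ((mom x k : ℝ) : ℂ) :=
      fun k => h.coeff_zero k x
    have h4 : evalAt x (PowerSeries.coeff 0 (1 : FormalFun d M)) = 1 := by
      rw [PowerSeries.coeff_zero_one]; rfl
    simp only [h3, h4, smul_eq_mul, mul_one, add_neg_cancel]
  obtain ⟨w, hw⟩ := S.pow_dvd_starPow g r m
  rw [hw]
  obtain ⟨s, hs⟩ : ∃ s, r - S.depth m = s + 1 := ⟨r - S.depth m - 1, by omega⟩
  rw [hs, pow_succ', mul_assoc]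
  have h5 : ∀ u v : SmoothFun d M, evalAt x u = 0 → ((u * v : SmoothFun d M) : M → ℂ) x = 0 := by
    intro u v hu
    change (u : M → ℂ) x * _ = 0
    rw [← evalAt_apply, hu, zero_mul]
  exact h5 _ _ hg0

/-- The coefficient of `λ^m` of the extension of `T` to smooth functions. -/
def extPart (S : Deformation d M)
    (T : MvPolynomial (Fin n) (PowerSeries ℂ) →ₗ[PowerSeries ℂ] FormalFun d M) (m : ℕ) :
    SmoothFun n (Euc n) →ₗ[ℂ] SmoothFun d M :=
  ∑ r ∈ Finset.range (S.depth m + 1), ((r ! : ℂ))⁻¹ • opPart mom hmom r (symbolPart T m)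

theorem extPart_apply (m : ℕ) (u : SmoothFun n (Euc n)) (x : M) :
    (extPart hmom S T m u : M → ℂ) x =
      ∑ r ∈ Finset.range (S.depth m + 1),
        ((r ! : ℂ))⁻¹ * (symbolPart T m (taylorPart (mom x) r u) : M → ℂ) x := by
  rw [extPart, LinearMap.sum_apply, ← evalAt_apply, map_sum]
  refine Finset.sum_congr rfl fun r _ => ?_
  rw [LinearMap.smul_apply, map_smul, evalAt_apply, opPart_apply, smul_eq_mul]

/-- The Taylor expansion of `W` at `mom x` is exact when long enough, and the terms beyond the depth
contribute nothing at `x`. -/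
theorem IsQuantization.extPart_evalFun (h : IsQuantization S mom T) (m : ℕ)
    (W : MvPolynomial (Fin n) ℂ) : extPart hmom S T m (evalFun W) = symbolPart T m W := by
  refine Subtype.ext (funext fun x => ?_)
  rw [extPart_apply]
  obtain ⟨R, hR⟩ := exists_taylorPoly_eq (mom x) W
  have h1 := hR (S.depth m + 1 + R) (by omega)
  conv_rhs => rw [← h1]
  rw [taylorPoly, map_sum, ← evalAt_apply, map_sum, Finset.sum_range_add _ (S.depth m + 1)]
  simp only [map_smul, evalAt_apply, smul_eq_mul]
  rw [left_eq_add]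
  refine Finset.sum_eq_zero fun i _ => ?_
  rw [h.symbolPart_taylorPart (by omega), mul_zero]

theorem VanishBelow.extPart {a m : ℕ} {x : M} {u : SmoothFun n (Euc n)}
    (hu : VanishBelow (a + S.depth m) (mom x) u) : VanishBelow a x (extPart hmom S T m u) := by
  rw [QMM.extPart, LinearMap.sum_apply]
  refine VanishBelow.sum fun r hr => ?_
  rw [Finset.mem_range] at hr
  exact VanishBelow.smul (VanishBelow.opPart mom hmom (hu.mono (by omega))) _

/-- The extension of `T` to formal series of smooth functions. -/
def extension (S : Deformation d M)
    (T : MvPolynomial (Fin n) (PowerSeries ℂ) →ₗ[PowerSeries ℂ] FormalFun d M) :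
    FormalFun n (Euc n) →ₗ[PowerSeries ℂ] FormalFun d M :=
  formalMap (extPart hmom S T)

theorem IsQuantization.extension_polyFun (h : IsQuantization S mom T)
    (W : MvPolynomial (Fin n) (PowerSeries ℂ)) : extension hmom S T (polyFun W) = T W := by
  have : extension hmom S T ∘ₗ polyFun.toLinearMap = T := by
    refine linearMap_ext_of_map_C fun W => ?_
    ext1 m
    rw [LinearMap.comp_apply, AlgHom.toLinearMap_apply, polyFun_map_C, extension,
      coeff_formalMap_C, h.extPart_evalFun, symbolPart_apply]
  exact LinearMap.congr_fun this W

end Symbol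

/-! ### Operators on ℝⁿ determined by their values on polynomials. -/

section EuclideanOperators

variable {n : ℕ}

/-- The hypothesis is pointwise dependence on jets. Replacing `u` by its Taylor polynomial at each
point writes `D` explicitly through partial derivatives, with coefficients obtained from its values
on polynomials. This gives both the loss of vanishing order and the preservation of 𝒜⁰. -/
theorem eq_sum_opPart {D : SmoothFun n (Euc n) →ₗ[ℂ] SmoothFun n (Euc n)} {k : ℕ}
    (hD : ∀ y u, VanishBelow k y u → (D u : Euc n → ℂ) y = 0) (u : SmoothFun n (Euc n)) :
    D u = ∑ r ∈ Finset.range k,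
      ((r ! : ℂ))⁻¹ • opPart id contMDiff_id r (D ∘ₗ evalFun.toLinearMap) u := by
  refine Subtype.ext (funext fun y => ?_)
  have h := hD y _ (vanishBelow_sub_taylorPoly y k u)
  rw [map_sub] at h
  have h1 : (D u : Euc n → ℂ) y = evalAt y (D (evalFun (taylorPoly y k u))) := sub_eq_zero.1 h
  rw [h1, taylorPoly, map_sum, map_sum, map_sum, ← evalAt_apply, map_sum]
  refine Finset.sum_congr rfl fun r _ => ?_
  rw [map_smul, map_smul, map_smul, map_smul, evalAt_apply, evalAt_apply, opPart_apply]
  rfl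

theorem VanishBelow.apply_operator {D : SmoothFun n (Euc n) →ₗ[ℂ] SmoothFun n (Euc n)} {k : ℕ}
    (hD : ∀ y u, VanishBelow k y u → (D u : Euc n → ℂ) y = 0) {a : ℕ} {y : Euc n}
    {u : SmoothFun n (Euc n)} (hu : VanishBelow (a + k) y u) : VanishBelow a y (D u) := by
  rw [eq_sum_opPart hD u]
  refine VanishBelow.sum fun r hr => ?_
  rw [Finset.mem_range] at hr
  exact VanishBelow.smul (VanishBelow.opPart id contMDiff_id (hu.mono (by omega))) _

end EuclideanOperators

/-! ### Agreement of formal series up to finite jets. -/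

section Agreement

variable {d : ℕ} {M : Type*} [TopologicalSpace M] [ChartedSpace (Euc d) M]

/-- The coefficients of `f` and `g` up to `λ^m` agree at `x` to order `a`. -/
def AgreeBelow (m a : ℕ) (x : M) (f g : FormalFun d M) : Prop :=
  ∀ j ≤ m, VanishBelow a x (PowerSeries.coeff j f - PowerSeries.coeff j g)

theorem AgreeBelow.mono {m a b : ℕ} {x : M} {f g : FormalFun d M} (h : AgreeBelow m b x f g)
    (hab : a ≤ b) : AgreeBelow m a x f g := fun j hj => (h j hj).mono hab

theorem AgreeBelow.coeffAt_eq {m a : ℕ} {x : M} {f g : FormalFun d M}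
    (h : AgreeBelow m (a + 1) x f g) : coeffAt m f x = coeffAt m g x :=
  sub_eq_zero.1 (h m le_rfl).apply_eq_zero

theorem Deformation.exists_agreeBelow_star (S : Deformation d M) (m : ℕ) :
    ∃ N, ∀ x f f' g g', AgreeBelow m N x f f' → AgreeBelow m N x g g' →
      coeffAt m (S.star f g) x = coeffAt m (S.star f' g') x := by
  obtain ⟨κ, hκ⟩ := S.exists_order
  refine ⟨∑ j ∈ Finset.range (m + 1), κ j, fun x f f' g g' hf hg => ?_⟩
  rw [← sub_eq_zero]
  have h : evalAt x (PowerSeries.coeff m (S.star f g) - PowerSeries.coeff m (S.star f' g')) = 0 := by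
    rw [coeff_star, coeff_star, ← Finset.sum_sub_distrib, map_sum]
    refine Finset.sum_eq_zero fun p hp => ?_
    rw [← Finset.sum_sub_distrib, map_sum]
    refine Finset.sum_eq_zero fun q hq => ?_
    rw [Finset.HasAntidiagonal.mem_antidiagonal] at hp hq
    have hle : κ p.1 ≤ ∑ j ∈ Finset.range (m + 1), κ j :=
      Finset.single_le_sum (f := κ) (fun _ _ => Nat.zero_le _) (Finset.mem_range.2 (by omega))
    rw [← smul_sub, map_smul]
    set u := PowerSeries.coeff q.1 f
    set u' := PowerSeries.coeff q.1 f'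
    set v := PowerSeries.coeff q.2 g
    set v' := PowerSeries.coeff q.2 g'
    -- One argument is changed at a time, so that each term contains a difference with high
    -- vanishing order.
    have : S.C p.1 u v - S.C p.1 u' v' = S.C p.1 (u - u') v + S.C p.1 u' (v - v') := by
      simp only [map_sub, LinearMap.sub_apply]; abel
    rw [this, map_add, evalAt_apply, evalAt_apply,
      hκ _ x _ _ (Or.inl ((hf _ (by omega)).mono hle)),
      hκ _ x _ _ (Or.inr ((hg _ (by omega)).mono hle)), add_zero, smul_zero]
  exact h

variable [IsManifold (𝓡 d) ∞ M]

theorem agreeBelow_star {S : Deformation d M} {k : ℕ → ℕ} {x : M} {a : ℕ}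
    (hk : ∀ (j : ℕ) (u v : SmoothFun d M), VanishBelow (k j) x u ∨ VanishBelow (k j) x v →
      VanishBelow a x (S.C j u v)) {m : ℕ} {f f' g g' : FormalFun d M}
    (hf : AgreeBelow m (∑ j ∈ Finset.range (m + 1), k j) x f f')
    (hg : AgreeBelow m (∑ j ∈ Finset.range (m + 1), k j) x g g') :
    AgreeBelow m a x (S.star f g) (S.star f' g') := by
  intro j hj
  rw [coeff_star, coeff_star, ← Finset.sum_sub_distrib]
  refine VanishBelow.sum fun p hp => ?_
  rw [← Finset.sum_sub_distrib]
  refine VanishBelow.sum fun q hq => ?_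
  rw [Finset.HasAntidiagonal.mem_antidiagonal] at hp hq
  rw [← smul_sub]
  refine VanishBelow.smul ?_ _
  have hle : k p.1 ≤ ∑ j ∈ Finset.range (m + 1), k j :=
    Finset.single_le_sum (f := k) (fun _ _ => Nat.zero_le _) (Finset.mem_range.2 (by omega))
  set u := PowerSeries.coeff q.1 f
  set u' := PowerSeries.coeff q.1 f'
  set v := PowerSeries.coeff q.2 g
  set v' := PowerSeries.coeff q.2 g'
  have : S.C p.1 u v - S.C p.1 u' v' = S.C p.1 (u - u') v + S.C p.1 u' (v - v') := by
    simp only [map_sub, LinearMap.sub_apply]; abel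
  rw [this]
  exact (hk _ _ _ (Or.inl ((hf _ (by omega)).mono hle))).add
    (hk _ _ _ (Or.inr ((hg _ (by omega)).mono hle)))

end Agreement

/-! ### The extension intertwines the two star products. -/

section StarCompatibility

variable {d n : ℕ} {M : Type*} [TopologicalSpace M] [ChartedSpace (Euc d) M]
  [IsManifold (𝓡 d) ∞ M] {S : Deformation d M} {mom : M → Euc n}
  (hmom : ContMDiff (𝓡 d) (𝓡 n) ∞ mom)
  {T : MvPolynomial (Fin n) (PowerSeries ℂ) →ₗ[PowerSeries ℂ] FormalFun d M}

/-- Here the jet of the product, not only its value, must be controlled. With one argument frozen,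
each cochain is an operator on ℝⁿ to which `VanishBelow.apply_operator` applies. -/
theorem exists_agreeBelow_star_euc (gutt : Deformation n (Euc n)) (m a : ℕ) :
    ∃ N, ∀ y f f' g g', AgreeBelow m N y f f' → AgreeBelow m N y g g' →
      AgreeBelow m a y (gutt.star f g) (gutt.star f' g') := by
  obtain ⟨κ, hκ⟩ := gutt.exists_order
  have hk : ∀ (y : Euc n) (j : ℕ) (u v : SmoothFun n (Euc n)),
      VanishBelow (a + κ j) y u ∨ VanishBelow (a + κ j) y v → VanishBelow a y (gutt.C j u v) := by
    rintro y j u v (h | h)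
    · exact VanishBelow.apply_operator (D := (gutt.C j).flip v)
        (fun y u hu => hκ j y u v (Or.inl hu)) h
    · exact VanishBelow.apply_operator (D := gutt.C j u)
        (fun y v hv => hκ j y u v (Or.inr hv)) h
  exact ⟨∑ j ∈ Finset.range (m + 1), (a + κ j), fun y f f' g g' hf hg =>
    agreeBelow_star (hk y) hf hg⟩

theorem agreeBelow_extension (m a : ℕ) :
    ∃ N, ∀ x f f', AgreeBelow m N (mom x) f f' →
      AgreeBelow m a x (extension hmom S T f) (extension hmom S T f') := by
  refine ⟨∑ j ∈ Finset.range (m + 1), (a + S.depth j), fun x f f' hf j hj => ?_⟩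
  rw [extension, coeff_formalMap, coeff_formalMap, ← Finset.sum_sub_distrib]
  refine VanishBelow.sum fun q hq => ?_
  rw [Finset.HasAntidiagonal.mem_antidiagonal] at hq
  rw [← map_sub]
  refine VanishBelow.extPart hmom ((hf q.2 (by omega)).mono ?_)
  exact Finset.single_le_sum (f := fun j => a + S.depth j) (fun _ _ => Nat.zero_le _)
    (Finset.mem_range.2 (by omega))

theorem exists_agreeBelow_polyFun (y : Euc n) (m N : ℕ) (u : FormalFun n (Euc n)) :
    ∃ P, AgreeBelow m N y u (polyFun P) := by
  refine ⟨∑ a ∈ Finset.range (m + 1), (PowerSeries.X ^ a : PowerSeries ℂ) •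
    MvPolynomial.map PowerSeries.C (taylorPoly y N (PowerSeries.coeff a u)), fun j hj => ?_⟩
  have : PowerSeries.coeff j (polyFun (∑ a ∈ Finset.range (m + 1),
      (PowerSeries.X ^ a : PowerSeries ℂ) •
      MvPolynomial.map PowerSeries.C (taylorPoly y N (PowerSeries.coeff a u)))) =
      evalFun (taylorPoly y N (PowerSeries.coeff j u)) := by
    rw [map_sum, map_sum]
    simp only [map_smul, polyFun_map_C]
    rw [Finset.sum_eq_single j]
    · rw [coeff_formal_smul, Finset.sum_eq_single (j, 0)]
      · simp [PowerSeries.coeff_X_pow]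
      · rintro ⟨b, e⟩ hb hne
        rw [Finset.HasAntidiagonal.mem_antidiagonal] at hb
        have he : e ≠ 0 := by
          rintro rfl
          exact hne (by simpa using hb)
        simp [PowerSeries.coeff_C, he]
      · intro h; simp at h
    · intro b _ hb
      rw [coeff_formal_smul]
      refine Finset.sum_eq_zero fun q hq => ?_
      rw [Finset.HasAntidiagonal.mem_antidiagonal] at hq
      by_cases hq0 : q.2 = 0
      · have : q.1 ≠ b := by omega
        simp [PowerSeries.coeff_X_pow, this]
      · simp [PowerSeries.coeff_C, hq0]
    · intro h
      exact absurd (Finset.mem_range.2 (by omega)) h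
  rw [this]
  exact vanishBelow_sub_taylorPoly y N _

/-- At a fixed order and point both sides depend on finite jets of `u` and `v` at `mom x`, so these
may be replaced by polynomials with the same jets. `N₁` and `N₂` serve the extension of the product,
`N₃` and `N₄` the product of the extensions. -/
theorem IsQuantization.extension_star (h : IsQuantization S mom T) {gutt : Deformation n (Euc n)}
    (hgutt : ∀ P Q, ∃ W, gutt.star (polyFun P) (polyFun Q) = polyFun W ∧
      T W = S.star (T P) (T Q)) (u v : FormalFun n (Euc n)) :
    extension hmom S T (gutt.star u v) = S.star (extension hmom S T u) (extension hmom S T v) := by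
  ext1 m
  refine Subtype.ext (funext fun x => ?_)
  change coeffAt m _ x = coeffAt m _ x
  obtain ⟨N₁, h₁⟩ := agreeBelow_extension (S := S) (T := T) hmom m 1
  obtain ⟨N₂, h₂⟩ := exists_agreeBelow_star_euc gutt m N₁
  obtain ⟨N₃, h₃⟩ := S.exists_agreeBelow_star m
  obtain ⟨N₄, h₄⟩ := agreeBelow_extension (S := S) (T := T) hmom m N₃
  obtain ⟨P, hP⟩ := exists_agreeBelow_polyFun (mom x) m (N₂ + N₄) u
  obtain ⟨Q, hQ⟩ := exists_agreeBelow_polyFun (mom x) m (N₂ + N₄) v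
  obtain ⟨W, hW, hTW⟩ := hgutt P Q
  rw [(h₁ x _ _ (h₂ _ _ _ _ _ (hP.mono (by omega)) (hQ.mono (by omega)))).coeffAt_eq, hW,
    h.extension_polyFun, hTW, h₃ x _ _ _ _ (h₄ x _ _ (hP.mono (by omega)))
      (h₄ x _ _ (hQ.mono (by omega))), h.extension_polyFun, h.extension_polyFun]

end StarCompatibility

/-! ### Exponential series of a formal power series with complex coefficients. -/

section PowerSeriesExp

theorem hasSum_of_eq {f g : ℕ → ℂ} {a : ℂ} (h : HasSum g a) (e : ∀ r, f r = g r) :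
    HasSum f a := by
  rwa [funext e]

theorem coeff_pow_eq_zero {A : Type*} [CommRing A] {N : PowerSeries A}
    (hN : PowerSeries.coeff 0 N = 0) {i j : ℕ} (hij : j < i) : PowerSeries.coeff j (N ^ i) = 0 := by
  have h1 : PowerSeries.X ∣ N := by
    rw [PowerSeries.X_dvd_iff, ← PowerSeries.coeff_zero_eq_constantCoeff_apply, hN]
  exact PowerSeries.X_pow_dvd_iff.1 (pow_dvd_pow_of_dvd h1 i) j hij

theorem hasSum_shifted_exp (z : ℂ) (i : ℕ) :
    HasSum (fun r : ℕ => if i ≤ r then (((r - i)! : ℕ) : ℂ)⁻¹ * z ^ (r - i) else 0)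
      (Complex.exp z) := by
  have h : HasSum (fun r : ℕ => ((r ! : ℕ) : ℂ)⁻¹ * z ^ r) (Complex.exp z) := by
    have := NormedSpace.expSeries_div_hasSum_exp z
    rw [← Complex.exp_eq_exp_ℂ] at this
    simpa [div_eq_inv_mul] using this
  rw [← (add_left_injective i).hasSum_iff]
  · have h1 : (fun r : ℕ => if i ≤ r then (((r - i)! : ℕ) : ℂ)⁻¹ * z ^ (r - i) else 0) ∘
        (fun r => r + i) = fun r : ℕ => ((r ! : ℕ) : ℂ)⁻¹ * z ^ r := by
      funext r
      simp
    rw [h1]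
    exact h
  · intro r hr
    rw [if_neg]
    intro hle
    exact hr ⟨r - i, by simp; omega⟩

/-- `N` has no constant term, so only the powers `N ^ i` with `i ≤ j` reach order `j`. The binomial
formula then splits the series into finitely many shifted exponential series of `z`. -/
theorem hasSum_coeff_pow (z : ℂ) {N : PowerSeries ℂ} (hN : PowerSeries.coeff 0 N = 0) (j : ℕ) :
    HasSum (fun r : ℕ => ((r ! : ℕ) : ℂ)⁻¹ * PowerSeries.coeff j ((PowerSeries.C z + N) ^ r))
      (Complex.exp z * ∑ i ∈ Finset.range (j + 1), ((i ! : ℕ) : ℂ)⁻¹ * PowerSeries.coeff j (N ^ i)) := by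
  rw [Finset.mul_sum]
  have h := hasSum_sum (f := fun i r => (if i ≤ r then (((r - i)! : ℕ) : ℂ)⁻¹ * z ^ (r - i) else 0) *
      (((i ! : ℕ) : ℂ)⁻¹ * PowerSeries.coeff j (N ^ i))) (s := Finset.range (j + 1))
    fun i _ => (hasSum_shifted_exp z i).mul_right _
  refine hasSum_of_eq h fun r => ?_
  rw [add_comm, add_pow, map_sum, Finset.mul_sum]
  set F : ℕ → ℂ := fun i => (if i ≤ r then (((r - i)! : ℕ) : ℂ)⁻¹ * z ^ (r - i) else 0) *
      (((i ! : ℕ) : ℂ)⁻¹ * PowerSeries.coeff j (N ^ i)) with hF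
  have h1 : ∀ i ∈ Finset.range (r + 1), ((r ! : ℕ) : ℂ)⁻¹ * PowerSeries.coeff j
      (N ^ i * PowerSeries.C z ^ (r - i) * ((r.choose i : ℕ) : PowerSeries ℂ)) = F i := by
    intro i hi
    rw [Finset.mem_range] at hi
    have hir : i ≤ r := by omega
    have h2 : N ^ i * PowerSeries.C z ^ (r - i) * ((r.choose i : ℕ) : PowerSeries ℂ) =
        PowerSeries.C (z ^ (r - i) * (r.choose i : ℕ)) * N ^ i := by
      rw [map_mul, map_pow, map_natCast]; ring
    rw [h2, PowerSeries.coeff_C_mul, hF]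
    simp only [if_pos hir]
    have h3 : ((r.choose i : ℕ) : ℂ) * (i ! : ℕ) * ((r - i)! : ℕ) = (r ! : ℕ) := by
      exact_mod_cast Nat.choose_mul_factorial_mul_factorial hir
    have h4 : ((i ! : ℕ) : ℂ) ≠ 0 := by exact_mod_cast i.factorial_ne_zero
    have h5 : (((r - i)! : ℕ) : ℂ) ≠ 0 := by exact_mod_cast (r - i).factorial_ne_zero
    have h6 : ((r ! : ℕ) : ℂ) ≠ 0 := by exact_mod_cast r.factorial_ne_zero
    have h7 : ((r.choose i : ℕ) : ℂ) ≠ 0 := by exact_mod_cast (Nat.choose_pos hir).ne'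
    rw [← h3]
    field_simp
  rw [Finset.sum_congr rfl h1]
  -- Both index ranges are enlarged to a common one: terms with `i > r` vanish by the `if`, terms
  -- with `i > j` because `N ^ i` has order at least `i`.
  have h2 : ∑ i ∈ Finset.range (r + 1), F i = ∑ i ∈ Finset.range (r + 1 + (j + 1)), F i := by
    refine Finset.sum_subset (Finset.range_mono (by omega)) fun i _ hi => ?_
    rw [Finset.mem_range] at hi
    simp only [hF]
    rw [if_neg (by omega), zero_mul]
  have h3 : ∑ i ∈ Finset.range (j + 1), F i = ∑ i ∈ Finset.range (r + 1 + (j + 1)), F i := by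
    refine Finset.sum_subset (Finset.range_mono (by omega)) fun i _ hi => ?_
    rw [Finset.mem_range] at hi
    simp only [hF]
    rw [coeff_pow_eq_zero hN (by omega), mul_zero, mul_zero]
  rw [h2, ← h3]

end PowerSeriesExp

/-! ### The formal exponential of a linear function and its Taylor coefficients. -/

section FormalExp

variable {n : ℕ}

/-- The function `e^{qX}` for `q ∈ ℂⁿ`. -/
def expFun (q : Fin n → ℂ) : SmoothFun n (Euc n) :=
  ⟨fun μ => Complex.exp (∑ k, q k * ((μ k : ℝ) : ℂ)), by
    have h : ContDiff ℝ ∞ (fun μ : Euc n => Complex.exp (∑ k, q k * ((μ k : ℝ) : ℂ))) :=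
      Complex.contDiff_exp.comp (ContDiff.sum fun k _ =>
        contDiff_const.mul (contDiff_coe (coord k)))
    exact h.contMDiff⟩

theorem expFun_apply (q : Fin n → ℂ) (μ : Euc n) :
    (expFun q : Euc n → ℂ) μ = Complex.exp (∑ k, q k * ((μ k : ℝ) : ℂ)) := rfl

theorem pd_expFun (q : Fin n → ℂ) (l : Fin n) : pd l (expFun q) = q l • expFun q := by
  refine Subtype.ext (funext fun x => ?_)
  change fderiv ℝ (fun μ : Euc n => Complex.exp (∑ k, q k * ((μ k : ℝ) : ℂ))) x (eVec l) = _
  have h : HasFDerivAt (fun μ : Euc n => ∑ k, q k * ((μ k : ℝ) : ℂ))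
      (∑ k, q k • (Complex.ofRealCLM.comp (EuclideanSpace.proj (𝕜 := ℝ) k))) x :=
    HasFDerivAt.fun_sum fun k _ =>
      ((Complex.ofRealCLM.comp (EuclideanSpace.proj (𝕜 := ℝ) k)).hasFDerivAt).const_mul (q k)
  rw [h.cexp.fderiv]
  change _ = q l * Complex.exp (∑ k, q k * ((x k : ℝ) : ℂ))
  rw [smul_apply, sum_apply, smul_eq_mul, mul_comm, Finset.sum_eq_single l]
  · simp
  · intro b _ hb
    simp [hb]
  · simp

/-- The coefficientwise partial derivative of a formal series of functions. -/
def formalPd (l : Fin n) : FormalFun n (Euc n) →ₗ[PowerSeries ℂ] FormalFun n (Euc n) :=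
  formalMap fun a => if a = 0 then pd l else 0

theorem coeff_formalPd (l : Fin n) (f : FormalFun n (Euc n)) (m : ℕ) :
    PowerSeries.coeff m (formalPd l f) = pd l (PowerSeries.coeff m f) := by
  rw [formalPd, coeff_formalMap, Finset.sum_eq_single (0, m)]
  · simp
  · rintro ⟨a, b⟩ hab hne
    rw [Finset.HasAntidiagonal.mem_antidiagonal] at hab
    have : a ≠ 0 := by
      rintro rfl
      exact hne (by simpa using hab)
    simp [this]
  · intro h
    simp at h

theorem formalPd_mul (l : Fin n) (f g : FormalFun n (Euc n)) :
    formalPd l (f * g) = f * formalPd l g + g * formalPd l f := by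
  ext1 m
  rw [coeff_formalPd, mul_comm g, map_add, PowerSeries.coeff_mul, PowerSeries.coeff_mul,
    PowerSeries.coeff_mul, map_sum, ← Finset.sum_add_distrib]
  refine Finset.sum_congr rfl fun q _ => ?_
  rw [pd_mul, coeff_formalPd, coeff_formalPd, mul_comm (pd l _)]

theorem formalPd_C (l : Fin n) (u : SmoothFun n (Euc n)) :
    formalPd l (PowerSeries.C u) = PowerSeries.C (pd l u) := by
  ext1 m
  rw [coeff_formalPd, PowerSeries.coeff_C, PowerSeries.coeff_C]
  split_ifs <;> simp

theorem formalPd_linearFun (p : Fin n → PowerSeries ℂ) (l : Fin n) :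
    formalPd l (linearFun p) = algebraMap (PowerSeries ℂ) _ (p l) := by
  rw [linearFun, map_sum]
  simp only [map_smul, formalPd_C, pd_coord]
  rw [Finset.sum_eq_single l]
  · rw [if_pos rfl, map_one, Algebra.algebraMap_eq_smul_one]
  · intro b _ hb
    rw [if_neg (Ne.symm hb), map_zero, smul_zero]
  · intro hl
    exact absurd (Finset.mem_univ l) hl

theorem formalPd_one (l : Fin n) : formalPd l (1 : FormalFun n (Euc n)) = 0 := by
  rw [← map_one PowerSeries.C, formalPd_C, pd_one, map_zero]

theorem formalPd_linearFun_pow (p : Fin n → PowerSeries ℂ) (l : Fin n) (r : ℕ) :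
    formalPd l (linearFun p ^ (r + 1)) = ((r : ℂ) + 1) • (p l • linearFun p ^ r) := by
  induction r with
  | zero =>
    rw [zero_add, pow_one, formalPd_linearFun, pow_zero, Algebra.algebraMap_eq_smul_one,
      Nat.cast_zero, zero_add, one_smul]
  | succ r ih =>
    rw [pow_succ', formalPd_mul, ih, formalPd_linearFun, mul_smul_comm, mul_smul_comm, ← pow_succ',
      mul_comm, ← Algebra.smul_def, Nat.cast_succ,
      add_smul ((r : ℂ) + 1) (1 : ℂ), one_smul]

/-- The nilpotent part `(p - p₀)X` of `pX`. -/
def nilPart (p : Fin n → PowerSeries ℂ) : FormalFun n (Euc n) :=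
  linearFun fun k => p k - PowerSeries.C (PowerSeries.constantCoeff (p k))

theorem linearFun_add (p q : Fin n → PowerSeries ℂ) :
    linearFun (fun k => p k + q k) = linearFun p + linearFun q := by
  simp [linearFun, add_smul, Finset.sum_add_distrib]

theorem coeff_zero_nilPart (p : Fin n → PowerSeries ℂ) : PowerSeries.coeff 0 (nilPart p) = 0 := by
  rw [nilPart, linearFun, map_sum]
  refine Finset.sum_eq_zero fun k _ => ?_
  rw [coeff_formal_smul]
  simp

/-- The truncated exponential `e^{p₀X} ∑_{i < R} (1/i!) ((p - p₀)X)^i`. -/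
def truncExp (p : Fin n → PowerSeries ℂ) (R : ℕ) : FormalFun n (Euc n) :=
  PowerSeries.C (expFun fun k => PowerSeries.constantCoeff (p k)) *
    ∑ i ∈ Finset.range R, ((i ! : ℂ))⁻¹ • nilPart p ^ i

/-- The formal exponential `e^{pX}`. -/
def formalExp (p : Fin n → PowerSeries ℂ) : FormalFun n (Euc n) :=
  PowerSeries.mk fun j => PowerSeries.coeff j (truncExp p (j + 1))

theorem coeff_complex_smul {A : Type*} [CommRing A] [Algebra ℂ A] (c : ℂ) (f : PowerSeries A)
    (m : ℕ) : PowerSeries.coeff m (c • f) = c • PowerSeries.coeff m f := rfl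

theorem coeff_truncExp (p : Fin n → PowerSeries ℂ) (R j : ℕ) :
    PowerSeries.coeff j (truncExp p R) = expFun (fun k => PowerSeries.constantCoeff (p k)) *
      ∑ i ∈ Finset.range R, ((i ! : ℂ))⁻¹ • PowerSeries.coeff j (nilPart p ^ i) := by
  rw [truncExp, PowerSeries.coeff_C_mul, map_sum]
  rfl

theorem coeff_formalExp (p : Fin n → PowerSeries ℂ) {R j : ℕ} (h : j < R) :
    PowerSeries.coeff j (formalExp p) = PowerSeries.coeff j (truncExp p R) := by
  rw [formalExp, PowerSeries.coeff_mk, coeff_truncExp, coeff_truncExp]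
  congr 1
  refine Finset.sum_subset (Finset.range_mono h) fun i _ hi => ?_
  rw [Finset.mem_range, not_lt] at hi
  rw [coeff_pow_eq_zero (coeff_zero_nilPart p) (by omega), smul_zero]

theorem coeff_smul_formalExp (c : PowerSeries ℂ) (p : Fin n → PowerSeries ℂ) {R j : ℕ} (h : j < R) :
    PowerSeries.coeff j (c • formalExp p) = PowerSeries.coeff j (c • truncExp p R) := by
  rw [coeff_formal_smul, coeff_formal_smul]
  refine Finset.sum_congr rfl fun q hq => ?_
  rw [Finset.HasAntidiagonal.mem_antidiagonal] at hq
  rw [coeff_formalExp p (R := R) (by omega)]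

/-- Differentiating the truncated sum shortens it by one term, hence the two lengths. They become
indistinguishable in `formalPd_formalExp`, where both exceed the order considered. -/
theorem formalPd_truncExp (p : Fin n → PowerSeries ℂ) (l : Fin n) (R : ℕ) :
    formalPd l (truncExp p (R + 1)) =
      PowerSeries.C (PowerSeries.constantCoeff (p l)) • truncExp p (R + 1) +
      (p l - PowerSeries.C (PowerSeries.constantCoeff (p l))) • truncExp p R := by
  rw [truncExp, formalPd_mul, formalPd_C, pd_expFun, add_comm]
  congr 1
  · rw [mul_comm, ← smul_mul_assoc]
    congr 1
    ext1 m
    rw [coeff_C_smul, PowerSeries.coeff_C, PowerSeries.coeff_C]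
    split_ifs <;> simp
  · rw [truncExp, ← mul_smul_comm]
    congr 1
    rw [Finset.sum_range_succ', map_add, map_sum, Finset.smul_sum]
    have hc : ∀ (c : ℂ) (f : FormalFun n (Euc n)), formalPd l (c • f) = c • formalPd l f := by
      intro c f
      ext1 m
      rw [coeff_formalPd, coeff_complex_smul, coeff_complex_smul, map_smul, coeff_formalPd]
    rw [hc, pow_zero, formalPd_one, smul_zero, add_zero]
    refine Finset.sum_congr rfl fun i _ => ?_
    rw [hc, nilPart, formalPd_linearFun_pow, smul_smul, smul_comm]
    congr 2
    rw [Nat.factorial_succ]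
    have h1 : (i ! : ℂ) ≠ 0 := by exact_mod_cast i.factorial_ne_zero
    have h2 : ((i : ℂ) + 1) ≠ 0 := by exact_mod_cast i.succ_ne_zero
    push_cast
    field_simp

theorem formalPd_formalExp (p : Fin n → PowerSeries ℂ) (l : Fin n) :
    formalPd l (formalExp p) = p l • formalExp p := by
  ext1 j
  rw [coeff_formalPd, coeff_formalExp p (R := j + 1 + 1) (by omega), ← coeff_formalPd,
    formalPd_truncExp, map_add, ← coeff_smul_formalExp _ _ (by omega),
    ← coeff_smul_formalExp _ _ (by omega), ← map_add, ← add_smul, add_sub_cancel]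

/-- Evaluation of the coefficients at a point. -/
def formalEval (μ : Euc n) : FormalFun n (Euc n) →+* PowerSeries ℂ :=
  PowerSeries.map ((Pi.evalRingHom (fun _ : Euc n => ℂ) μ).comp (SmoothFun n (Euc n)).val.toRingHom)

theorem coeff_formalEval (μ : Euc n) (f : FormalFun n (Euc n)) (j : ℕ) :
    PowerSeries.coeff j (formalEval μ f) = coeffAt j f μ := by
  rw [formalEval, PowerSeries.coeff_map]; rfl

theorem isFormalExp_formalExp (p : Fin n → PowerSeries ℂ) :
    IsFormalExp (linearFun p) (formalExp p) := by
  intro j μ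
  have hlin : linearFun p = nilPart p +
      linearFun fun k => PowerSeries.C (PowerSeries.constantCoeff (p k)) := by
    rw [nilPart, ← linearFun_add]
    simp
  have h0 : formalEval μ (linearFun p) =
      PowerSeries.C (∑ k, PowerSeries.constantCoeff (p k) * ((μ k : ℝ) : ℂ)) +
        formalEval μ (nilPart p) := by
    rw [hlin, map_add, add_comm]
    congr 1
    ext m
    rw [coeff_formalEval, coeffAt, linearFun, map_sum]
    simp only [coeff_C_smul, PowerSeries.coeff_C]
    rw [← evalAt_apply, map_sum]
    split_ifs <;> simp
  have hN : PowerSeries.coeff 0 (formalEval μ (nilPart p)) = 0 := by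
    rw [coeff_formalEval, coeffAt, coeff_zero_nilPart]; rfl
  have h := hasSum_coeff_pow (∑ k, PowerSeries.constantCoeff (p k) * ((μ k : ℝ) : ℂ)) hN j
  rw [← h0] at h
  simp only [← map_pow, coeff_formalEval] at h
  have he : coeffAt j (formalExp p) μ =
      Complex.exp (∑ k, PowerSeries.constantCoeff (p k) * ((μ k : ℝ) : ℂ)) *
      ∑ i ∈ Finset.range (j + 1), ((i ! : ℕ) : ℂ)⁻¹ * coeffAt j (nilPart p ^ i) μ := by
    rw [coeffAt, formalExp, PowerSeries.coeff_mk, coeff_truncExp]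
    have hm : ∀ u v : SmoothFun n (Euc n),
        ((u * v : SmoothFun n (Euc n)) : Euc n → ℂ) μ = (u : Euc n → ℂ) μ * evalAt μ v :=
      fun _ _ => rfl
    rw [hm, map_sum]
    rfl
  rw [he]
  exact h

/-- The exponential series may be differentiated termwise. Differentiation brings down `p l`, and
the Taylor recursion brings in a shifted variable; generalizing over `c` and `L` absorbs them, so
the induction never leaves series of the same shape. -/
theorem hasSum_taylorPart_formalExp (p : Fin n → PowerSeries ℂ) (y : Euc n) (k j : ℕ)
    (c : PowerSeries ℂ) (L : MvPolynomial (Fin n) ℂ →ₗ[ℂ] ℂ) :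
    HasSum (fun r : ℕ => ((r ! : ℂ))⁻¹ *
      L (taylorPart y k (PowerSeries.coeff j (c • linearFun p ^ r))))
      (L (taylorPart y k (PowerSeries.coeff j (c • formalExp p)))) := by
  induction k generalizing j c L with
  | zero =>
    have hL : ∀ f : FormalFun n (Euc n), L (taylorPart y 0 (PowerSeries.coeff j (c • f))) =
        ∑ q ∈ Finset.HasAntidiagonal.antidiagonal j,
          (PowerSeries.coeff q.1 c * L 1) * coeffAt q.2 f y := by
      intro f
      rw [taylorPart_zero, ← mul_one (MvPolynomial.C _), ← MvPolynomial.smul_eq_C_mul, map_smul,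
        coeff_formal_smul, ← evalAt_apply, map_sum, Finset.sum_smul]
      refine Finset.sum_congr rfl fun q _ => ?_
      rw [map_smul, smul_eq_mul, smul_eq_mul, evalAt_apply, coeffAt]
      ring
    simp only [hL]
    have hq : ∀ q : ℕ × ℕ, HasSum (fun r : ℕ => (PowerSeries.coeff q.1 c * L 1) *
        (((r ! : ℂ))⁻¹ * coeffAt q.2 (linearFun p ^ r) y))
        ((PowerSeries.coeff q.1 c * L 1) * coeffAt q.2 (formalExp p) y) := fun q =>
      HasSum.mul_left _ (isFormalExp_formalExp p q.2 y)
    refine hasSum_of_eq (hasSum_sum fun q _ => hq q) fun r => ?_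
    rw [Finset.mul_sum]
    refine Finset.sum_congr rfl fun q _ => ?_
    rw [mul_left_comm]
  | succ k ih =>
    have hL : ∀ f : FormalFun n (Euc n), L (taylorPart y (k + 1) (PowerSeries.coeff j (c • f))) =
        ∑ l, (L ∘ₗ LinearMap.mulLeft ℂ (shiftedX y l))
          (taylorPart y k (PowerSeries.coeff j (c • formalPd l f))) := by
      intro f
      rw [taylorPart_succ, map_sum]
      refine Finset.sum_congr rfl fun l _ => ?_
      rw [← coeff_formalPd, map_smul]
      rfl
    simp only [hL, Finset.mul_sum]
    refine hasSum_sum fun l _ => ?_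
    -- The term `r = 0` is constant and is killed by the derivative, so the series restarts at `r =
    -- 1`.
    rw [← hasSum_nat_add_iff' 1]
    simp only [Finset.range_one, Finset.sum_singleton, pow_zero, formalPd_one, smul_zero, map_zero,
      mul_zero, sub_zero]
    rw [formalPd_formalExp, smul_smul]
    refine hasSum_of_eq (ih j (c * p l) (L ∘ₗ LinearMap.mulLeft ℂ (shiftedX y l))) fun r => ?_
    rw [formalPd_linearFun_pow, smul_comm c, smul_smul, coeff_complex_smul, map_smul, map_smul,
      smul_eq_mul, ← mul_assoc]
    congr 1
    rw [Nat.factorial_succ]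
    have h1 : (r ! : ℂ) ≠ 0 := by exact_mod_cast r.factorial_ne_zero
    have h2 : ((r : ℂ) + 1) ≠ 0 := by exact_mod_cast r.succ_ne_zero
    push_cast
    field_simp

end FormalExp

/-! ### Star exponentials as extensions of exponentials. -/

section StarExponential

variable {d n : ℕ} {M : Type*} [TopologicalSpace M] [ChartedSpace (Euc d) M]
  [IsManifold (𝓡 d) ∞ M] {S : Deformation d M} {mom : M → Euc n}
  (hmom : ContMDiff (𝓡 d) (𝓡 n) ∞ mom)
  {T : MvPolynomial (Fin n) (PowerSeries ℂ) →ₗ[PowerSeries ℂ] FormalFun d M}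

theorem polyFun_affinePoly (p : Fin n → PowerSeries ℂ) :
    polyFun (affinePoly p 0) = linearFun p := by
  simp [affinePoly, polyFun, linearFun]

theorem coeffAt_extension (f : FormalFun n (Euc n)) (m : ℕ) (x : M) :
    coeffAt m (extension hmom S T f) x = ∑ q ∈ Finset.HasAntidiagonal.antidiagonal m,
      ∑ r ∈ Finset.range (S.depth q.1 + 1), ((r ! : ℂ))⁻¹ *
        (symbolPart T q.1 (taylorPart (mom x) r (PowerSeries.coeff q.2 f)) : M → ℂ) x := by
  rw [coeffAt, extension, coeff_formalMap, ← evalAt_apply, map_sum]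
  exact Finset.sum_congr rfl fun q _ => extPart_apply hmom _ _ _

/-- The star powers are the images of the ordinary powers of `linearFun p`, and a coefficient of
`extension` at a point is a finite combination of Taylor functionals, so the summation passes
through it. -/
theorem IsQuantization.isStarExp (h : IsQuantization S mom T) (p : Fin n → PowerSeries ℂ) :
    S.IsStarExp (T (affinePoly p 0)) (extension hmom S T (formalExp p)) := by
  intro j x
  have hr : ∀ r : ℕ, S.starPow (T (affinePoly p 0)) r =
      extension hmom S T (linearFun p ^ r) := by
    intro r
    rw [← h.affine_pow, ← h.extension_polyFun hmom, map_pow, polyFun_affinePoly]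
  simp only [hr, coeffAt_extension, Finset.mul_sum]
  refine hasSum_sum fun q _ => hasSum_sum fun k _ => ?_
  have := (hasSum_taylorPart_formalExp p (mom x) k q.2 1 (evalAt x ∘ₗ symbolPart T q.1)).mul_left
    ((k ! : ℂ))⁻¹
  simp only [one_smul] at this
  refine hasSum_of_eq this fun r => ?_
  rw [LinearMap.comp_apply, evalAt_apply]
  ring

end StarExponential

/-! ### The class 𝒜⁰ and its stability properties. -/

section SymbolClassZero

variable {n : ℕ}

theorem one_le_japanese (x : Euc n) : 1 ≤ japanese x := by
  rw [japanese, Real.one_le_sqrt]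
  nlinarith [sq_nonneg ‖x‖]

theorem norm_le_japanese (x : Euc n) : ‖x‖ ≤ japanese x :=
  Real.le_sqrt_of_sq_le (by linarith)

theorem japanese_le (x : Euc n) : japanese x ≤ 1 + ‖x‖ := by
  rw [japanese, Real.sqrt_le_left (by positivity)]
  nlinarith [norm_nonneg x]

theorem japanese_rpow_mono (x : Euc n) {s t : ℝ} (h : s ≤ t) :
    japanese x ^ s ≤ japanese x ^ t :=
  Real.rpow_le_rpow_of_exponent_le (one_le_japanese x) h

theorem japanese_rpow_pos (x : Euc n) (s : ℝ) : 0 < japanese x ^ s :=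
  Real.rpow_pos_of_pos (zero_lt_one.trans_le (one_le_japanese x)) s

theorem InSymbolClassZero.add {u v : Euc n → ℂ} (hu : InSymbolClassZero u)
    (hv : InSymbolClassZero v) : InSymbolClassZero (u + v) := by
  obtain ⟨hu, σ, hσ, hu'⟩ := hu
  obtain ⟨hv, τ, hτ, hv'⟩ := hv
  refine ⟨hu.add hv, max σ τ, le_max_of_le_left hσ, fun k => ?_⟩
  obtain ⟨A, hA⟩ := hu' k
  obtain ⟨B, hB⟩ := hv' k
  refine ⟨|A| + |B|, fun x => ?_⟩
  rw [iteratedFDeriv_add_apply (hu.contDiffAt.of_le (by exact_mod_cast le_top))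
    (hv.contDiffAt.of_le (by exact_mod_cast le_top)), add_mul]
  refine (norm_add_le _ _).trans (add_le_add ((hA x).trans ?_) ((hB x).trans ?_))
  · exact mul_le_mul (le_abs_self A) (japanese_rpow_mono x (le_max_left _ _))
      (japanese_rpow_pos x _).le (abs_nonneg A)
  · exact mul_le_mul (le_abs_self B) (japanese_rpow_mono x (le_max_right _ _))
      (japanese_rpow_pos x _).le (abs_nonneg B)

theorem InSymbolClassZero.mul {u v : Euc n → ℂ} (hu : InSymbolClassZero u)
    (hv : InSymbolClassZero v) : InSymbolClassZero (u * v) := by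
  obtain ⟨hu, σ, hσ, hu'⟩ := hu
  obtain ⟨hv, τ, hτ, hv'⟩ := hv
  refine ⟨hu.mul hv, σ + τ, add_nonneg hσ hτ, fun k => ?_⟩
  choose A hA using hu'
  choose B hB using hv'
  refine ⟨∑ i ∈ Finset.range (k + 1), (k.choose i : ℝ) * |A i| * |B (k - i)|, fun x => ?_⟩
  refine (norm_iteratedFDeriv_mul_le hu hv x (n := k) (by exact_mod_cast le_top)).trans ?_
  rw [Finset.sum_mul]
  refine Finset.sum_le_sum fun i _ => ?_
  have h1 : ‖iteratedFDeriv ℝ i u x‖ ≤ |A i| * japanese x ^ σ :=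
    (hA i x).trans (mul_le_mul_of_nonneg_right (le_abs_self _) (japanese_rpow_pos x _).le)
  have h2 : ‖iteratedFDeriv ℝ (k - i) v x‖ ≤ |B (k - i)| * japanese x ^ τ :=
    (hB (k - i) x).trans (mul_le_mul_of_nonneg_right (le_abs_self _) (japanese_rpow_pos x _).le)
  have h3 := mul_le_mul h1 h2 (norm_nonneg _) (mul_nonneg (abs_nonneg _) (japanese_rpow_pos x _).le)
  rw [Real.rpow_add (zero_lt_one.trans_le (one_le_japanese x)), mul_assoc]
  refine (mul_le_mul_of_nonneg_left h3 (Nat.cast_nonneg _)).trans (le_of_eq ?_)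
  ring

theorem norm_iteratedFDeriv_pd_le (l : Fin n) (u : SmoothFun n (Euc n)) (k : ℕ) (x : Euc n) :
    ‖iteratedFDeriv ℝ k (pd l u : Euc n → ℂ) x‖ ≤
      ‖iteratedFDeriv ℝ (k + 1) (u : Euc n → ℂ) x‖ := by
  have h3 := norm_iteratedFDeriv_clm_apply_const (c := eVec l) (x := x) (n := k)
    (f := fderiv ℝ (u : Euc n → ℂ)) (N := ∞)
    ((contDiff_coe u).fderiv_right (m := ∞) (by simp)).contDiffAt (by exact_mod_cast le_top)
  rw [norm_iteratedFDeriv_fderiv] at h3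
  have h4 : ‖eVec l‖ = 1 := by simp
  rw [h4, one_mul] at h3
  exact h3

set_option synthInstance.maxHeartbeats 200000 in
-- Converse to `norm_iteratedFDeriv_pd_le`: the total derivative is a finite sum of fixed linear
-- maps applied to the partials. Symbol estimates can therefore be proved by induction through `pd`.
theorem exists_norm_iteratedFDeriv_succ_le (n : ℕ) :
    ∃ K : Fin n → ℝ, (∀ l, 0 ≤ K l) ∧ ∀ (u : SmoothFun n (Euc n)) (k : ℕ) (x : Euc n),
      ‖iteratedFDeriv ℝ (k + 1) (u : Euc n → ℂ) x‖ ≤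
        ∑ l, K l * ‖iteratedFDeriv ℝ k (pd l u : Euc n → ℂ) x‖ := by
  set B : Fin n → ℂ →L[ℝ] (Euc n →L[ℝ] ℂ) := fun l =>
    ContinuousLinearMap.smulRightL ℝ (Euc n) ℂ (EuclideanSpace.proj (𝕜 := ℝ) l) with hB
  refine ⟨fun l => ‖B l‖, fun l => (B l).opNorm_nonneg, fun u k x => ?_⟩
  have h1 : fderiv ℝ (u : Euc n → ℂ) = fun x => ∑ l, (B l ∘ (pd l u : Euc n → ℂ)) x := by
    funext z
    ext w
    have hw : w = ∑ l, w l • eVec l := by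
      ext j; simp [Finset.sum_apply, Pi.single_apply]
    conv_lhs => rw [hw]
    simp only [map_sum, map_smul, sum_apply, Function.comp_apply]
    rfl
  have hc : ∀ l, ContDiff ℝ ∞ (B l ∘ (pd l u : Euc n → ℂ)) := fun l =>
    (B l).contDiff.comp (contDiff_coe _)
  rw [← norm_iteratedFDeriv_fderiv, h1, iteratedFDeriv_fun_sum_apply
    fun l _ => (hc l).contDiffAt.of_le (by exact_mod_cast le_top)]
  refine (norm_sum_le _ _).trans (Finset.sum_le_sum fun l _ => ?_)
  exact (B l).norm_iteratedFDeriv_comp_left (contDiff_coe (pd l u)).contDiffAt (N := ∞)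
    (by exact_mod_cast le_top)

theorem inSymbolClassZero_of_pd {u : SmoothFun n (Euc n)} {σ : ℝ} (hσ : 0 ≤ σ)
    (h : ∀ k : ℕ, ∃ C : ℝ, ∀ x, ‖iteratedFDeriv ℝ k (u : Euc n → ℂ) x‖ ≤ C * japanese x ^ σ) :
    InSymbolClassZero (u : Euc n → ℂ) := ⟨contDiff_coe u, σ, hσ, h⟩

theorem inSymbolClassZero_const (c : ℂ) : InSymbolClassZero (fun _ : Euc n => c) := by
  refine ⟨contDiff_const, 0, le_rfl, fun k => ⟨‖c‖, fun x => ?_⟩⟩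
  rw [Real.rpow_zero, mul_one]
  rcases k with _ | k
  · simp
  · rw [iteratedFDeriv_succ_const]; simp

/-- The smooth functions in the class `𝒜⁰`. -/
def symbolZero (n : ℕ) : Subalgebra ℂ (SmoothFun n (Euc n)) where
  carrier := {u | InSymbolClassZero (u : Euc n → ℂ)}
  mul_mem' hu hv := InSymbolClassZero.mul hu hv
  add_mem' hu hv := InSymbolClassZero.add hu hv
  algebraMap_mem' c := inSymbolClassZero_const c

theorem pd_mem_symbolZero {u : SmoothFun n (Euc n)} (hu : u ∈ symbolZero n) (l : Fin n) :
    pd l u ∈ symbolZero n := by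
  obtain ⟨_, σ, hσ, hu'⟩ := hu
  refine inSymbolClassZero_of_pd hσ fun k => ?_
  obtain ⟨C, hC⟩ := hu' (k + 1)
  exact ⟨C, fun x => (norm_iteratedFDeriv_pd_le l u k x).trans (hC x)⟩

theorem coord_mem_symbolZero (l : Fin n) : coord l ∈ symbolZero n := by
  obtain ⟨K, hK0, hK⟩ := exists_norm_iteratedFDeriv_succ_le n
  refine inSymbolClassZero_of_pd zero_le_one fun k => ?_
  rcases k with _ | k
  · refine ⟨1, fun x => ?_⟩
    rw [norm_iteratedFDeriv_zero, Real.rpow_one, one_mul, coord_apply, Complex.norm_real]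
    exact (PiLp.norm_apply_le x l).trans (norm_le_japanese x)
  · refine ⟨∑ i, K i, fun x => (hK _ _ _).trans ?_⟩
    rw [Finset.sum_mul]
    refine Finset.sum_le_sum fun i _ => mul_le_mul_of_nonneg_left ?_ (hK0 i)
    have hc : ∃ c : ℂ, ‖c‖ ≤ 1 ∧ (pd i (coord l) : Euc n → ℂ) = fun _ => c := by
      rw [pd_coord]
      split_ifs
      · exact ⟨1, by simp, rfl⟩
      · exact ⟨0, by simp, rfl⟩
    obtain ⟨c, hc1, hc⟩ := hc
    rw [hc, Real.rpow_one]
    refine le_trans ?_ (one_le_japanese x)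
    rcases k with _ | k
    · simpa using hc1
    · rw [iteratedFDeriv_succ_const]; simp

/-- For imaginary exponents the exponential has modulus one and each partial multiplies it by a
constant, so all derivatives are bounded. -/
theorem expFun_mem_symbolZero {q : Fin n → ℂ} (hq : ∀ k, (q k).re = 0) :
    expFun q ∈ symbolZero n := by
  obtain ⟨K, hK0, hK⟩ := exists_norm_iteratedFDeriv_succ_le n
  refine inSymbolClassZero_of_pd le_rfl fun k => ?_
  simp only [Real.rpow_zero, mul_one]
  induction k with
  | zero =>
    refine ⟨1, fun x => ?_⟩
    rw [norm_iteratedFDeriv_zero, expFun_apply, Complex.norm_exp]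
    simp [hq]
  | succ k ih =>
    obtain ⟨C, hC⟩ := ih
    refine ⟨∑ l, K l * (‖q l‖ * C), fun x => (hK _ _ _).trans ?_⟩
    refine Finset.sum_le_sum fun l _ => mul_le_mul_of_nonneg_left ?_ (hK0 l)
    rw [pd_expFun]
    have h1 : ((q l • expFun q : SmoothFun n (Euc n)) : Euc n → ℂ) =
        q l • (expFun q : Euc n → ℂ) := rfl
    rw [h1, iteratedFDeriv_const_smul_apply
      ((contDiff_coe (expFun q)).contDiffAt.of_le (by exact_mod_cast le_top)), norm_smul]
    exact mul_le_mul_of_nonneg_left (hC x) (norm_nonneg _)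

/-- The formal series with coefficients in `𝒜⁰`. -/
def formalSymbolZero (n : ℕ) : Subalgebra ℂ (FormalFun n (Euc n)) where
  carrier := {f | ∀ j, PowerSeries.coeff j f ∈ symbolZero n}
  mul_mem' {f g} hf hg j := by
    rw [PowerSeries.coeff_mul]
    exact sum_mem fun q _ => mul_mem (hf _) (hg _)
  add_mem' {f g} hf hg j := by
    rw [map_add]
    exact add_mem (hf j) (hg j)
  algebraMap_mem' c j := by
    rw [Algebra.algebraMap_eq_smul_one, coeff_complex_smul, PowerSeries.coeff_one]
    split_ifs
    · exact (symbolZero n).smul_mem (one_mem _) c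
    · rw [smul_zero]; exact zero_mem _

theorem smul_mem_formalSymbolZero (c : PowerSeries ℂ) {f : FormalFun n (Euc n)}
    (hf : f ∈ formalSymbolZero n) : c • f ∈ formalSymbolZero n := by
  intro j
  rw [coeff_formal_smul]
  exact sum_mem fun q _ => (symbolZero n).smul_mem (hf _) _

theorem C_mem_formalSymbolZero {u : SmoothFun n (Euc n)} (hu : u ∈ symbolZero n) :
    PowerSeries.C u ∈ formalSymbolZero n := by
  intro j
  rw [PowerSeries.coeff_C]
  split_ifs
  · exact hu
  · exact zero_mem _

theorem linearFun_mem_formalSymbolZero (p : Fin n → PowerSeries ℂ) :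
    linearFun p ∈ formalSymbolZero n :=
  sum_mem fun k _ => smul_mem_formalSymbolZero _ (C_mem_formalSymbolZero (coord_mem_symbolZero k))

theorem polyFun_mem_formalSymbolZero (W : MvPolynomial (Fin n) (PowerSeries ℂ)) :
    polyFun W ∈ formalSymbolZero n := by
  induction W using MvPolynomial.induction_on with
  | C a =>
    rw [← MvPolynomial.algebraMap_eq, AlgHom.commutes, Algebra.algebraMap_eq_smul_one]
    exact smul_mem_formalSymbolZero _ (one_mem _)
  | add p q hp hq => rw [map_add]; exact add_mem hp hq
  | mul_X p l hp =>
    rw [map_mul]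
    refine mul_mem hp ?_
    have : polyFun (MvPolynomial.X l : MvPolynomial (Fin n) (PowerSeries ℂ)) =
        PowerSeries.C (coord l) := by simp [polyFun]
    rw [this]
    exact C_mem_formalSymbolZero (coord_mem_symbolZero l)

theorem formalExp_mem_formalSymbolZero {p : Fin n → PowerSeries ℂ}
    (hp : ∀ k, (PowerSeries.constantCoeff (p k)).re = 0) : formalExp p ∈ formalSymbolZero n := by
  intro j
  rw [formalExp, PowerSeries.coeff_mk]
  refine mul_mem (C_mem_formalSymbolZero (expFun_mem_symbolZero hp)) (sum_mem fun i _ => ?_) j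
  exact (formalSymbolZero n).smul_mem (pow_mem (linearFun_mem_formalSymbolZero _) i) _

theorem opPart_mem_symbolZero {τ : MvPolynomial (Fin n) ℂ →ₗ[ℂ] SmoothFun n (Euc n)}
    (hτ : ∀ W, τ W ∈ symbolZero n) (r : ℕ) {u : SmoothFun n (Euc n)} (hu : u ∈ symbolZero n) :
    opPart id contMDiff_id r τ u ∈ symbolZero n := by
  induction r generalizing τ u with
  | zero =>
    rw [opPart_zero]
    exact mul_mem (hτ 1) hu
  | succ r ih =>
    rw [opPart_succ]
    refine sum_mem fun l _ => ih (fun W => ?_) (pd_mem_symbolZero hu l)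
    exact sub_mem (hτ _) (mul_mem (coord_mem_symbolZero l) (hτ W))

theorem operator_mem_symbolZero {D : SmoothFun n (Euc n) →ₗ[ℂ] SmoothFun n (Euc n)} {k : ℕ}
    (hD : ∀ y u, VanishBelow k y u → (D u : Euc n → ℂ) y = 0)
    (hpoly : ∀ W, D (evalFun W) ∈ symbolZero n) {u : SmoothFun n (Euc n)}
    (hu : u ∈ symbolZero n) : D u ∈ symbolZero n := by
  rw [eq_sum_opPart hD u]
  exact sum_mem fun r _ => (symbolZero n).smul_mem (opPart_mem_symbolZero (fun W => hpoly W) r hu) _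

/-- On polynomials the product is polynomial, so each cochain maps pairs of polynomials into 𝒜⁰. Its
description through values on polynomials extends this to 𝒜⁰, in one argument after the other. -/
theorem star_mem_formalSymbolZero {gutt : Deformation n (Euc n)}
    (hgutt : ∀ P Q, ∃ W, gutt.star (polyFun P) (polyFun Q) = polyFun W)
    {f g : FormalFun n (Euc n)} (hf : f ∈ formalSymbolZero n) (hg : g ∈ formalSymbolZero n) :
    gutt.star f g ∈ formalSymbolZero n := by
  obtain ⟨κ, hκ⟩ := gutt.exists_order
  have h1 : ∀ j P Q, gutt.C j (evalFun P) (evalFun Q) ∈ symbolZero n := by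
    intro j P Q
    obtain ⟨W, hW⟩ := hgutt (MvPolynomial.map PowerSeries.C P) (MvPolynomial.map PowerSeries.C Q)
    have h := polyFun_mem_formalSymbolZero W j
    -- For factors free of λ, order `j` of the product contains only the cochain of index `j`,
    -- scaled by (1/2)^j.
    rw [← hW, coeff_star, polyFun_map_C, polyFun_map_C, Finset.sum_eq_single (j, 0)] at h
    · have h2 := (symbolZero n).smul_mem h ((2 : ℂ) ^ j)
      have h3 : (2 : ℂ) ^ j * (1 / 2) ^ j = 1 := by rw [← mul_pow]; norm_num
      simpa [smul_smul, h3] using h2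
    · rintro ⟨a, b⟩ hab hne
      rw [Finset.HasAntidiagonal.mem_antidiagonal] at hab
      have hb : b ≠ 0 := by
        rintro rfl
        exact hne (by simpa using hab)
      refine Finset.sum_eq_zero fun q hq => ?_
      rw [Finset.HasAntidiagonal.mem_antidiagonal] at hq
      by_cases hq1 : q.1 = 0
      · have hq2 : q.2 ≠ 0 := by
          intro h0
          exact hb (by change q.1 + q.2 = b at hq; omega)
        simp [PowerSeries.coeff_C, hq2]
      · simp [PowerSeries.coeff_C, hq1]
    · intro h; simp at h
  have h2 : ∀ j P v, v ∈ symbolZero n → gutt.C j (evalFun P) v ∈ symbolZero n :=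
    fun j P v hv => operator_mem_symbolZero (D := gutt.C j (evalFun P))
      (fun y v hv => hκ j y _ v (Or.inr hv)) (h1 j P) hv
  have h3 : ∀ j u v, u ∈ symbolZero n → v ∈ symbolZero n → gutt.C j u v ∈ symbolZero n :=
    fun j u v hu hv => operator_mem_symbolZero (D := (gutt.C j).flip v)
      (fun y u hu => hκ j y u v (Or.inl hu)) (fun W => h2 j W v hv) hu
  intro m
  rw [coeff_star]
  exact sum_mem fun p _ => sum_mem fun q _ => (symbolZero n).smul_mem (h3 _ _ _ (hf _) (hg _)) _

end SymbolClassZero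

/-! ### Amplitudes in 𝒜. -/

section SymbolClass

variable {n : ℕ}

theorem InSymbolClass.add {a b : Euc n × Euc n → ℂ} (ha : InSymbolClass a)
    (hb : InSymbolClass b) : InSymbolClass (a + b) := by
  obtain ⟨ha, m, σ, hσ, ha'⟩ := ha
  obtain ⟨hb, m', τ, hτ, hb'⟩ := hb
  refine ⟨ha.add hb, max m m', max σ τ, le_max_of_le_left hσ, fun k => ?_⟩
  obtain ⟨A, hA⟩ := ha' k
  obtain ⟨B, hB⟩ := hb' k
  refine ⟨|A| + |B|, fun z => ?_⟩
  rw [iteratedFDeriv_add_apply (ha.contDiffAt.of_le (by exact_mod_cast le_top))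
    (hb.contDiffAt.of_le (by exact_mod_cast le_top)), add_mul, add_mul]
  refine (norm_add_le _ _).trans (add_le_add ((hA z).trans ?_) ((hB z).trans ?_))
  · refine mul_le_mul (mul_le_mul (le_abs_self A) (japanese_rpow_mono _ (le_max_left _ _))
      (japanese_rpow_pos _ _).le (abs_nonneg A)) (japanese_rpow_mono _ (le_max_left _ _))
      (japanese_rpow_pos _ _).le (mul_nonneg (abs_nonneg A) (japanese_rpow_pos _ _).le)
  · refine mul_le_mul (mul_le_mul (le_abs_self B) (japanese_rpow_mono _ (le_max_right _ _))
      (japanese_rpow_pos _ _).le (abs_nonneg B)) (japanese_rpow_mono _ (le_max_right _ _))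
      (japanese_rpow_pos _ _).le (mul_nonneg (abs_nonneg B) (japanese_rpow_pos _ _).le)

theorem InSymbolClass.const_smul {a : Euc n × Euc n → ℂ} (ha : InSymbolClass a) (c : ℂ) :
    InSymbolClass (c • a) := by
  obtain ⟨ha, m, σ, hσ, ha'⟩ := ha
  refine ⟨contDiff_const.smul ha, m, σ, hσ, fun k => ?_⟩
  obtain ⟨A, hA⟩ := ha' k
  refine ⟨‖c‖ * A, fun z => ?_⟩
  rw [iteratedFDeriv_const_smul_apply (ha.contDiffAt.of_le (by exact_mod_cast le_top)), norm_smul,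
    mul_assoc, mul_assoc, ← mul_assoc A]
  exact mul_le_mul_of_nonneg_left (hA z) (norm_nonneg c)

/-- The amplitude `f(ξ) u(x)`. -/
def tensorFun (f u : SmoothFun n (Euc n)) (z : Euc n × Euc n) : ℂ :=
  (f : Euc n → ℂ) z.1 * (u : Euc n → ℂ) z.2

theorem norm_iteratedFDeriv_comp_le {E F : Type*} [NormedAddCommGroup E] [NormedSpace ℝ E]
    [NormedAddCommGroup F] [NormedSpace ℝ F] {g : F → ℂ} (hg : ContDiff ℝ ∞ g) (L : E →L[ℝ] F)
    (hL : ‖L‖ ≤ 1) (k : ℕ) (z : E) :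
    ‖iteratedFDeriv ℝ k (g ∘ L) z‖ ≤ ‖iteratedFDeriv ℝ k g (L z)‖ := by
  rw [L.iteratedFDeriv_comp_right hg z (by exact_mod_cast le_top)]
  refine (ContinuousMultilinearMap.norm_compContinuousLinearMap_le _ _).trans ?_
  rw [Finset.prod_const]
  exact mul_le_of_le_one_right (norm_nonneg _) (pow_le_one₀ (norm_nonneg _) hL)

theorem InSymbolClassZero.inSymbolClass_mul {f u : Euc n → ℂ} (hf : InSymbolClassZero f)
    (hu : InSymbolClassZero u) : InSymbolClass fun z => f z.1 * u z.2 := by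
  obtain ⟨hf, m, _, hf'⟩ := hf
  obtain ⟨hu, σ, hσ, hu'⟩ := hu
  choose A hA using hf'
  choose B hB using hu'
  have hn1 := ContinuousLinearMap.norm_fst_le ℝ (Euc n) (Euc n)
  have hn2 := ContinuousLinearMap.norm_snd_le ℝ (Euc n) (Euc n)
  obtain ⟨F, hF⟩ : ∃ F : Euc n × Euc n → ℂ, F = f ∘ ContinuousLinearMap.fst ℝ (Euc n) (Euc n) :=
    ⟨_, rfl⟩
  obtain ⟨U, hU⟩ : ∃ U : Euc n × Euc n → ℂ, U = u ∘ ContinuousLinearMap.snd ℝ (Euc n) (Euc n) :=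
    ⟨_, rfl⟩
  have hf1 : ContDiff ℝ ∞ F := hF ▸ hf.comp (ContinuousLinearMap.contDiff _)
  have hu1 : ContDiff ℝ ∞ U := hU ▸ hu.comp (ContinuousLinearMap.contDiff _)
  have h1 (i : ℕ) (z : Euc n × Euc n) :
      ‖iteratedFDeriv ℝ i F z‖ ≤ |A i| * japanese z.1 ^ m := by
    rw [hF]
    refine (norm_iteratedFDeriv_comp_le hf _ hn1 i z).trans ?_
    refine (hA i z.1).trans ?_
    exact mul_le_mul_of_nonneg_right (le_abs_self _) (japanese_rpow_pos _ _).le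
  have h2 (i : ℕ) (z : Euc n × Euc n) :
      ‖iteratedFDeriv ℝ i U z‖ ≤ |B i| * japanese z.2 ^ σ := by
    rw [hU]
    refine (norm_iteratedFDeriv_comp_le hu _ hn2 i z).trans ?_
    refine (hB i z.2).trans ?_
    exact mul_le_mul_of_nonneg_right (le_abs_self _) (japanese_rpow_pos _ _).le
  have he : (fun z : Euc n × Euc n => f z.1 * u z.2) = fun z => F z * U z := by
    rw [hF, hU]; rfl
  rw [he]
  refine ⟨hf1.mul hu1, m, σ, hσ, fun k => ?_⟩
  refine ⟨∑ i ∈ Finset.range (k + 1), (k.choose i : ℝ) * |A i| * |B (k - i)|, fun z => ?_⟩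
  refine (norm_iteratedFDeriv_mul_le hf1 hu1 z (n := k) (by exact_mod_cast le_top)).trans ?_
  rw [Finset.sum_mul, Finset.sum_mul]
  refine Finset.sum_le_sum fun i _ => ?_
  have h3 := mul_le_mul (h1 i z) (h2 (k - i) z) (norm_nonneg _)
    (mul_nonneg (abs_nonneg _) (japanese_rpow_pos _ _).le)
  rw [mul_assoc]
  refine (mul_le_mul_of_nonneg_left h3 (Nat.cast_nonneg _)).trans (le_of_eq ?_)
  ring

theorem inSymbolClass_tensorFun {f u : SmoothFun n (Euc n)} (hf : f ∈ symbolZero n)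
    (hu : u ∈ symbolZero n) : InSymbolClass (tensorFun f u) :=
  InSymbolClassZero.inSymbolClass_mul hf hu

theorem japanese_rpow_le (x : Euc n) (s : ℝ) : japanese x ^ s ≤ (1 + ‖x‖) ^ ⌈|s|⌉₊ := by
  refine (japanese_rpow_mono x ((le_abs_self s).trans (Nat.le_ceil _))).trans ?_
  rw [Real.rpow_natCast]
  exact pow_le_pow_left₀ (zero_le_one.trans (one_le_japanese x)) (japanese_le x) _

theorem InSymbolClass.exists_growth {a : Euc n × Euc n → ℂ} (ha : InSymbolClass a) :
    ∃ (C : ℝ) (N : ℕ), 0 ≤ C ∧ ∀ z, ‖a z‖ ≤ C * (1 + ‖z‖) ^ N := by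
  obtain ⟨_, m, σ, _, h⟩ := ha
  obtain ⟨A, hA⟩ := h 0
  refine ⟨|A|, ⌈|m|⌉₊ + ⌈|σ|⌉₊, abs_nonneg A, fun z => ?_⟩
  have h0 := hA z
  rw [norm_iteratedFDeriv_zero] at h0
  refine h0.trans ?_
  rw [pow_add, ← mul_assoc]
  have h1 : japanese z.1 ^ m ≤ (1 + ‖z‖) ^ ⌈|m|⌉₊ := (japanese_rpow_le _ _).trans
    (pow_le_pow_left₀ (by positivity) (by gcongr; exact norm_fst_le z) _)
  have h2 : japanese z.2 ^ σ ≤ (1 + ‖z‖) ^ ⌈|σ|⌉₊ := (japanese_rpow_le _ _).trans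
    (pow_le_pow_left₀ (by positivity) (by gcongr; exact norm_snd_le z) _)
  exact mul_le_mul (mul_le_mul (le_abs_self A) h1 (japanese_rpow_pos _ _).le (abs_nonneg A)) h2
    (japanese_rpow_pos _ _).le (by positivity)

end SymbolClass

/-! ### Oscillatory integrals and integration by parts. -/

section OscIntegral

variable {n : ℕ}

instance : (volume : Measure (Euc n × Euc n)).IsAddHaarMeasure :=
  inferInstanceAs ((volume : Measure (Euc n)).prod (volume : Measure (Euc n))).IsAddHaarMeasure

/-- The factor `e^{-iξx}`. -/
def oscPhase (z : Euc n × Euc n) : ℂ :=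
  Complex.exp (-Complex.I * ((∑ l, z.1 l * z.2 l : ℝ) : ℂ))

theorem norm_oscPhase (z : Euc n × Euc n) : ‖oscPhase z‖ = 1 := by
  rw [oscPhase, Complex.norm_exp]
  simp

theorem continuous_oscPhase : Continuous (oscPhase (n := n)) := by
  unfold oscPhase
  fun_prop

/-- The dilation `z ↦ χ(ε z)` of a Schwartz function. -/
def dilate (ε : ℝ) (hε : ε ≠ 0) (χ : 𝓢(Euc n × Euc n, ℂ)) : 𝓢(Euc n × Euc n, ℂ) :=
  SchwartzMap.compCLMOfContinuousLinearEquiv ℝ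
    (ContinuousLinearEquiv.smulLeft (R₁ := ℝ) (M₁ := Euc n × Euc n) (Units.mk0 ε hε)) χ

theorem dilate_apply (ε : ℝ) (hε : ε ≠ 0) (χ : 𝓢(Euc n × Euc n, ℂ)) (z : Euc n × Euc n) :
    dilate ε hε χ z = χ (ε • z) := rfl

theorem integrable_schwartz_mul (ψ : 𝓢(Euc n × Euc n, ℂ)) {a : Euc n × Euc n → ℂ}
    (ha : InSymbolClass a) : Integrable fun z => ψ z * oscPhase z * a z := by
  obtain ⟨C, N, hC, hb⟩ := ha.exists_growth
  have h1 := ψ.integrable_pow_mul (volume : Measure (Euc n × Euc n)) 0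
  have h2 := ψ.integrable_pow_mul (volume : Measure (Euc n × Euc n)) N
  have h3 := (h1.add h2).const_mul (C * 2 ^ (N - 1))
  refine h3.mono' ?_ (Eventually.of_forall fun z => ?_)
  · exact ((ψ.continuous.mul continuous_oscPhase).mul ha.1.continuous).aestronglyMeasurable
  · rw [norm_mul, norm_mul, norm_oscPhase, mul_one]
    have h4 : (1 + ‖z‖) ^ N ≤ 2 ^ (N - 1) * (1 ^ N + ‖z‖ ^ N) :=
      add_pow_le zero_le_one (norm_nonneg z) N
    have h5 : ‖a z‖ ≤ C * (2 ^ (N - 1) * (1 ^ N + ‖z‖ ^ N)) :=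
      (hb z).trans (mul_le_mul_of_nonneg_left h4 hC)
    refine (mul_le_mul_of_nonneg_left h5 (norm_nonneg _)).trans (le_of_eq ?_)
    simp only [Pi.add_apply, pow_zero, one_pow]
    ring

/-- The regularized oscillatory integral. -/
def regInt (χ : 𝓢(Euc n × Euc n, ℂ)) (a : Euc n × Euc n → ℂ) (ε : ℝ) : ℂ :=
  (((2 * Real.pi) ^ n : ℝ) : ℂ)⁻¹ * ∫ z : Euc n × Euc n, χ (ε • z) * oscPhase z * a z

/-- A strengthening of `HasOscIntegral` to cutoff functions with arbitrary value at the origin. -/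
def HasStrongOscIntegral (a : Euc n × Euc n → ℂ) (c : ℂ) : Prop :=
  InSymbolClass a ∧ ∀ χ : 𝓢(Euc n × Euc n, ℂ),
    Tendsto (regInt χ a) (𝓝[>] 0) (𝓝 (χ 0 * c))

theorem HasStrongOscIntegral.hasOscIntegral {a : Euc n × Euc n → ℂ} {c : ℂ}
    (h : HasStrongOscIntegral a c) : HasOscIntegral a c := by
  refine ⟨h.1, fun χ hχ => ?_⟩
  have := h.2 χ
  rw [hχ, one_mul] at this
  exact this

theorem HasStrongOscIntegral.add {a b : Euc n × Euc n → ℂ} {c c' : ℂ}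
    (ha : HasStrongOscIntegral a c) (hb : HasStrongOscIntegral b c') :
    HasStrongOscIntegral (a + b) (c + c') := by
  refine ⟨ha.1.add hb.1, fun χ => ?_⟩
  rw [mul_add]
  refine ((ha.2 χ).add (hb.2 χ)).congr' ?_
  filter_upwards [self_mem_nhdsWithin] with ε (hε : 0 < ε)
  have h1 := integrable_schwartz_mul (dilate ε hε.ne' χ) ha.1
  have h2 := integrable_schwartz_mul (dilate ε hε.ne' χ) hb.1
  simp only [dilate_apply] at h1 h2
  rw [regInt, regInt, regInt, ← mul_add, ← integral_add h1 h2]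
  simp only [Pi.add_apply, mul_add]

theorem HasStrongOscIntegral.const_smul {a : Euc n × Euc n → ℂ} {c : ℂ}
    (ha : HasStrongOscIntegral a c) (s : ℂ) : HasStrongOscIntegral (s • a) (s * c) := by
  refine ⟨ha.1.const_smul s, fun χ => ?_⟩
  rw [mul_left_comm]
  refine ((ha.2 χ).const_mul s).congr fun ε => ?_
  rw [regInt, regInt, mul_left_comm, ← integral_const_mul]
  congr 2
  funext z
  simp only [Pi.smul_apply, smul_eq_mul]
  ring

theorem hasStrongOscIntegral_zero : HasStrongOscIntegral (0 : Euc n × Euc n → ℂ) 0 := by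
  refine ⟨⟨contDiff_const, 0, 0, le_rfl, fun k => ⟨0, fun z => ?_⟩⟩, fun χ => ?_⟩
  · rw [iteratedFDeriv_zero]; simp
  · have : regInt χ (0 : Euc n × Euc n → ℂ) = fun _ => 0 := by
      funext ε; simp [regInt]
    rw [this, mul_zero]
    exact tendsto_const_nhds

theorem HasStrongOscIntegral.sum {ι : Type*} {s : Finset ι} {a : ι → Euc n × Euc n → ℂ}
    {c : ι → ℂ} (h : ∀ i ∈ s, HasStrongOscIntegral (a i) (c i)) :
    HasStrongOscIntegral (∑ i ∈ s, a i) (∑ i ∈ s, c i) := by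
  classical
  induction s using Finset.induction_on with
  | empty => simpa using hasStrongOscIntegral_zero
  | insert i s hi ih =>
    rw [Finset.sum_insert hi, Finset.sum_insert hi]
    exact (h i (by simp)).add (ih fun j hj => h j (by simp [hj]))

theorem hasLineDerivAt_oscPhase (l : Fin n) (z : Euc n × Euc n) :
    HasLineDerivAt ℝ oscPhase (oscPhase z * (-Complex.I * ((z.1 l : ℝ) : ℂ))) z (0, eVec l) := by
  have h1 : ∀ t : ℝ, oscPhase (z + t • ((0 : Euc n), eVec l)) =
      Complex.exp (-Complex.I * ((∑ k, z.1 k * z.2 k : ℝ) : ℂ) +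
        -Complex.I * ((z.1 l : ℝ) : ℂ) * (t : ℂ)) := by
    intro t
    rw [oscPhase]
    congr 1
    have : ∑ k, (z + t • ((0 : Euc n), eVec l)).1 k * (z + t • ((0 : Euc n), eVec l)).2 k =
        ∑ k, z.1 k * z.2 k + z.1 l * t := by
      simp [mul_add, Finset.sum_add_distrib]
    rw [this]
    push_cast
    ring
  have h2 : HasDerivAt (fun t : ℝ => -Complex.I * ((∑ k, z.1 k * z.2 k : ℝ) : ℂ) +
      -Complex.I * ((z.1 l : ℝ) : ℂ) * (t : ℂ)) (-Complex.I * ((z.1 l : ℝ) : ℂ)) 0 := by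
    have := ((Complex.ofRealCLM.hasDerivAt (x := (0 : ℝ))).const_mul
      (-Complex.I * ((z.1 l : ℝ) : ℂ))).const_add (-Complex.I * ((∑ k, z.1 k * z.2 k : ℝ) : ℂ))
    simpa using this
  have h3 := h2.cexp
  unfold HasLineDerivAt
  rw [show (fun t : ℝ => oscPhase (z + t • ((0 : Euc n), eVec l))) = _ from funext h1]
  simpa [oscPhase] using h3

theorem hasLineDerivAt_tensorFun (f u : SmoothFun n (Euc n)) (l : Fin n) (z : Euc n × Euc n) :
    HasLineDerivAt ℝ (tensorFun f u) (tensorFun f (pd l u) z) z (0, eVec l) := by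
  have h1 : HasFDerivAt (u : Euc n → ℂ) (fderiv ℝ (u : Euc n → ℂ) z.2) z.2 :=
    ((contDiff_coe u).differentiable (by simp) z.2).hasFDerivAt
  have h2 : HasDerivAt (fun t : ℝ => (u : Euc n → ℂ) (z.2 + t • eVec l))
      ((pd l u : Euc n → ℂ) z.2) 0 := h1.hasLineDerivAt (eVec l)
  have h3 := h2.const_mul ((f : Euc n → ℂ) z.1)
  have e : (fun t : ℝ => tensorFun f u (z + t • ((0 : Euc n), eVec l))) =
      fun t : ℝ => (f : Euc n → ℂ) z.1 * (u : Euc n → ℂ) (z.2 + t • eVec l) := by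
    funext t
    simp [tensorFun]
  unfold HasLineDerivAt
  rw [e]
  exact h3

/-- Integration by parts in x_l: the factor iξ_l is, up to sign, produced by differentiating the
phase. The derivative then falls on `u`, giving `pd l u`, or on the cutoff, giving a factor ε times
an integral with cutoff χ'. That integral must converge although χ'(0) is arbitrary, which is why
cutoffs are not normalized in `HasStrongOscIntegral`. -/
theorem HasStrongOscIntegral.coord_mul {f u : SmoothFun n (Euc n)} {c c' : ℂ} (l : Fin n)
    (hf : f ∈ symbolZero n) (hu : u ∈ symbolZero n)
    (h : HasStrongOscIntegral (tensorFun f u) c)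
    (h' : HasStrongOscIntegral (tensorFun f (pd l u)) c') :
    HasStrongOscIntegral (tensorFun (Complex.I • (coord l * f)) u) c' := by
  have hcls : InSymbolClass (tensorFun (Complex.I • (coord l * f)) u) :=
    inSymbolClass_tensorFun ((symbolZero n).smul_mem (mul_mem (coord_mem_symbolZero l) hf) _) hu
  refine ⟨hcls, fun χ => ?_⟩
  set v : Euc n × Euc n := (0, eVec l) with hv
  set χ' : 𝓢(Euc n × Euc n, ℂ) := LineDeriv.lineDerivOp v χ with hχ'
  have hε : Tendsto (fun ε : ℝ => (ε : ℂ)) (𝓝[>] 0) (𝓝 0) := by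
    have : Tendsto (fun ε : ℝ => (ε : ℂ)) (𝓝 0) (𝓝 ((0 : ℝ) : ℂ)) :=
      Complex.continuous_ofReal.tendsto 0
    rw [Complex.ofReal_zero] at this
    exact this.mono_left nhdsWithin_le_nhds
  have hlim := (hε.mul (h.2 χ')).add (h'.2 χ)
  rw [zero_mul, zero_add] at hlim
  refine hlim.congr' ?_
  filter_upwards [self_mem_nhdsWithin] with ε (hε : 0 < ε)
  have i1 := integrable_schwartz_mul (dilate ε hε.ne' χ') h.1
  have i2 := integrable_schwartz_mul (dilate ε hε.ne' χ) h'.1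
  have i3 := integrable_schwartz_mul (dilate ε hε.ne' χ) h.1
  have i4 := integrable_schwartz_mul (dilate ε hε.ne' χ) hcls
  simp only [dilate_apply] at i1 i2 i3 i4
  have hF : ∀ z, HasLineDerivAt ℝ (fun z => χ (ε • z) * tensorFun f u z)
      ((ε : ℂ) * χ' (ε • z) * tensorFun f u z + χ (ε • z) * tensorFun f (pd l u) z) z v := by
    intro z
    have h1 : HasDerivAt (fun t : ℝ => χ (ε • (z + t • v))) ((ε : ℂ) * χ' (ε • z)) 0 := by
      have h2 : HasFDerivAt χ (fderiv ℝ χ (ε • z)) (ε • z) := (χ.differentiableAt).hasFDerivAt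
      have h3 := h2.hasLineDerivAt (ε • v)
      unfold HasLineDerivAt at h3
      rw [map_smul, ← SchwartzMap.lineDerivOp_apply_eq_fderiv] at h3
      have e : (fun t : ℝ => χ (ε • (z + t • v))) = fun t : ℝ => χ (ε • z + t • ε • v) := by
        funext t
        rw [smul_add, smul_comm]
      rw [e, ← Complex.real_smul]
      exact h3
    have h5 : HasDerivAt (fun t : ℝ => tensorFun f u (z + t • v)) (tensorFun f (pd l u) z) 0 :=
      hasLineDerivAt_tensorFun f u l z
    have h4 := h1.fun_mul h5
    simpa [HasLineDerivAt] using h4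
  have key := integral_bilinear_hasLineDerivAt_right_eq_neg_left_of_integrable
    (μ := (volume : Measure (Euc n × Euc n))) (B := ContinuousLinearMap.mul ℝ ℂ)
    (f := fun z => χ (ε • z) * tensorFun f u z) (g := oscPhase) (v := v)
    (f' := fun z => (ε : ℂ) * χ' (ε • z) * tensorFun f u z + χ (ε • z) * tensorFun f (pd l u) z)
    (g' := fun z => oscPhase z * (-Complex.I * ((z.1 l : ℝ) : ℂ)))
    ?_ ?_ ?_ (fun z _ => hF z) (fun z _ => hasLineDerivAt_oscPhase l z)
  · have e1 : ∫ z, (ContinuousLinearMap.mul ℝ ℂ) (χ (ε • z) * tensorFun f u z)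
        (oscPhase z * (-Complex.I * ((z.1 l : ℝ) : ℂ))) =
        -∫ z, χ (ε • z) * oscPhase z * tensorFun (Complex.I • (coord l * f)) u z := by
      rw [← integral_neg]
      congr 1
      funext z
      change _ = -(_ * _ * (Complex.I * (((z.1 l : ℝ) : ℂ) * (f : Euc n → ℂ) z.1) *
        (u : Euc n → ℂ) z.2))
      simp only [ContinuousLinearMap.mul_apply', tensorFun]
      ring
    have e2 : ∫ z, (ContinuousLinearMap.mul ℝ ℂ) ((ε : ℂ) * χ' (ε • z) * tensorFun f u z +
        χ (ε • z) * tensorFun f (pd l u) z) (oscPhase z) =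
        ε * (∫ z, χ' (ε • z) * oscPhase z * tensorFun f u z) +
          ∫ z, χ (ε • z) * oscPhase z * tensorFun f (pd l u) z := by
      rw [← integral_const_mul, ← integral_add (i1.const_mul _) i2]
      congr 1
      funext z
      simp only [ContinuousLinearMap.mul_apply']
      ring
    rw [e1, e2] at key
    simp only [regInt]
    rw [neg_inj.1 key]
    ring
  · refine ((i1.const_mul (ε : ℂ)).add i2).congr (Eventually.of_forall fun z => ?_)
    simp only [ContinuousLinearMap.mul_apply', Pi.add_apply]
    ring
  · refine i4.neg.congr (Eventually.of_forall fun z => ?_)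
    change -(_ * _ * (Complex.I * (((z.1 l : ℝ) : ℂ) * (f : Euc n → ℂ) z.1) *
        (u : Euc n → ℂ) z.2)) = _
    simp only [ContinuousLinearMap.mul_apply', tensorFun]
    ring
  · refine i3.congr (Eventually.of_forall fun z => ?_)
    simp only [ContinuousLinearMap.mul_apply']
    ring

end OscIntegral

/-! ### Partial Fourier transform of the cutoff, uniformly in the frozen variable. -/

section Slice

variable {n : ℕ}

theorem slice_decay (χ : 𝓢(Euc n × Euc n, ℂ)) (w : Euc n) (k p : ℕ) (v : Euc n) :
    ‖v‖ ^ k * ‖iteratedFDeriv ℝ p (fun v => χ (v, w)) v‖ ≤ SchwartzMap.seminorm ℝ k p χ := by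
  have hn := ContinuousLinearMap.norm_inl_le_one ℝ (Euc n) (Euc n)
  have hg : ContDiff ℝ ∞ fun z : Euc n × Euc n => χ (z + (0, w)) :=
    (χ.smooth ⊤).comp (contDiff_id.add contDiff_const)
  have h1 := norm_iteratedFDeriv_comp_le hg (ContinuousLinearMap.inl ℝ (Euc n) (Euc n)) hn p v
  rw [iteratedFDeriv_comp_add_right] at h1
  have e1 : (fun z : Euc n × Euc n => χ (z + (0, w))) ∘
      (ContinuousLinearMap.inl ℝ (Euc n) (Euc n)) = fun v => χ (v, w) := by
    funext v
    simp
  have e2 : ContinuousLinearMap.inl ℝ (Euc n) (Euc n) v + (0, w) = (v, w) := by simp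
  rw [e1, e2] at h1
  refine le_trans ?_ (SchwartzMap.le_seminorm ℝ k p χ (v, w))
  refine mul_le_mul ?_ h1 (norm_nonneg _) (by positivity)
  exact pow_le_pow_left₀ (norm_nonneg _) (norm_fst_le (v, w)) _

/-- The Schwartz function `v ↦ χ(v, w)`. -/
def slice (χ : 𝓢(Euc n × Euc n, ℂ)) (w : Euc n) : 𝓢(Euc n, ℂ) where
  toFun v := χ (v, w)
  smooth' := (χ.smooth ⊤).comp (contDiff_id.prodMk contDiff_const)
  decay' k p := ⟨_, slice_decay χ w k p⟩

theorem slice_apply (χ : 𝓢(Euc n × Euc n, ℂ)) (w v : Euc n) : slice χ w v = χ (v, w) := rfl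

theorem seminorm_slice_le (χ : 𝓢(Euc n × Euc n, ℂ)) (w : Euc n) (k p : ℕ) :
    SchwartzMap.seminorm ℝ k p (slice χ w) ≤ SchwartzMap.seminorm ℝ k p χ :=
  SchwartzMap.seminorm_le_bound ℝ k p _ (apply_nonneg _ _) (slice_decay χ w k p)

theorem exists_forall_seminorm_slice_le (χ : 𝓢(Euc n × Euc n, ℂ))
    (q : Seminorm ℝ 𝓢(Euc n, ℂ)) (hq : Continuous q) : ∃ C, ∀ w, q (slice χ w) ≤ C := by
  obtain ⟨s, C, -, h⟩ := Seminorm.bound_of_continuous (schwartz_withSeminorms ℝ (Euc n) ℂ) q hq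
  refine ⟨C * ∑ i ∈ s, SchwartzMap.seminorm ℝ i.1 i.2 χ, fun w => (h _).trans ?_⟩
  rw [smul_apply, NNReal.smul_def, smul_eq_mul]
  refine mul_le_mul_of_nonneg_left ?_ C.2
  refine Seminorm.finset_sup_apply_le (Finset.sum_nonneg fun i _ => apply_nonneg _ _) fun i hi => ?_
  exact (seminorm_slice_le χ w i.1 i.2).trans
    (Finset.single_le_sum (f := fun i : ℕ × ℕ => SchwartzMap.seminorm ℝ i.1 i.2 χ)
      (fun i _ => apply_nonneg _ _) hi)

/-- The partial Fourier transform in the first variable. -/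
def partialFourier (χ : 𝓢(Euc n × Euc n, ℂ)) (w t : Euc n) : ℂ :=
  FourierTransform.fourier (slice χ w) t

theorem partialFourier_eq (χ : 𝓢(Euc n × Euc n, ℂ)) (w t : Euc n) :
    partialFourier χ w t =
      ∫ v, Complex.exp (↑(-2 * Real.pi * inner ℝ v t) * Complex.I) * χ (v, w) := by
  rw [partialFourier, SchwartzMap.fourier_coe, Real.fourier_eq']
  rfl

/-- The Fourier transform is continuous on Schwartz space and the seminorms of the slices are
bounded uniformly in `w`; the resulting bound supplies the dominating function in the limit ε → 0.
-/
theorem exists_partialFourier_le (χ : 𝓢(Euc n × Euc n, ℂ)) (N : ℕ) :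
    ∃ C, ∀ w t, (1 + ‖t‖) ^ N * ‖partialFourier χ w t‖ ≤ C := by
  have hq (k : ℕ) : ∃ C, ∀ w, SchwartzMap.seminorm ℝ k 0
      (FourierTransform.fourier (slice χ w)) ≤ C := by
    refine exists_forall_seminorm_slice_le χ ((SchwartzMap.seminorm ℝ k 0).comp
      (FourierTransform.fourierCLM ℝ 𝓢(Euc n, ℂ)).toLinearMap) ?_
    exact ((schwartz_withSeminorms ℝ (Euc n) ℂ).continuous_seminorm (k, 0)).comp
      (FourierTransform.fourierCLM ℝ 𝓢(Euc n, ℂ)).continuous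
  obtain ⟨A, hA⟩ := hq 0
  obtain ⟨B, hB⟩ := hq N
  refine ⟨2 ^ (N - 1) * (A + B), fun w t => ?_⟩
  have h0 := (SchwartzMap.le_seminorm ℝ 0 0 (FourierTransform.fourier (slice χ w)) t).trans (hA w)
  have hN := (SchwartzMap.le_seminorm ℝ N 0 (FourierTransform.fourier (slice χ w)) t).trans (hB w)
  rw [norm_iteratedFDeriv_zero] at h0 hN
  have h4 : (1 + ‖t‖) ^ N ≤ 2 ^ (N - 1) * (1 ^ N + ‖t‖ ^ N) :=
    add_pow_le zero_le_one (norm_nonneg t) N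
  refine (mul_le_mul_of_nonneg_right h4 (norm_nonneg _)).trans ?_
  rw [mul_assoc]
  refine mul_le_mul_of_nonneg_left ?_ (by positivity)
  rw [one_pow, add_mul, one_mul]
  rw [pow_zero, one_mul] at h0
  exact add_le_add h0 hN

theorem integrable_one_add_norm_pow :
    Integrable fun v : Euc n => (1 + ‖v‖) ^ (-((n + 1 : ℕ) : ℝ)) :=
  integrable_one_add_norm (by rw [finrank_euclideanSpace_fin]; push_cast; linarith)

theorem le_mul_one_add_norm_pow {a C : ℝ} (v : Euc n) (h : (1 + ‖v‖) ^ (n + 1) * a ≤ C) :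
    a ≤ C * (1 + ‖v‖) ^ (-((n + 1 : ℕ) : ℝ)) := by
  have h1 : 0 < (1 + ‖v‖) ^ (n + 1) := by positivity
  rw [Real.rpow_neg (by positivity), Real.rpow_natCast, ← div_eq_mul_inv, le_div_iff₀ h1, mul_comm]
  exact h

theorem continuous_partialFourier (χ : 𝓢(Euc n × Euc n, ℂ)) :
    Continuous fun z : Euc n × Euc n => partialFourier χ z.1 z.2 := by
  simp only [partialFourier_eq]
  have hb (v w : Euc n) := SchwartzMap.one_add_le_sup_seminorm_apply (𝕜 := ℝ) (m := (n + 1, 0))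
    (k := n + 1) (n := 0) le_rfl le_rfl χ (v, w)
  set C : ℝ := 2 ^ (n + 1) *
    ((Finset.Iic (n + 1, 0)).sup fun m => SchwartzMap.seminorm ℝ m.1 m.2) χ
  refine continuous_of_dominated
    (bound := fun v : Euc n => C * (1 + ‖v‖) ^ (-((n + 1 : ℕ) : ℝ))) (fun z => ?_)
    (fun z => Eventually.of_forall fun v => ?_) (integrable_one_add_norm_pow.const_mul C)
    (Eventually.of_forall fun v => ?_)
  · refine Continuous.aestronglyMeasurable ?_
    have := χ.continuous
    fun_prop
  · refine le_mul_one_add_norm_pow v (le_trans ?_ (hb v z.1))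
    rw [norm_mul, Complex.norm_exp_ofReal_mul_I, one_mul, norm_iteratedFDeriv_zero]
    refine mul_le_mul_of_nonneg_right ?_ (norm_nonneg _)
    exact pow_le_pow_left₀ (by positivity) (by gcongr; exact norm_fst_le (v, z.1)) _
  · have := χ.continuous
    fun_prop

theorem integral_partialFourier (χ : 𝓢(Euc n × Euc n, ℂ)) (w : Euc n) :
    ∫ t, partialFourier χ w t = χ (0, w) := by
  have h1 : FourierTransformInv.fourierInv (FourierTransform.fourier (slice χ w)) = slice χ w :=
    FourierPair.fourierInv_fourier_eq _
  have h2 := congrArg (fun f : 𝓢(Euc n, ℂ) => f 0) h1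
  simp only [SchwartzMap.fourierInv_coe, Real.fourierInv_eq', slice_apply] at h2
  rw [← h2]
  simp [partialFourier]

end Slice

/-! ### Evaluation of the oscillatory integrals against exponentials. -/

section BaseCase

variable {n : ℕ}

/-- Inner integral over the first variable. -/
theorem integral_slice_mul_exp (χ : 𝓢(Euc n × Euc n, ℂ)) {ε : ℝ} (hε : 0 < ε) (y μ : Euc n) :
    ∫ ν : Euc n, χ (ε • (ν, μ)) * oscPhase (ν, μ) *
        Complex.exp (∑ k, Complex.I * ((ν k : ℝ) : ℂ) * ((y k : ℝ) : ℂ)) =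
      ((ε ^ n)⁻¹ : ℝ) • partialFourier χ (ε • μ) ((2 * Real.pi * ε)⁻¹ • (μ - y)) := by
  have h := Measure.integral_comp_smul (volume : Measure (Euc n)) (fun v : Euc n =>
    Complex.exp (↑(-2 * Real.pi * inner ℝ v ((2 * Real.pi * ε)⁻¹ • (μ - y))) * Complex.I) *
      χ (v, ε • μ)) ε
  rw [finrank_euclideanSpace_fin, abs_of_pos (by positivity), ← partialFourier_eq] at h
  rw [← h]
  congr 1
  funext ν
  have e : -2 * Real.pi * inner ℝ (ε • ν) ((2 * Real.pi * ε)⁻¹ • (μ - y)) =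
      ∑ k, (ν k * y k - ν k * μ k) := by
    rw [real_inner_smul_left, real_inner_smul_right, PiLp.inner_apply, Finset.sum_sub_distrib]
    simp only [PiLp.sub_apply, RCLike.inner_apply, conj_trivial, sub_mul, Finset.sum_sub_distrib]
    have := Real.pi_ne_zero
    field_simp
    simp only [mul_comm]
    ring
  rw [e, oscPhase, mul_assoc, ← Complex.exp_add, mul_comm]
  congr 2
  push_cast
  rw [Finset.sum_sub_distrib, sub_mul, Finset.sum_mul, mul_comm (-Complex.I)]
  simp only [Finset.sum_mul, mul_neg]
  rw [sub_eq_neg_add]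
  simp only [mul_comm, mul_left_comm]

theorem InSymbolClassZero.exists_growth {u : Euc n → ℂ} (hu : InSymbolClassZero u) :
    ∃ (C : ℝ) (N : ℕ), 0 ≤ C ∧ ∀ x, ‖u x‖ ≤ C * (1 + ‖x‖) ^ N := by
  obtain ⟨_, σ, _, h⟩ := hu
  obtain ⟨A, hA⟩ := h 0
  refine ⟨|A|, ⌈|σ|⌉₊, abs_nonneg A, fun x => ?_⟩
  have h0 := hA x
  rw [norm_iteratedFDeriv_zero] at h0
  exact h0.trans (mul_le_mul (le_abs_self A) (japanese_rpow_le _ _) (japanese_rpow_pos _ _).le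
    (abs_nonneg A))

/-- Substitute μ = y + 2πε t. The Jacobian (2πε)ⁿ cancels the prefactor (2π)⁻ⁿ and the ε⁻ⁿ of the
inner integral. -/
theorem regInt_expFun (χ : 𝓢(Euc n × Euc n, ℂ)) {ε : ℝ} (hε : 0 < ε) (y : Euc n)
    {u : SmoothFun n (Euc n)} (hu : u ∈ symbolZero n) :
    regInt χ (tensorFun (expFun fun k => Complex.I * ((y k : ℝ) : ℂ)) u) ε =
      ∫ t : Euc n, (u : Euc n → ℂ) (y + (2 * Real.pi * ε) • t) *
        partialFourier χ (ε • (y + (2 * Real.pi * ε) • t)) t := by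
  have hcls : InSymbolClass (tensorFun (expFun fun k => Complex.I * ((y k : ℝ) : ℂ)) u) :=
    inSymbolClass_tensorFun (expFun_mem_symbolZero fun k => by simp) hu
  have hint := integrable_schwartz_mul (dilate ε hε.ne' χ) hcls
  simp only [dilate_apply] at hint
  have hpi := Real.pi_pos
  set R : ℝ := 2 * Real.pi * ε with hR
  have hR0 : 0 < R := by positivity
  have h1 : ∀ μ : Euc n, ∫ ν : Euc n, χ (ε • (ν, μ)) * oscPhase (ν, μ) *
      tensorFun (expFun fun k => Complex.I * ((y k : ℝ) : ℂ)) u (ν, μ) =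
      ((ε ^ n)⁻¹ : ℝ) • ((u : Euc n → ℂ) (y + (μ - y)) *
        partialFourier χ (ε • (y + (μ - y))) (R⁻¹ • (μ - y))) := by
    intro μ
    rw [add_sub_cancel, mul_comm, ← smul_mul_assoc, ← integral_slice_mul_exp χ hε,
      ← integral_mul_const]
    congr 1
    funext ν
    rw [tensorFun, expFun_apply, ← mul_assoc]
    simp only [mul_right_comm]
  have h2 := integral_sub_right_eq_self (μ := (volume : Measure (Euc n))) (fun s : Euc n =>
    ((ε ^ n)⁻¹ : ℝ) • ((u : Euc n → ℂ) (y + s) * partialFourier χ (ε • (y + s)) (R⁻¹ • s))) y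
  have h3 := Measure.integral_comp_smul (volume : Measure (Euc n)) (fun s : Euc n =>
    ((ε ^ n)⁻¹ : ℝ) • ((u : Euc n → ℂ) (y + s) * partialFourier χ (ε • (y + s)) (R⁻¹ • s))) R
  simp only [inv_smul_smul₀ hR0.ne'] at h3
  rw [finrank_euclideanSpace_fin, abs_of_pos (by positivity), integral_smul] at h3
  have h4 : ∫ z : Euc n × Euc n, χ (ε • z) * oscPhase z *
      tensorFun (expFun fun k => Complex.I * ((y k : ℝ) : ℂ)) u z =
      ((R ^ n) * (ε ^ n)⁻¹ : ℝ) • ∫ t : Euc n, (u : Euc n → ℂ) (y + R • t) *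
        partialFourier χ (ε • (y + R • t)) t := by
    rw [mul_smul, h3, smul_inv_smul₀ (pow_pos hR0 n).ne', ← h2]
    simp only [← h1]
    exact integral_prod_symm _ hint
  rw [regInt, h4, Complex.real_smul, ← mul_assoc]
  convert one_mul _ using 2
  rw [hR, mul_pow _ ε, mul_inv_cancel_right₀ (pow_pos hε n).ne']
  exact inv_mul_cancel₀ (by exact_mod_cast (by positivity : (2 * Real.pi) ^ n ≠ 0))

/-- As ε → 0, `u` is evaluated at `y`, and the remaining integral of the partial Fourier transform
is χ(0) by Fourier inversion. -/
theorem hasStrongOscIntegral_expFun (y : Euc n) {u : SmoothFun n (Euc n)}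
    (hu : u ∈ symbolZero n) :
    HasStrongOscIntegral (tensorFun (expFun fun k => Complex.I * ((y k : ℝ) : ℂ)) u)
      ((u : Euc n → ℂ) y) := by
  refine ⟨inSymbolClass_tensorFun (expFun_mem_symbolZero fun k => by simp) hu, fun χ => ?_⟩
  obtain ⟨A, N, hA, hu'⟩ := InSymbolClassZero.exists_growth hu
  -- `N` powers absorb the growth of `u`, and `n + 1` more make the bound integrable on ℝⁿ.
  obtain ⟨B, hB⟩ := exists_partialFourier_le χ (N + (n + 1))
  have hcu : Continuous (u : Euc n → ℂ) := (contDiff_coe u).continuous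
  have hpf := continuous_partialFourier χ
  have hlim : Tendsto (fun ε : ℝ => ∫ t : Euc n, (u : Euc n → ℂ) (y + (2 * Real.pi * ε) • t) *
      partialFourier χ (ε • (y + (2 * Real.pi * ε) • t)) t) (𝓝[>] 0)
      (𝓝 (∫ t : Euc n, (u : Euc n → ℂ) y * partialFourier χ 0 t)) := by
    set D : ℝ := 1 + ‖y‖ + 2 * Real.pi with hD
    have hpi := Real.pi_pos
    refine tendsto_integral_filter_of_dominated_convergence
      (fun t => A * D ^ N * B * (1 + ‖t‖) ^ (-((n + 1 : ℕ) : ℝ)))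
      (Eventually.of_forall fun ε => ?_) ?_ (integrable_one_add_norm_pow.const_mul _)
      (Eventually.of_forall fun t => ?_)
    · refine Continuous.aestronglyMeasurable ?_
      exact (hcu.comp (by fun_prop)).mul (hpf.comp
        (f := fun t : Euc n => (ε • (y + (2 * Real.pi * ε) • t), t)) (by fun_prop))
    · have h1 : ∀ᶠ ε : ℝ in 𝓝[>] 0, ε < 1 := nhdsWithin_le_nhds (Iio_mem_nhds one_pos)
      filter_upwards [self_mem_nhdsWithin, h1] with ε (hε : 0 < ε) hε1
      refine Eventually.of_forall fun t => ?_
      refine le_mul_one_add_norm_pow t ?_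
      have h2 : 1 + ‖y + (2 * Real.pi * ε) • t‖ ≤ D * (1 + ‖t‖) := by
        have h3 : ‖(2 * Real.pi * ε) • t‖ ≤ 2 * Real.pi * ‖t‖ := by
          rw [norm_smul, Real.norm_of_nonneg (by positivity)]
          have : 2 * Real.pi * ε ≤ 2 * Real.pi := mul_le_of_le_one_right (by positivity) hε1.le
          exact mul_le_mul_of_nonneg_right this (norm_nonneg t)
        have h4 := norm_add_le y ((2 * Real.pi * ε) • t)
        have h5 : 0 ≤ ‖y‖ * ‖t‖ := by positivity
        have h6 := norm_nonneg t
        rw [hD]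
        nlinarith
      have h7 : ‖(u : Euc n → ℂ) (y + (2 * Real.pi * ε) • t)‖ ≤ A * (D * (1 + ‖t‖)) ^ N :=
        (hu' _).trans (mul_le_mul_of_nonneg_left (pow_le_pow_left₀ (by positivity) h2 _) hA)
      have h8 := hB (ε • (y + (2 * Real.pi * ε) • t)) t
      rw [norm_mul]
      calc _ ≤ (1 + ‖t‖) ^ (n + 1) * (A * (D * (1 + ‖t‖)) ^ N *
            ‖partialFourier χ (ε • (y + (2 * Real.pi * ε) • t)) t‖) := by gcongr
        _ = A * D ^ N * ((1 + ‖t‖) ^ (N + (n + 1)) *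
            ‖partialFourier χ (ε • (y + (2 * Real.pi * ε) • t)) t‖) := by
          rw [mul_pow, pow_add]; ring
        _ ≤ A * D ^ N * B := by gcongr
    · have hc : Continuous fun ε : ℝ => (u : Euc n → ℂ) (y + (2 * Real.pi * ε) • t) *
          partialFourier χ (ε • (y + (2 * Real.pi * ε) • t)) t :=
        (hcu.comp (by fun_prop)).mul (hpf.comp
          (f := fun ε : ℝ => (ε • (y + (2 * Real.pi * ε) • t), t)) (by fun_prop))
      have := hc.tendsto 0
      simp only [mul_zero, zero_smul, add_zero] at this
      exact this.mono_left nhdsWithin_le_nhds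
  rw [integral_const_mul, integral_partialFourier, ← Prod.zero_eq_mk] at hlim
  rw [mul_comm (χ 0)]
  refine hlim.congr' ?_
  filter_upwards [self_mem_nhdsWithin] with ε (hε : 0 < ε)
  rw [regInt_expFun χ hε y hu]

/-- The function `f` is a polynomial in ν times e^{iν·y}. Differentiating e^{iν·μ} in μ_l multiplies
it by iν_l, which the oscillatory integral converts into `pd l` on `u`; both sides thus satisfy the
same recursion in `r`. -/
theorem exists_symbol_taylorPart_expFun (y : Euc n) (r : ℕ)
    (L : MvPolynomial (Fin n) ℂ →ₗ[ℂ] ℂ) : ∃ f ∈ symbolZero n,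
      (∀ ν : Euc n, (f : Euc n → ℂ) ν =
        L (taylorPart y r (expFun fun k => Complex.I * ((ν k : ℝ) : ℂ)))) ∧
      ∀ u ∈ symbolZero n, HasStrongOscIntegral (tensorFun f u) (L (taylorPart y r u)) := by
  induction r generalizing L with
  | zero =>
    have hL (c : ℂ) : L (MvPolynomial.C c) = L 1 * c := by
      rw [← mul_one (MvPolynomial.C c), ← MvPolynomial.smul_eq_C_mul, map_smul, smul_eq_mul,
        mul_comm]
    refine ⟨L 1 • expFun fun k => Complex.I * ((y k : ℝ) : ℂ),
      (symbolZero n).smul_mem (expFun_mem_symbolZero fun k => by simp) _, fun ν => ?_,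
      fun u hu => ?_⟩
    · rw [taylorPart_zero, hL, expFun_apply]
      change L 1 * Complex.exp (∑ k, Complex.I * ((y k : ℝ) : ℂ) * ((ν k : ℝ) : ℂ)) = _
      simp only [mul_right_comm]
    · rw [taylorPart_zero, hL]
      convert (hasStrongOscIntegral_expFun y hu).const_smul (L 1) using 1
      funext z
      simp only [tensorFun, Pi.smul_apply, smul_eq_mul, ← mul_assoc]
      rfl
  | succ r ih =>
    choose f hf hval hosc using fun l => ih (L ∘ₗ LinearMap.mulLeft ℂ (shiftedX y l))
    refine ⟨∑ l, Complex.I • (coord l * f l), sum_mem fun l _ =>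
      (symbolZero n).smul_mem (mul_mem (coord_mem_symbolZero l) (hf l)) _, fun ν => ?_,
      fun u hu => ?_⟩
    · rw [taylorPart_succ, map_sum, ← evalAt_apply, map_sum]
      refine Finset.sum_congr rfl fun l _ => ?_
      rw [pd_expFun, map_smul (evalAt ν), map_smul (taylorPart y r), mul_smul_comm, map_smul L,
        smul_eq_mul, smul_eq_mul, evalAt_apply]
      change Complex.I * (((ν l : ℝ) : ℂ) * (f l : Euc n → ℂ) ν) = _
      rw [hval, mul_assoc]
      rfl
    · have h := HasStrongOscIntegral.sum (s := Finset.univ) fun l _ =>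
        (hosc l u hu).coord_mul l (hf l) hu (hosc l (pd l u) (pd_mem_symbolZero hu l))
      rw [taylorPart_succ, map_sum]
      convert h using 1
      swap
      · rfl
      funext z
      rw [Finset.sum_apply]
      simp only [tensorFun]
      rw [← Finset.sum_mul, ← evalAt_apply, map_sum]
      rfl

end BaseCase

/-! ### Counting words with prescribed letter multiplicities. -/

section WordCount

variable {n r : ℕ}

/-- The multiplicities of the letters of a word. -/
def wordCount (f : Fin r → Fin n) : Fin n →₀ ℕ := ∑ j, Finsupp.single (f j) 1

theorem wordCount_apply (f : Fin r → Fin n) (i : Fin n) :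
    wordCount f i = (Finset.univ.filter fun j => f j = i).card := by
  rw [wordCount, Finsupp.finsetSum_apply, Finset.card_filter]
  refine Finset.sum_congr rfl fun j _ => ?_
  rw [Finsupp.single_apply]

theorem wordCount_eq_iff {f : Fin r → Fin n} {m : Fin n →₀ ℕ} :
    wordCount f = m ↔ ∀ i, (Finset.univ.filter fun j => f j = i).card = m i := by
  simp only [DFunLike.ext_iff, wordCount_apply]

theorem sum_wordCount (f : Fin r → Fin n) : ∑ i, wordCount f i = r := by
  simp only [wordCount, Finsupp.finsetSum_apply]
  rw [Finset.sum_comm]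
  simp [Finsupp.single_apply]

theorem prod_X_eq_monomial {R : Type*} [CommSemiring R] (f : Fin r → Fin n) :
    ∏ j, (MvPolynomial.X (f j) : MvPolynomial (Fin n) R) =
      MvPolynomial.monomial (wordCount f) 1 := by
  rw [wordCount, MvPolynomial.monomial_sum_one]
  rfl

theorem prod_eq_of_wordCount_eq {R : Type*} [CommSemiring R] (p : Fin n → R)
    {f g : Fin r → Fin n} (h : wordCount f = wordCount g) : ∏ j, p (f j) = ∏ j, p (g j) := by
  have key (f : Fin r → Fin n) :
      ∏ j, p (f j) = MvPolynomial.eval p (MvPolynomial.monomial (wordCount f) 1) := by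
    rw [← prod_X_eq_monomial, map_prod]
    simp
  rw [key, key, h]

/-- Compare coefficients in two expansions of (∑ X_i)^r: over words, and by the multinomial theorem.
-/
theorem card_wordCount_mul_prod_factorial (m : Fin n →₀ ℕ) (hm : ∑ i, m i = r) :
    (Finset.univ.filter fun f : Fin r → Fin n => wordCount f = m).card * ∏ i, (m i)! = r ! := by
  have h1 : MvPolynomial.coeff m ((∑ i, MvPolynomial.X i : MvPolynomial (Fin n) ℕ) ^ r) =
      (Finset.univ.filter fun f : Fin r → Fin n => wordCount f = m).card := by
    rw [Fintype.sum_pow, MvPolynomial.coeff_sum, Finset.card_filter]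
    refine Finset.sum_congr rfl fun f _ => ?_
    rw [prod_X_eq_monomial, MvPolynomial.coeff_monomial]
  have h2 : MvPolynomial.coeff m ((∑ i, MvPolynomial.X i : MvPolynomial (Fin n) ℕ) ^ r) =
      Nat.multinomial Finset.univ m := by
    have hX (k : Fin n → ℕ) : ∏ i, (MvPolynomial.X i : MvPolynomial (Fin n) ℕ) ^ k i =
        MvPolynomial.monomial (Finsupp.equivFunOnFinite.symm k) 1 := by
      rw [MvPolynomial.monomial_eq, MvPolynomial.C_1, one_mul, Finsupp.prod_fintype]
      · rfl
      · intro i; rw [pow_zero]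
    rw [Finset.sum_pow_eq_sum_piAntidiag, MvPolynomial.coeff_sum,
      Finset.sum_eq_single (m : Fin n → ℕ)]
    · rw [hX, ← map_natCast MvPolynomial.C, MvPolynomial.coeff_C_mul, MvPolynomial.coeff_monomial,
        if_pos (by ext; rfl), mul_one, Nat.cast_id]
    · intro k _ hk
      rw [hX, ← map_natCast MvPolynomial.C, MvPolynomial.coeff_C_mul, MvPolynomial.coeff_monomial,
        if_neg, mul_zero]
      rintro rfl
      exact hk rfl
    · intro h
      exact absurd (Finset.mem_piAntidiag.2 ⟨hm, fun i _ => Finset.mem_univ i⟩) h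
  rw [← h1, h2, mul_comm, Nat.multinomial_spec, hm]

end WordCount

/-! ### Symmetrization of powers of affine polynomials. -/

section Symmetrization

variable {n : ℕ} {L : Type*} [LieRing L] [LieAlgebra ℝ L] (b : Module.Basis (Fin n) ℝ L)

theorem symmMonomial_eq {m : Fin n →₀ ℕ} {r : ℕ} (hm : ∑ i, m i = r) :
    symmMonomial b m = PowerSeries.C (((∏ i, (m i)! : ℕ) : ℂ) / (r ! : ℂ)) •
      ∑ f : Fin r → Fin n with wordCount f = m,
        (List.ofFn fun j => toEnv (LieLambda.of 1 (b (f j)))).prod := by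
  subst hm
  simp only [symmMonomial, wordCount_eq_iff]

theorem symmetrization_monomial (m : Fin n →₀ ℕ) :
    symmetrization b (MvPolynomial.monomial m 1) = symmMonomial b m := by
  exact (MvPolynomial.basisMonomials (Fin n) (PowerSeries ℂ)).constr_basis _ _ m

/-- Expand both sides over words `f`. Symmetrizing replaces the product along `f` by the average
over its rearrangements `g`, while the scalar weight depends only on the multiplicities; after
exchanging the sums each `g` collects total weight one. -/
theorem symmetrization_linear_pow (p : Fin n → PowerSeries ℂ) (r : ℕ) :
    symmetrization b ((∑ k, p k • MvPolynomial.X k) ^ r) =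
      (∑ k, p k • toEnv (LieLambda.of 1 (b k))) ^ r := by
  have h1 : (∑ k, p k • (MvPolynomial.X k : MvPolynomial (Fin n) (PowerSeries ℂ))) ^ r =
      ∑ f : Fin r → Fin n, (∏ j, p (f j)) • MvPolynomial.monomial (wordCount f) 1 := by
    rw [Fintype.sum_pow]
    refine Finset.sum_congr rfl fun f _ => ?_
    rw [← prod_X_eq_monomial, Finset.prod_smul]
  have h2 : (∑ k, p k • toEnv (LieLambda.of 1 (b k))) ^ r =
      ∑ f : Fin r → Fin n, (∏ j, p (f j)) •
        (List.ofFn fun j => toEnv (LieLambda.of 1 (b (f j)))).prod := by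
    rw [← MultilinearMap.mkPiAlgebraFin_apply_const (R := PowerSeries ℂ), MultilinearMap.map_sum]
    refine Finset.sum_congr rfl fun f _ => ?_
    rw [MultilinearMap.map_smul_univ, MultilinearMap.mkPiAlgebraFin_apply]
  rw [h1, h2, map_sum]
  simp only [map_smul, symmetrization_monomial]
  have h3 (f : Fin r → Fin n) : (∏ j, p (f j)) • symmMonomial b (wordCount f) =
      ∑ g : Fin r → Fin n, if wordCount g = wordCount f then
        PowerSeries.C (((∏ i, (wordCount g i)! : ℕ) : ℂ) / (r ! : ℂ)) • (∏ j, p (g j)) •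
          (List.ofFn fun j => toEnv (LieLambda.of 1 (b (g j)))).prod else 0 := by
    rw [symmMonomial_eq b (sum_wordCount f), Finset.sum_filter, Finset.smul_sum, Finset.smul_sum]
    refine Finset.sum_congr rfl fun g _ => ?_
    split_ifs with h
    · rw [prod_eq_of_wordCount_eq p h, h, smul_comm]
    · rw [smul_zero, smul_zero]
  simp only [h3]
  rw [Finset.sum_comm]
  refine Finset.sum_congr rfl fun g _ => ?_
  rw [← Finset.sum_filter, Finset.sum_const, ← Nat.cast_smul_eq_nsmul (PowerSeries ℂ), smul_smul,
    ← map_natCast PowerSeries.C, ← map_mul]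
  have h4 := card_wordCount_mul_prod_factorial (wordCount g) (sum_wordCount g)
  simp only [eq_comm (a := wordCount g)]
  rw [← mul_div_assoc, ← Nat.cast_mul, h4, div_self (by exact_mod_cast r.factorial_ne_zero),
    map_one, one_smul]

/-- The constant is central, so both sides expand by the binomial formula and reduce to the linear
case. -/
theorem symmetrization_affinePoly_pow (p : Fin n → PowerSeries ℂ) (c : PowerSeries ℂ) (r : ℕ) :
    symmetrization b (affinePoly p c ^ r) =
      (∑ k, p k • toEnv (LieLambda.of 1 (b k)) + algebraMap (PowerSeries ℂ) _ c) ^ r := by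
  rw [affinePoly, add_pow, (Algebra.commute_algebraMap_right c _).add_pow, map_sum]
  refine Finset.sum_congr rfl fun i _ => ?_
  rw [← symmetrization_linear_pow, ← map_pow, ← map_pow, mul_assoc, mul_assoc,
    ← map_natCast MvPolynomial.C, ← map_mul,
    ← map_natCast (algebraMap (PowerSeries ℂ) (EnvLambda L)), ← map_mul, mul_comm, ← MvPolynomial.smul_eq_C_mul, map_smul, Algebra.smul_def,
    Algebra.commutes]

theorem toEnv_combination (p : Fin n → PowerSeries ℂ) :
    toEnv (combination b p) = ∑ k, p k • toEnv (LieLambda.of 1 (b k)) := by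
  rw [combination, toEnv, map_sum]
  refine Finset.sum_congr rfl fun k _ => ?_
  rw [toEnv, ← map_smul]
  congr 1
  change (p k ⊗ₜ[ℝ] b k : PowerSeries ℂ ⊗[ℝ] L) = p k • ((1 : PowerSeries ℂ) ⊗ₜ[ℝ] b k)
  rw [TensorProduct.smul_tmul', smul_eq_mul, mul_one]

end Symmetrization

/-! ### The integral extension equals the differential-operator extension. -/

section Formal

variable {n : ℕ}

theorem formalExp_C (q : Fin n → ℂ) :
    formalExp (fun k => PowerSeries.C (q k)) = PowerSeries.C (expFun q) := by
  have h0 : nilPart (fun k => PowerSeries.C (q k)) = 0 := by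
    simp [nilPart, linearFun]
  ext1 j
  rw [formalExp, PowerSeries.coeff_mk, truncExp, h0, Finset.sum_eq_single 0]
  · simp
  · intro i _ hi
    rw [zero_pow hi, smul_zero]
  · simp

variable {d : ℕ} {M : Type*} [TopologicalSpace M] [ChartedSpace (Euc d) M] [IsManifold (𝓡 d) ∞ M]
  {S : Deformation d M} {mom : M → Euc n} (hmom : ContMDiff (𝓡 d) (𝓡 n) ∞ mom)
  (T : MvPolynomial (Fin n) (PowerSeries ℂ) →ₗ[PowerSeries ℂ] FormalFun d M)

/-- For λ-free exponents `formalExp` is the ordinary exponential. The amplitude is thus a finite sum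
of products of a function from `exists_symbol_taylorPart_expFun` with a coefficient of `u`, and
integrating term by term reproduces the formula for `extension`. -/
theorem hasOscIntegral_extension {u : FormalFun n (Euc n)} (hu : u ∈ formalSymbolZero n) (m : ℕ)
    (x : M) : HasOscIntegral (fun z : Euc n × Euc n =>
        ∑ q ∈ Finset.HasAntidiagonal.antidiagonal m, coeffAt q.1 u z.2 *
          coeffAt q.2 (extension hmom S T
            (formalExp fun k => PowerSeries.C (Complex.I * ((z.1 k : ℝ) : ℂ)))) x)
      (coeffAt m (extension hmom S T u) x) := by
  choose f _ hval hosc using fun j r => exists_symbol_taylorPart_expFun (mom x) r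
    (evalAt x ∘ₗ symbolPart T j)
  have h := HasStrongOscIntegral.sum (s := Finset.HasAntidiagonal.antidiagonal m)
    fun q _ => HasStrongOscIntegral.sum (s := Finset.range (S.depth q.1 + 1)) fun r _ =>
      (hosc q.1 r (PowerSeries.coeff q.2 u) (hu q.2)).const_smul ((r ! : ℂ))⁻¹
  rw [coeffAt_extension]
  convert h.hasOscIntegral using 1
  swap
  · rfl
  funext z
  rw [← Finset.Nat.sum_antidiagonal_swap, Finset.sum_apply]
  refine Finset.sum_congr rfl fun q _ => ?_
  rw [formalExp_C, coeffAt, coeffAt, extension, coeff_formalMap_C, extPart_apply, Finset.mul_sum,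
    Finset.sum_apply]
  refine Finset.sum_congr rfl fun r _ => ?_
  rw [Pi.smul_apply, smul_eq_mul, tensorFun, hval, mul_left_comm, LinearMap.comp_apply,
    evalAt_apply, mul_comm ((symbolPart T q.1 _ : M → ℂ) x)]
  rfl

end Formal

/-! ### Application to the quantum moment map. -/

section MomentMap

variable {d n : ℕ} {M : Type*} [TopologicalSpace M] [ChartedSpace (Euc d) M] {G : Type*} [TopologicalSpace G] [ChartedSpace (Euc n) G]
  [Group G] [LieGroup (𝓡 n) ∞ G] [MulAction G M] {S : Deformation d M}
  (Φ : QuantumMomentMap n G S) (b : Module.Basis (Fin n) ℝ (GroupLieAlgebra (𝓡 n) G))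

namespace QuantumMomentMap

theorem toLin_pow (a : EnvLambda (GroupLieAlgebra (𝓡 n) G)) (r : ℕ) :
    Φ.toLin (a ^ r) = S.starPow (Φ.toLin a) r := by
  induction r with
  | zero => rw [pow_zero, Φ.map_one]; rfl
  | succ r ih => rw [pow_succ', Φ.map_mul, ih]; rfl

/-- The quantum moment map on symmetrized polynomials. -/
def onPolynomials : MvPolynomial (Fin n) (PowerSeries ℂ) →ₗ[PowerSeries ℂ] FormalFun d M :=
  Φ.toLin ∘ₗ symmetrization b

/-- The classical moment map `M → 𝔤^* ≅ ℝⁿ`. -/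
def classical (x : M) : Euc n :=
  WithLp.toLp 2 fun k => (coeffAt 0 (Φ.toLin (toEnv (LieLambda.of 1 (b k)))) x).re

theorem contMDiff_classical : ContMDiff (𝓡 d) (𝓡 n) ∞ (Φ.classical b) := by
  have h1 : ContMDiff (𝓡 d) 𝓘(ℝ, Fin n → ℝ) ∞ fun (x : M) (k : Fin n) =>
      (coeffAt 0 (Φ.toLin (toEnv (LieLambda.of 1 (b k)))) x).re := by
    refine contMDiff_pi_space.2 fun k => ?_
    have h2 : ContMDiff (𝓡 d) 𝓘(ℝ, ℂ) ∞
        (coeffAt 0 (Φ.toLin (toEnv (LieLambda.of 1 (b k))))) :=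
      (PowerSeries.coeff 0 (Φ.toLin (toEnv (LieLambda.of 1 (b k))))).2
    exact (Complex.reCLM.contDiff.contMDiff).comp h2
  exact ((EuclideanSpace.equiv (Fin n) ℝ).symm.contDiff.contMDiff).comp h1

theorem onPolynomials_affinePoly_pow (p : Fin n → PowerSeries ℂ) (c : PowerSeries ℂ) (r : ℕ) :
    Φ.onPolynomials b (affinePoly p c ^ r) = S.starPow (Φ.onPolynomials b (affinePoly p c)) r := by
  have h1 := symmetrization_affinePoly_pow b p c 1
  rw [pow_one, pow_one] at h1
  rw [onPolynomials, LinearMap.comp_apply, LinearMap.comp_apply, symmetrization_affinePoly_pow, h1,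
    toLin_pow]

theorem onPolynomials_affinePoly (p : Fin n → PowerSeries ℂ) :
    Φ.onPolynomials b (affinePoly p 0) = Φ.linear b p := by
  have h1 := symmetrization_affinePoly_pow b p 0 1
  rw [pow_one, pow_one, map_zero, add_zero] at h1
  rw [onPolynomials, LinearMap.comp_apply, h1, linear, toEnv_combination]

theorem isQuantization : IsQuantization S (Φ.classical b) (Φ.onPolynomials b) where
  affine_pow := Φ.onPolynomials_affinePoly_pow b
  coeff_zero k x := by
    have h1 := Φ.onPolynomials_affinePoly b (Pi.single k 1)
    have h2 : affinePoly (Pi.single k 1) 0 =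
        (MvPolynomial.X k : MvPolynomial (Fin n) (PowerSeries ℂ)) := by
      rw [affinePoly, map_zero, add_zero, Finset.sum_eq_single k]
      · rw [Pi.single_eq_same, one_smul]
      · intro i _ hi
        rw [Pi.single_eq_of_ne hi, zero_smul]
      · simp
    have h3 : (∑ i, (Pi.single k 1 : Fin n → PowerSeries ℂ) i •
        toEnv (LieLambda.of 1 (b i))) = toEnv (LieLambda.of 1 (b k)) := by
      rw [Finset.sum_eq_single k]
      · rw [Pi.single_eq_same, one_smul]
      · intro i _ hi
        rw [Pi.single_eq_of_ne hi, zero_smul]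
      · simp
    rw [h2, linear, toEnv_combination, h3] at h1
    rw [h1]
    -- `classical` records only real parts; nothing is lost because the classical moment map is
    -- real-valued.
    exact Complex.ext rfl (Φ.classical_real (b k) x)

theorem isExtension_extension [IsManifold (𝓡 d) ∞ M] {u : FormalFun n (Euc n)}
    (hu : u ∈ formalSymbolZero n) :
    Φ.IsExtension b u (extension (Φ.contMDiff_classical b) S (Φ.onPolynomials b) u) := by
  refine ⟨hu, fun ν => extension (Φ.contMDiff_classical b) S (Φ.onPolynomials b)
    (formalExp fun k => PowerSeries.C (Complex.I * ((ν k : ℝ) : ℂ))), fun ν => ?_,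
    hasOscIntegral_extension _ _ hu⟩
  rw [← onPolynomials_affinePoly]
  exact (Φ.isQuantization b).isStarExp _ _

end QuantumMomentMap

end MomentMap

end QMM

end

theorem mainTheorem7 {d n : ℕ}
    {M : Type*} [TopologicalSpace M] [T2Space M] [SecondCountableTopology M]
    [ChartedSpace (QMM.Euc d) M] [IsManifold (𝓡 d) ∞ M]
    {G : Type*} [TopologicalSpace G] [T2Space G] [SecondCountableTopology G]
    [ChartedSpace (QMM.Euc n) G] [Group G] [LieGroup (𝓡 n) ∞ G] [MulAction G M]
    (Ω : QMM.SymplecticForm d M) (hG : QMM.IsSymplecticAction n G Ω)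
    (S : QMM.Deformation d M) (hS : QMM.IsStarProduct Ω S) (hSG : QMM.IsInvariant hG S)
    (Φ : QMM.QuantumMomentMap n G S)
    (b : Module.Basis (Fin n) ℝ (GroupLieAlgebra (𝓡 n) G)) :
    (∀ p : Fin n → PowerSeries ℂ, (∀ k, (PowerSeries.constantCoeff (p k)).re = 0) →
      ∃ (e : QMM.FormalFun n (QMM.Euc n)) (E : QMM.FormalFun d M),
        QMM.IsFormalExp (QMM.linearFun p) e ∧
        (∀ j, QMM.InSymbolClassZero (QMM.coeffAt j e)) ∧
        S.IsStarExp (Φ.linear b p) E ∧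
        Φ.IsExtension b e E) ∧
    (∀ gutt : QMM.Deformation n (QMM.Euc n), QMM.IsGutt b gutt →
      ∀ p r : Fin n → PowerSeries ℂ,
        (∀ k, (PowerSeries.constantCoeff (p k)).re = 0) →
        (∀ k, (PowerSeries.constantCoeff (r k)).re = 0) →
        ∃ (e₁ e₂ : QMM.FormalFun n (QMM.Euc n)) (F₁ F₂ : QMM.FormalFun d M),
          QMM.IsFormalExp (QMM.linearFun p) e₁ ∧ QMM.IsFormalExp (QMM.linearFun r) e₂ ∧
          Φ.IsExtension b e₁ F₁ ∧ Φ.IsExtension b e₂ F₂ ∧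
          Φ.IsExtension b (gutt.star e₁ e₂) (S.star F₁ F₂)) := by
  refine ⟨fun p hp => ?_, fun gutt hgutt p r hp hr => ?_⟩
  · refine ⟨QMM.formalExp p, _, QMM.isFormalExp_formalExp p,
      QMM.formalExp_mem_formalSymbolZero hp, ?_,
      Φ.isExtension_extension b (QMM.formalExp_mem_formalSymbolZero hp)⟩
    rw [← Φ.onPolynomials_affinePoly]
    exact (Φ.isQuantization b).isStarExp _ _
  · have hp' := QMM.formalExp_mem_formalSymbolZero hp
    have hr' := QMM.formalExp_mem_formalSymbolZero hr
    refine ⟨QMM.formalExp p, QMM.formalExp r, _, _, QMM.isFormalExp_formalExp p,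
      QMM.isFormalExp_formalExp r, Φ.isExtension_extension b hp', Φ.isExtension_extension b hr', ?_⟩
    -- Once the star product on M is rewritten as the extension of the Gutt product, the claim is
    -- the integral formula for an element of 𝒜⁰[[λ]].
    rw [← (Φ.isQuantization b).extension_star (Φ.contMDiff_classical b) fun P Q => ?_]
    · refine Φ.isExtension_extension b (QMM.star_mem_formalSymbolZero (fun P Q => ?_) hp' hr')
      obtain ⟨W, -, hW⟩ := hgutt P Q
      exact ⟨W, hW⟩
    · obtain ⟨W, hW, hW'⟩ := hgutt P Q
      refine ⟨W, hW', ?_⟩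
      change Φ.toLin _ = _
      rw [hW, Φ.map_mul]
      rfl
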